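/- Let $k$ be a field of characteristic $0$. A QED graph has trivalent vertices, at which one photon line and two (unoriented) electron lines meet, internal lines of these two types, and labelled external lines; its residue is the vertex (one external photon, two external electrons; written $v$), the electron line (two external electrons; $\mathrm{el}$) or the photon line (two external photons; $\mathrm{ph}$). It is 1PI if it is connected, not a tree, and remains connected when any one internal line is removed. $\mathrm{Sym}(\Gamma)$ is the number of automorphisms of $\Gamma$ respecting the types and fixing the external lines; for a disjoint union $\gamma$ in which the pairwise non-isomorphic 1PI graphs $\gamma_i$ occur $n_i$ times, $\mathrm{Sym}(\gamma)=\prod_i n_i!\,\mathrm{Sym}(\gamma_i)^{n_i}$. Let $n_{\gamma,r}$ be the number of components of $\gamma$ with residue $r$. Loop numbers are additive over components. Let $H$ be the Hopf algebra of QED graphs: the free commutative $k$-algebra on the isomorphism classes of 1PI QED graphs with labelled external lines (the empty graph is $1$), with the algebra maps $\epsilon$, $\Delta$, $S$ given on 1PI graphs $\Gamma$ by $\epsilon(\Gamma)=0$ and $$\Delta(\Gamma)=\Gamma\otimes 1+1\otimes\Gamma+\sum_{\emptyset\ne\gamma\subsetneq\Gamma}\gamma\otimes\Gamma/\gamma,\qquad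 S(\Gamma)=-\Gamma-\sum_{\emptyset\neq\gamma\subsetneq\Gamma}S(\gamma)\,\Gamma/\gamma .$$ Here $\gamma$ runs over the subgraphs that are disjoint unions of 1PI graphs with residues $v,\mathrm{el},\mathrm{ph}$. In $\Gamma/\gamma$ each vertex graph in $\gamma$ is contracted to a vertex and each self-energy graph to a line. As an element of $H$, $\gamma$ is the product over its components of the average of the non-isomorphic graphs obtained by labelling the external lines of the component. Set $G^r_0=1$ and, for $L\ge1$, $G^{v}_L=\sum_\Gamma \Gamma/\mathrm{Sym}(\Gamma)$ and $G^{\mathrm{el}}_L=-\sum_\Gamma \Gamma/\mathrm{Sym}(\Gamma)$, the sums being over the 1PI graphs with $L$ loops and residue $v$, respectively $\mathrm{el}$. The Ward elements are $W_L=G^{v}_L-G^{\mathrm{el}}_L$; in particular $W_0=0$. Put $$c(L,\gamma)=n_{\gamma,v}!\binom{2L}{n_{\gamma,v}}\,n_{\gamma,\mathrm{el}}!\binom{2L+n_{\gamma,\mathrm{el}}-1}{n_{\gamma,\mathrm{el}}}\,n_{\gamma,\mathrm{ph}}!\binom{L+n_{\gamma,\mathrm{ph}}-1}{n_{\gamma,\mathrm{ph}}},$$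 and, for $L\ge 1$, let $$(L,\mathrm{el}\,|\,\gamma)=n_{\gamma,v}!\binom{2L}{n_{\gamma,v}}\,n_{\gamma,\mathrm{el}}!\binom{2L+n_{\gamma,\mathrm{el}}-2}{n_{\gamma,\mathrm{el}}}\,n_{\gamma,\mathrm{ph}}!\binom{L+n_{\gamma,\mathrm{ph}}-1}{n_{\gamma,\mathrm{ph}}}$$ be the number of insertion places for $\gamma$ in a 1PI electron self-energy graph with $L$ loops (its value for $L=0$ is irrelevant below, as $W_0=0$). Binomial coefficients $\binom{-1}{0}$ are $1$. Theorem. For all $L\ge0$, $$\Delta(W_L)=\sum_{\substack{K,K'\ge0\\K+K'\le L}}\ \sum_{\gamma_{K'}}\frac{c(L-K-K',\gamma)}{\mathrm{Sym}(\gamma)}\,W_K\,\gamma\otimes G^{v}_{L-K-K'}+\sum_{K=0}^{L}\ \sum_{\gamma_K}\frac{(L-K,\mathrm{el}\,|\,\gamma)}{\mathrm{Sym}(\gamma)}\,\gamma\otimes W_{L-K},$$ where $\gamma_{K}$ runs over the disjoint unions of 1PI graphs (including the empty graph) with total loop number $K$. Consequently the ideal $I$ of $H$ generated by all $W_L$ is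 a Hopf ideal: $$\Delta(I)\subseteq I\otimes H+H\otimes I,\qquad \epsilon(I)=0,\qquad S(I)\subseteq I.$$ -/

import Mathlib

open scoped TensorProduct

namespace QED

/-! ### Feynman graphs of quantum electrodynamics -/

/-- The two types of lines. -/
inductive LineType
  | electron
  | photon
  deriving DecidableEq

/-- The vertex and the two types of lines, i.e. the possible residues of a graph. -/
inductive Residue
  | vertex
  | electron
  | photon
  deriving DecidableEq

instance : Fintype LineType :=
  ⟨{.electron, .photon}, fun t => by cases t <;> simp⟩

instance : Fintype Residue :=
  ⟨{.vertex, .electron, .photon}, fun r => by cases r <;> simp⟩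

/-- The number `N` of external lines of a graph with the given residue. -/
def Residue.numExt : Residue → ℕ
  | .vertex => 3
  | .electron => 2
  | .photon => 2

/-- The types of the labelled external lines of a graph with the given residue. -/
def Residue.extType : (r : Residue) → Fin r.numExt → LineType
  | .vertex => ![.photon, .electron, .electron]
  | .electron => ![.electron, .electron]
  | .photon => ![.photon, .photon]

/-- The raw data of a graph with external structure `r`: a finite set `V` of vertices, a finite set
`E` of lines, the type of each line, and the unordered family `{∂₀ e, ∂₁ e}` of the ends of
each line `e`. An end is a vertex or one of the labels of the external lines. That there are
exactly two ends, and the compatibility with the types, is the predicate `IsFeynmanGraph`. -/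
structure Diagram (r : Residue) : Type 1 where
  V : Type
  E : Type
  [fintypeV : Fintype V]
  [fintypeE : Fintype E]
  lineType : E → LineType
  ends : E → Multiset (V ⊕ Fin r.numExt)

attribute [instance] Diagram.fintypeV Diagram.fintypeE

namespace Diagram

variable {r : Residue}

open scoped Classical in
/-- The number of ends at `x` of lines of type `t`. -/
noncomputable def valence (G : Diagram r) (x : G.V ⊕ Fin r.numExt) (t : LineType) : ℕ :=
  ∑ e : G.E with G.lineType e = t, (G.ends e).count x

/-- Every line has two ends, two electron lines and one photon line meet at each vertex, and
each label is the end of exactly one external line, which has the prescribed type. -/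
structure IsFeynmanGraph (G : Diagram r) : Prop where
  card_ends : ∀ e, (G.ends e).card = 2
  electrons : ∀ v, G.valence (.inl v) .electron = 2
  photons : ∀ v, G.valence (.inl v) .photon = 1
  external : ∀ j t, G.valence (.inr j) t = if r.extType j = t then 1 else 0

/-- `x` and `y` are the two ends of a line that does not belong to `D`. -/
def Adj (G : Diagram r) (D : Set G.E) (x y : G.V ⊕ Fin r.numExt) : Prop :=
  ∃ e ∉ D, G.ends e = {x, y}

/-- The graph is connected after removal of the lines in `D`. -/
def ConnectedWithout (G : Diagram r) (D : Set G.E) : Prop :=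
  ∀ x y, Relation.ReflTransGen (G.Adj D) x y

/-- A line is internal if both its ends are vertices. -/
def IsInternal (G : Diagram r) (e : G.E) : Prop :=
  ∃ v w : G.V, G.ends e = {.inl v, .inl w}

/-- The loop number of a connected graph. The external lines have their labels as additional end
points, so each of them adds one line and one point, and this is also
`(number of internal lines) - (number of vertices) + 1`. -/
noncomputable def loops (G : Diagram r) : ℕ :=
  Fintype.card G.E + 1 - (Fintype.card G.V + r.numExt)

/-- One-particle irreducible Feynman graphs: connected, not a tree, and still connected after
removal of any single internal line. -/
structure IsOnePI (G : Diagram r) : Prop where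
  isFeynmanGraph : G.IsFeynmanGraph
  connected : G.ConnectedWithout ∅
  not_tree : 0 < G.loops
  irreducible : ∀ e, G.IsInternal e → G.ConnectedWithout {e}

/-- Isomorphisms of graphs. They respect the types of the lines and fix the labels of the
external lines (hence also the external lines themselves, in the case of automorphisms). -/
structure Iso (G G' : Diagram r) where
  onV : G.V ≃ G'.V
  onE : G.E ≃ G'.E
  lineType_eq : ∀ e, G'.lineType (onE e) = G.lineType e
  ends_eq : ∀ e, G'.ends (onE e) = (G.ends e).map (Sum.map onV id)

/-- The symmetry factor: the order of the automorphism group. -/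
noncomputable def sym (G : Diagram r) : ℕ := Nat.card (Iso G G)

def Iso.refl (G : Diagram r) : Iso G G where
  onV := Equiv.refl _
  onE := Equiv.refl _
  lineType_eq _ := rfl
  ends_eq e := by simp

def Iso.trans {G G' G'' : Diagram r} (f : Iso G G') (g : Iso G' G'') : Iso G G'' where
  onV := f.onV.trans g.onV
  onE := f.onE.trans g.onE
  lineType_eq e := by simp [g.lineType_eq, f.lineType_eq]
  ends_eq e := by simp [g.ends_eq, f.ends_eq]

def Iso.symm {G G' : Diagram r} (f : Iso G G') : Iso G' G where
  onV := f.onV.symm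
  onE := f.onE.symm
  lineType_eq e := by rw [← f.lineType_eq]; simp
  ends_eq e := by
    have h := f.ends_eq (f.onE.symm e)
    simp only [Equiv.apply_symm_apply] at h
    simp [h]

end Diagram

instance onePISetoid (r : Residue) : Setoid {G : Diagram r // G.IsOnePI} where
  r G G' := Nonempty (Diagram.Iso G.1 G'.1)
  iseqv :=
    ⟨fun G => ⟨Diagram.Iso.refl G.1⟩, fun ⟨f⟩ => ⟨f.symm⟩, fun ⟨f⟩ ⟨g⟩ => ⟨f.trans g⟩⟩

/-- 1PI graphs, with labelled external lines and residue `r` in `R`, up to isomorphism. -/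
def OnePI : Type 1 := Σ r : Residue, Quotient (onePISetoid r)

namespace OnePI

def res (g : OnePI) : Residue := g.1

/-- A graph in the isomorphism class `g`. -/
noncomputable def graph (g : OnePI) : Diagram g.res := (Quotient.out g.2).1

/-- The isomorphism class of a 1PI graph. -/
def mk {r : Residue} (G : Diagram r) (h : G.IsOnePI) : OnePI := ⟨r, ⟦⟨G, h⟩⟧⟩

noncomputable def loops (g : OnePI) : ℕ := g.graph.loops

noncomputable def sym (g : OnePI) : ℕ := g.graph.sym

theorem graph_isOnePI (g : OnePI) : g.graph.IsOnePI := (Quotient.out g.2).2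

theorem nonempty_iso_graph_mk {r : Residue} (G : Diagram r) (h : G.IsOnePI) :
    Nonempty (Diagram.Iso (mk G h).graph G) :=
  Quotient.mk_out (s := onePISetoid r) ⟨G, h⟩

theorem eq_of_iso {g g' : OnePI} (h : g.res = g'.res)
    (f : Nonempty (Diagram.Iso (h ▸ g.graph) g'.graph)) : g = g' := by
  obtain ⟨r, q⟩ := g
  obtain ⟨r', q'⟩ := g'
  change r = r' at h
  subst h
  have : (⟦q.out⟧ : Quotient (onePISetoid r)) = ⟦q'.out⟧ := Quotient.sound f
  rw [Quotient.out_eq, Quotient.out_eq] at this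
  rw [this]

end OnePI

/-! ### Finitely many graphs at each loop order -/

namespace Diagram

theorem two_mul_card_E {r : Residue} {G : Diagram r} (h : G.IsFeynmanGraph) :
    2 * Fintype.card G.E = 3 * Fintype.card G.V + r.numExt := by
  classical
  have key : ∀ x, ∑ e, (G.ends e).count x = G.valence x .electron + G.valence x .photon := by
    intro x
    unfold valence
    rw [← Finset.sum_filter_add_sum_filter_not Finset.univ (fun e => G.lineType e = .electron)]
    congr 1
    refine Finset.sum_congr (Finset.filter_congr fun e _ => ?_) fun _ _ => by congr
    cases G.lineType e <;> simp
  have h1 : ∑ e : G.E, (G.ends e).card = 2 * Fintype.card G.E := by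
    simp [h.card_ends, mul_comm]
  have h2 : ∑ e : G.E, (G.ends e).card
      = ∑ x : G.V ⊕ Fin r.numExt, ∑ e : G.E, (G.ends e).count x := by
    rw [Finset.sum_comm]
    refine Finset.sum_congr rfl fun e _ => ?_
    rw [Multiset.sum_count_eq_card]
    simp
  have h3 : ∀ j, G.valence (.inr j) .electron + G.valence (.inr j) .photon = 1 := by
    intro j
    rw [h.external, h.external]
    cases r.extType j <;> simp
  rw [← h1, h2, Fintype.sum_sum_type]
  simp [key, h.electrons, h.photons, h3, mul_comm]

end Diagram

theorem finite_onePI (r : Residue) (L : ℕ) :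
    {g : OnePI | g.res = r ∧ g.loops = L}.Finite := by
  classical
  have main : ∀ g : {g : OnePI | g.res = r ∧ g.loops = L},
      ∃ c : Σ n : Fin (2 * L + 4), Σ m : Fin (3 * L + 9),
        (Fin m → LineType) × (Fin m → Sym (Fin n ⊕ Fin r.numExt) 2),
      Nonempty (Diagram.Iso (g.2.1 ▸ g.1.graph)
        { V := Fin c.1, E := Fin c.2.1, lineType := c.2.2.1,
          ends := fun e => (c.2.2.2 e : Multiset _) }) := by
    rintro ⟨g, hr, hL⟩
    subst hr
    have hG := g.graph_isOnePI
    have h2 := Diagram.two_mul_card_E hG.isFeynmanGraph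
    have h0 := hG.not_tree
    change g.graph.loops = L at hL
    rw [hL] at h0
    unfold Diagram.loops at hL
    have hN : g.res.numExt ≤ 3 := by cases g.res <;> simp [Residue.numExt]
    let fV := Fintype.equivFin g.graph.V
    let fE := Fintype.equivFin g.graph.E
    refine ⟨⟨⟨Fintype.card g.graph.V, by lia⟩, ⟨Fintype.card g.graph.E, by lia⟩,
      fun e => g.graph.lineType (fE.symm e),
      fun e => ⟨(g.graph.ends (fE.symm e)).map (Sum.map fV id), by
        simpa using hG.isFeynmanGraph.card_ends (fE.symm e)⟩⟩, ⟨⟨fV, fE, ?_, ?_⟩⟩⟩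
    · intro e; simp
    · intro e; simp
  choose code hcode using main
  refine Set.finite_coe_iff.mp (Finite.of_injective code ?_)
  rintro ⟨g, hr, hL⟩ ⟨g', hr', hL'⟩ hc
  have h1 := hcode ⟨g, hr, hL⟩
  have h2 := hcode ⟨g', hr', hL'⟩
  rw [hc] at h1
  obtain ⟨f1⟩ := h1
  obtain ⟨f2⟩ := h2
  have hrr := hr'
  subst hrr
  exact Subtype.ext (OnePI.eq_of_iso hr ⟨f1.trans f2.symm⟩)

/-- The 1PI graphs with residue `r` and loop number `L`. -/
noncomputable def onePIGraphs (r : Residue) (L : ℕ) : Finset OnePI :=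
  (finite_onePI r L).toFinset

/-! ### Disjoint unions of 1PI graphs -/

/-- A disjoint union of 1PI graphs: each isomorphism class is given with its multiplicity. -/
abbrev GraphUnion : Type 1 := OnePI →₀ ℕ

namespace GraphUnion

noncomputable def loops (γ : GraphUnion) : ℕ := γ.sum fun g n => n * g.loops

/-- The number of connected components with residue `r`. -/
noncomputable def num (γ : GraphUnion) (r : Residue) : ℕ :=
  γ.sum fun g n => if g.res = r then n else 0

/-- The symmetry factor of a disjoint union: `n₁! ⋯ nₖ! Sym(γ₁)^n₁ ⋯ Sym(γₖ)^nₖ` if `γᵢ` occurs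
`nᵢ` times. -/
noncomputable def sym (γ : GraphUnion) : ℕ := γ.prod fun g n => n.factorial * g.sym ^ n

end GraphUnion

theorem finite_unions (K : ℕ) : {γ : GraphUnion | GraphUnion.loops γ = K}.Finite := by
  classical
  let T : Finset OnePI :=
    Finset.univ.biUnion fun r : Residue => (Finset.range (K + 1)).biUnion fun L => onePIGraphs r L
  let b : OnePI →₀ ℕ := Finsupp.indicator T fun _ _ => K
  refine (Set.finite_Iic b).subset ?_
  intro γ hγ g
  by_cases hg : γ g = 0
  · rw [hg]; exact Nat.zero_le _
  have hpos : 0 < g.loops := g.graph_isOnePI.not_tree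
  have hle : γ g * g.loops ≤ K := by
    rw [← (show GraphUnion.loops γ = K from hγ)]
    exact Finset.single_le_sum (f := fun g => γ g * g.loops) (fun _ _ => Nat.zero_le _)
      (Finsupp.mem_support_iff.mpr hg)
  have hmem : g ∈ T := by
    simp only [T, Finset.mem_biUnion, Finset.mem_univ, true_and, Finset.mem_range, onePIGraphs,
      Set.Finite.mem_toFinset, Set.mem_ofPred_eq]
    exact ⟨g.res, g.loops, by nlinarith [Nat.pos_of_ne_zero hg], rfl, rfl⟩
  have : b g = K := by simp [b, Finsupp.indicator_of_mem hmem]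
  rw [this]
  nlinarith

/-- The disjoint unions of 1PI graphs (including the empty graph) at loop order `K`. -/
noncomputable def unions (K : ℕ) : Finset GraphUnion := (finite_unions K).toFinset

/-! ### Subgraphs and contraction -/

namespace Diagram

variable {r : Residue}

open scoped Classical in
/-- The line `e` has exactly one end in the set `S` of vertices: it is an external line of the
subgraph on `S`. -/
def IsBoundary (G : Diagram r) (S : Finset G.V) (e : G.E) : Prop :=
  (G.ends e).countP (fun x => ∃ v ∈ S, x = .inl v) = 1

/-- All ends of `e` lie in `S`: it is an internal line of the subgraph on `S`. -/
def IsInside (G : Diagram r) (S : Finset G.V) (e : G.E) : Prop :=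
  ∀ x ∈ G.ends e, ∃ v ∈ S, x = .inl v

open scoped Classical in
/-- The subgraph of `G` consisting of the vertices in `S` and all lines meeting them, with a
labelling `lam` of its external lines. -/
noncomputable def sub (G : Diagram r) (S : Finset G.V) (r' : Residue)
    (lam : {e // G.IsBoundary S e} ≃ Fin r'.numExt) : Diagram r' where
  V := {v // v ∈ S}
  E := {e : G.E // ∃ v ∈ S, .inl v ∈ G.ends e}
  lineType e := G.lineType e.1
  ends e :=
    (G.ends e.1).filterMap
      (Sum.elim (fun v => if h : v ∈ S then some (.inl ⟨v, h⟩) else none) (fun _ => none)) +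
    if h : G.IsBoundary S e.1 then {.inr (lam ⟨e.1, h⟩)} else 0

/-- The ways to label the external lines of the subgraph on `S` such that a 1PI graph
with residue in `R` results. -/
def Labelling (G : Diagram r) (S : Finset G.V) : Type :=
  Σ r' : Residue, {lam : {e // G.IsBoundary S e} ≃ Fin r'.numExt // (G.sub S r' lam).IsOnePI}

open scoped Classical in
noncomputable instance (G : Diagram r) (S : Finset G.V) : Fintype (G.Labelling S) := by
  unfold Labelling
  infer_instance

noncomputable def Labelling.cls {G : Diagram r} {S : Finset G.V} (l : G.Labelling S) : OnePI :=
  OnePI.mk (G.sub S l.1 l.2.1) l.2.2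

open scoped Classical in
/-- The non-isomorphic graphs that arise from the subgraph `γ` on `S` by labelling its external
lines. Their number is `|γ|_∨`. -/
noncomputable def labelled (G : Diagram r) (S : Finset G.V) : Finset OnePI :=
  Finset.univ.image (Labelling.cls (G := G) (S := S))

/-- The subgraph on `S` is a 1PI graph with residue the vertex. -/
def IsVertexSub (G : Diagram r) (S : Finset G.V) : Prop :=
  ∃ l : G.Labelling S, l.1 = .vertex

/-- The subgraphs `γ` of `G` that are disjoint unions of 1PI graphs with residues in `R`. They are
given by the set of the vertex sets of their connected components. (In a 1PI graph, a line that
joins two vertices of a connected component of `γ` must belong to `γ`: it would otherwise provide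
two of the at most three external lines of this component, which would then be attached to the rest
of the graph by at most one line.) -/
def IsSubgraph (G : Diagram r) (A : Finset (Finset G.V)) : Prop :=
  (∀ S ∈ A, Nonempty (G.Labelling S)) ∧ (A : Set (Finset G.V)).PairwiseDisjoint id

open scoped Classical in
/-- The subgraphs of `G` other than the empty graph and `G` itself. -/
noncomputable def properSubgraphs (G : Diagram r) : Finset (Finset (Finset G.V)) :=
  Finset.univ.filter fun A => G.IsSubgraph A ∧ A ≠ ∅ ∧ Finset.univ ∉ A

/-- The vertices of `G/γ`: the vertices outside `γ`, and one for each vertex graph in `γ`. -/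
abbrev ContractV (G : Diagram r) (A : Finset (Finset G.V)) : Type :=
  {v : G.V // ∀ S ∈ A, v ∉ S} ⊕ {S : Finset G.V // S ∈ A ∧ G.IsVertexSub S}

open scoped Classical in
/-- The image in `G/γ` of the vertices and labels of `G`. Vertices in self-energy graphs
disappear. -/
noncomputable def contractPoint (G : Diagram r) (A : Finset (Finset G.V)) :
    G.V ⊕ Fin r.numExt → Option (G.ContractV A ⊕ Fin r.numExt)
  | .inr j => some (.inr j)
  | .inl v =>
    if h : ∀ S ∈ A, v ∉ S then some (.inl (.inl ⟨v, h⟩))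
    else if h : ∃ S, (S ∈ A ∧ G.IsVertexSub S) ∧ v ∈ S then
      some (.inl (.inr ⟨h.choose, h.choose_spec.1⟩))
    else none

/-- Two lines are the external lines of a common self-energy graph in `γ`. (These have the same
type.) -/
def Joined (G : Diagram r) (A : Finset (Finset G.V))
    (e e' : {e : G.E // ∀ S ∈ A, ¬ G.IsInside S e}) : Prop :=
  G.lineType e.1 = G.lineType e'.1 ∧
    ∃ S ∈ A, ¬ G.IsVertexSub S ∧ G.IsBoundary S e.1 ∧ G.IsBoundary S e'.1

open scoped Classical in
/-- The graph `G/γ`. Each vertex graph in `γ` is contracted to a vertex, and each self-energy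
graph to a line: its two external lines (and more generally all the lines that are connected by a
chain of self-energy graphs) become one line. -/
noncomputable def contract (G : Diagram r) (A : Finset (Finset G.V)) : Diagram r where
  V := G.ContractV A
  E := Quot (G.Joined A)
  fintypeE := Fintype.ofFinite _
  lineType := Quot.lift (fun e => G.lineType e.1) fun _ _ h => h.1
  ends c :=
    ∑ e : {e : G.E // ∀ S ∈ A, ¬ G.IsInside S e} with Quot.mk (G.Joined A) e = c,
      (G.ends e.1).filterMap (G.contractPoint A)

end Diagram

/-! ### The Hopf algebra -/

section Hopf

variable (k : Type*) [Field k]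

/-- The free commutative algebra generated by the 1PI graphs. -/
abbrev H := MvPolynomial OnePI k

/-- A disjoint union of 1PI graphs as an element of `H`. -/
noncomputable def GraphUnion.toH (γ : GraphUnion) : H k := MvPolynomial.monomial γ 1

variable {r : Residue}

open scoped Classical in
/-- The generator given by a graph. (It is used for `G/γ`, which is a 1PI graph if `G` is one and
`γ` is a proper subgraph of `G`.) -/
noncomputable def Diagram.toH (G : Diagram r) : H k :=
  if h : G.IsOnePI then MvPolynomial.X (OnePI.mk G h) else 0

/-- The element of `H` given by a connected subgraph `γ`. Its external lines carry no labels, so it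
is understood as the sum of the `|γ|_∨` graphs obtained by labelling them, divided by
`|γ|_∨`. -/
noncomputable def Diagram.componentToH (G : Diagram r) (S : Finset G.V) : H k :=
  ((G.labelled S).card : k)⁻¹ • ∑ g ∈ G.labelled S, MvPolynomial.X g

/-- The element of `H` given by a subgraph. -/
noncomputable def Diagram.subgraphToH (G : Diagram r) (A : Finset (Finset G.V)) : H k :=
  ∏ S ∈ A, G.componentToH k S

/-- The coproduct: `Δ(Γ) = Γ ⊗ 1 + 1 ⊗ Γ + ∑ γ ⊗ Γ/γ`. -/
noncomputable def coproduct : H k →ₐ[k] H k ⊗[k] H k :=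
  MvPolynomial.aeval fun g : OnePI =>
    MvPolynomial.X g ⊗ₜ[k] 1 + 1 ⊗ₜ[k] MvPolynomial.X g +
      ∑ A ∈ g.graph.properSubgraphs,
        g.graph.subgraphToH k A ⊗ₜ[k] (g.graph.contract A).toH k

/-- The counit: it vanishes on all nonempty graphs. -/
noncomputable def counit : H k →ₐ[k] k := MvPolynomial.aeval fun _ : OnePI => (0 : k)

/-- The antipode on the graphs with fewer than `n` vertices. -/
noncomputable def antipodeAux : ℕ → (H k →ₐ[k] H k)
  | 0 => MvPolynomial.aeval fun _ => 0
  | n + 1 => MvPolynomial.aeval fun g : OnePI =>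
      -MvPolynomial.X g -
        ∑ A ∈ g.graph.properSubgraphs,
          antipodeAux n (g.graph.subgraphToH k A) * (g.graph.contract A).toH k

/-- The antipode. It is the algebra map with the recursive description `antipode_X`. -/
noncomputable def antipode : H k →ₐ[k] H k :=
  MvPolynomial.aeval fun g : OnePI =>
    antipodeAux k (Fintype.card g.graph.V + 1) (MvPolynomial.X g)

theorem card_V_of_mem_labelled {G : Diagram r} {S : Finset G.V} {g : OnePI}
    (hg : g ∈ G.labelled S) : Fintype.card g.graph.V = S.card := by
  classical
  simp only [Diagram.labelled, Finset.mem_image, Finset.mem_univ, true_and] at hg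
  obtain ⟨l, rfl⟩ := hg
  obtain ⟨f⟩ := OnePI.nonempty_iso_graph_mk _ l.2.2
  calc Fintype.card (Diagram.Labelling.cls l).graph.V
      = Nat.card (Diagram.Labelling.cls l).graph.V := Nat.card_eq_fintype_card.symm
    _ = Nat.card {v // v ∈ S} := Nat.card_congr f.onV
    _ = S.card := by simp

theorem map_subgraphToH_congr {G : Diagram r} {A : Finset (Finset G.V)}
    (hA : A ∈ G.properSubgraphs) {f f' : H k →ₐ[k] H k}
    (h : ∀ g : OnePI, Fintype.card g.graph.V < Fintype.card G.V →
      f (MvPolynomial.X g) = f' (MvPolynomial.X g)) :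
    f (G.subgraphToH k A) = f' (G.subgraphToH k A) := by
  classical
  simp only [Diagram.properSubgraphs, Finset.mem_filter, Finset.mem_univ, true_and] at hA
  simp only [Diagram.subgraphToH, map_prod, Diagram.componentToH, map_smul, map_sum]
  refine Finset.prod_congr rfl fun S hS => ?_
  congr 1
  refine Finset.sum_congr rfl fun g hg => h g ?_
  rw [card_V_of_mem_labelled hg]
  refine lt_of_le_of_ne (Finset.card_le_univ S) fun hc => hA.2.2 ?_
  rwa [← (Finset.card_eq_iff_eq_univ S).mp hc]

theorem antipodeAux_X (n m : ℕ) (g : OnePI) (hn : Fintype.card g.graph.V < n)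
    (hm : Fintype.card g.graph.V < m) :
    antipodeAux k n (MvPolynomial.X g) = antipodeAux k m (MvPolynomial.X g) := by
  induction n generalizing m g with
  | zero => lia
  | succ n ih =>
    obtain _ | m := m
    · lia
    simp only [antipodeAux, MvPolynomial.aeval_X]
    congr 1
    refine Finset.sum_congr rfl fun A hA => ?_
    congr 1
    exact map_subgraphToH_congr k hA fun g' hg' => ih m g' (by lia) (by lia)

/-- `S(Γ) = - Γ - ∑ S(γ) Γ/γ`. -/
theorem antipode_X (g : OnePI) :
    antipode k (MvPolynomial.X g) = -MvPolynomial.X g -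
      ∑ A ∈ g.graph.properSubgraphs,
        antipode k (g.graph.subgraphToH k A) * (g.graph.contract A).toH k := by
  conv_lhs => simp only [antipode, MvPolynomial.aeval_X, antipodeAux]
  congr 1
  refine Finset.sum_congr rfl fun A hA => ?_
  congr 1
  refine map_subgraphToH_congr k hA fun g' hg' => ?_
  simp only [antipode, MvPolynomial.aeval_X]
  exact antipodeAux_X k _ _ g' hg' (by lia)

/-! ### Green's functions and Ward elements -/

/-- The sign with which the graphs with residue `r` occur in the Green's function. -/
def Residue.sign : Residue → ℤ
  | .vertex => 1
  | .electron => -1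
  | .photon => -1

/-- The 1PI Green's function `G^r_L` at loop order `L`. -/
noncomputable def green (r : Residue) (L : ℕ) : H k :=
  if L = 0 then 1
  else (r.sign : k) • ∑ g ∈ onePIGraphs r L, (g.sym : k)⁻¹ • MvPolynomial.X g

/-- The Ward elements. -/
noncomputable def ward (L : ℕ) : H k := green k .vertex L - green k .electron L

/-- The ideal generated by the Ward elements. -/
noncomputable def wardIdeal : Ideal (H k) := Ideal.span (Set.range (ward k))

/-- The subspace `I ⊗ H + H ⊗ I` of `H ⊗ H`. -/
noncomputable def tensorIdeal (I : Ideal (H k)) : Submodule k (H k ⊗[k] H k) :=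
  LinearMap.range ((I.restrictScalars k).subtype.rTensor (H k)) ⊔
    LinearMap.range ((I.restrictScalars k).subtype.lTensor (H k))

end Hopf

open Nat in
/-- The coefficient `c(L, γ)`. -/
noncomputable def wardCoeff (L : ℕ) (γ : GraphUnion) : ℕ :=
  (γ.num .vertex)! * (2 * L).choose (γ.num .vertex) *
  ((γ.num .electron)! * (2 * L + γ.num .electron - 1).choose (γ.num .electron)) *
  ((γ.num .photon)! * (L + γ.num .photon - 1).choose (γ.num .photon))

open Nat in
/-- The number of insertion places for `γ` in a graph `Γ` with residue `r`, which has `m v`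
vertices, `m e` internal electron lines and `m p` internal photon lines: components that are vertex
graphs go to different vertices, whereas self-energy graphs may go to the same internal line. -/
noncomputable def insertionPlaces (m : Residue → ℕ) (γ : GraphUnion) : ℕ :=
  (γ.num .vertex)! * (m .vertex).choose (γ.num .vertex) *
  ((γ.num .electron)! *
    (m .electron + γ.num .electron - 1).choose (γ.num .electron)) *
  ((γ.num .photon)! * (m .photon + γ.num .photon - 1).choose (γ.num .photon))

/-- The number of vertices and of internal lines of each type in an electron self-energy graph
with `L ≥ 1` loops. -/
def electronCounts (L : ℕ) : Residue → ℕ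
  | .vertex => 2 * L
  | .electron => 2 * L - 1
  | .photon => L

/-- The number `(L, electron | γ)` of insertion places for `γ` in an electron self-energy graph
with `L ≥ 1` loops. (For `L = 0` this only occurs as the coefficient of `W₀ = 0`.) -/
noncomputable def electronInsertionPlaces (L : ℕ) (γ : GraphUnion) : ℕ :=
  insertionPlaces (electronCounts L) γ

end QED

open QED

/-!
The theorem is a count of insertions. The coefficient of `γ ⊗ Γ'` in the coproduct of a sum of
graphs counts the ways to find `γ` as a subgraph of some graph `G` with `G/γ = Γ'`. This is the
same as the number of ways to insert `γ` in `Γ'`, which depends on `Γ'` only through its residue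
and its loop number. A vertex graph and an electron self-energy with the same number of loops
differ by one vertex and one electron line, and so the difference of the two counts, which appears
in `Δ(W_L)`, counts the insertions in which one component has the place of this vertex or this
line.

Since one-particle irreducible graphs have no self-loops (`Diagram.IsOnePI.isLoopless`), every line
consists of two flags (half-lines). Subgraphs, contractions and insertions are described by maps
between flags: `IsPieces` for disjoint subgraphs, `IsContraction` for the isomorphisms of the
contracted graph with `Γ'`, and `Rooting` and `Gluing` for the places at which vertex graphs and
self-energies are inserted. An insertion of self-energies is a matching of their legs and the flags
of `Γ'` that becomes the matching of `Γ'` when each self-energy is contracted (`IsInsertion`). The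
result of an insertion is again one-particle irreducible, and loop numbers add up
(`Rooting.insertion_isOnePI`).

The central statement is `card_realization_eq`: the ways to write `G` as the result of an insertion
of graphs `D i` in `Γ'` correspond to the decompositions of `G` in subgraphs `D i` with contraction
`Γ'`. On one side, self-energies are inserted one after the other, in a number of lines that grows
by one each time, which gives the rising factorials in the number of insertion places; vertex
graphs are inserted at different vertices, which gives a falling factorial (`card_insertions`).
Each component contributes a further factor `2` for the identification of its external lines with
their places. On the other side, a component of a subgraph has exactly two labellings
(`card_labelling`), so that this factor cancels against the average over the labellings in the
coproduct (`coeff_subgraphToH_mul`). Summation over isomorphism classes, with each graph divided by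
its symmetry factor, gives the coproduct of the Green's functions (`coproduct_green`).

For the Ward elements, the difference of the insertion places in a vertex graph and in an electron
self-energy is a sum over a distinguished component that is a vertex graph or an electron
self-energy (`insertionPlaces_vertexCounts`). The element `W_K` is the sum of these two kinds of graphs,
since `G^el` carries a minus sign. Hence the sum over the distinguished component is multiplication
with Ward elements (`wardInsertion_eq`), and this proves the formula for the coproduct
(`coproduct_ward_eq_sum`). As each term of the formula contains a Ward element, the ideal generated
by them is a coideal. Its stability under the antipode follows by induction on the loop number from
the relation `m ∘ (S ⊗ id) ∘ Δ = 1 ∘ ε` (`antipode_ward_mem`).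
-/

namespace QED

namespace Diagram

variable {r : Residue}

/-! ### Flags -/

/-- The points of a graph: its vertices and the labels of its external lines. -/
abbrev Pt (G : Diagram r) : Type := G.V ⊕ Fin r.numExt

/-- Every line has two ends, which are distinct. -/
def IsLoopless (G : Diagram r) : Prop := ∀ e, (G.ends e).card = 2 ∧ (G.ends e).Nodup

/-- The flags (half-lines) of a graph: a line together with one of its ends. Without self-loops
every line has exactly two flags. -/
@[ext]
structure Flag (G : Diagram r) : Type where
  line : G.E
  pt : G.Pt
  mem : pt ∈ G.ends line

/-- The flags at vertices: a line together with a vertex on it. -/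
@[ext]
structure VFlag (G : Diagram r) : Type where
  line : G.E
  vert : G.V
  mem : Sum.inl vert ∈ G.ends line

/-- A flag at a vertex as a flag. -/
def VFlag.flag {G : Diagram r} (u : G.VFlag) : G.Flag := ⟨u.line, .inl u.vert, u.mem⟩

@[simp] theorem VFlag.flag_line {G : Diagram r} (u : G.VFlag) : u.flag.line = u.line := rfl
@[simp] theorem VFlag.flag_pt {G : Diagram r} (u : G.VFlag) : u.flag.pt = .inl u.vert := rfl

theorem VFlag.flag_injective (G : Diagram r) : Function.Injective (VFlag.flag (G := G)) := by
  rintro ⟨e, v, h⟩ ⟨e', v', h'⟩ hh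
  simp only [VFlag.flag, Flag.mk.injEq, Sum.inl.injEq] at hh
  obtain ⟨rfl, rfl⟩ := hh
  rfl

@[simp] theorem VFlag.flag_inj {G : Diagram r} {u u' : G.VFlag} : u.flag = u'.flag ↔ u = u' :=
  (VFlag.flag_injective G).eq_iff

theorem Flag.exists_vflag {G : Diagram r} (z : G.Flag) {v : G.V} (h : z.pt = .inl v) :
    ∃ u : G.VFlag, u.flag = z ∧ u.vert = v :=
  ⟨⟨z.line, v, h ▸ z.mem⟩, Flag.ext rfl h.symm, rfl⟩

instance (G : Diagram r) : Finite G.Flag :=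
  Finite.of_injective (fun z : G.Flag => (z.line, z.pt)) fun a b h => by
    simp only [Prod.mk.injEq] at h
    exact Flag.ext h.1 h.2

noncomputable instance (G : Diagram r) : Fintype G.Flag := Fintype.ofFinite _

instance (G : Diagram r) : Finite G.VFlag := Finite.of_injective _ (VFlag.flag_injective G)

noncomputable instance (G : Diagram r) : Fintype G.VFlag := Fintype.ofFinite _

theorem Flag.exists_other {G : Diagram r} (h : G.IsLoopless) (z : G.Flag) :
    ∃ z' : G.Flag, z'.line = z.line ∧ z'.pt ≠ z.pt ∧ G.ends z.line = {z.pt, z'.pt} := by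
  obtain ⟨hc, hn⟩ := h z.line
  obtain ⟨x, y, hxy⟩ := Multiset.card_eq_two.mp hc
  have hne : x ≠ y := by
    rintro rfl
    rw [hxy] at hn
    simp at hn
  have hz := z.mem
  rw [hxy] at hz
  simp only [Multiset.insert_eq_cons, Multiset.mem_cons, Multiset.mem_singleton] at hz
  rcases hz with hz | hz
  · exact ⟨⟨z.line, y, by rw [hxy]; simp⟩, rfl, by rw [hz]; exact hne.symm, by rw [hz]; exact hxy⟩
  · exact ⟨⟨z.line, x, by rw [hxy]; simp⟩, rfl, by rw [hz]; exact hne,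
      by rw [hz]; exact hxy.trans (Multiset.pair_comm _ _)⟩

/-- The other flag of the same line. -/
noncomputable def Flag.swap {G : Diagram r} (h : G.IsLoopless) (z : G.Flag) : G.Flag :=
  (z.exists_other h).choose

section swap

variable {G : Diagram r} (h : G.IsLoopless) (z z' : G.Flag)

@[simp] theorem Flag.swap_line : (z.swap h).line = z.line := (z.exists_other h).choose_spec.1

theorem Flag.swap_pt_ne : (z.swap h).pt ≠ z.pt := (z.exists_other h).choose_spec.2.1

theorem Flag.ends_line : G.ends z.line = {z.pt, (z.swap h).pt} :=
  (z.exists_other h).choose_spec.2.2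

theorem Flag.swap_ne : z.swap h ≠ z := fun hh => z.swap_pt_ne h (by rw [hh])

variable {z z'}

theorem Flag.eq_or_eq_swap (hl : z'.line = z.line) : z' = z ∨ z' = z.swap h := by
  have h1 := z'.mem
  rw [hl, z.ends_line h] at h1
  simp only [Multiset.insert_eq_cons, Multiset.mem_cons, Multiset.mem_singleton] at h1
  rcases h1 with h1 | h1
  · exact .inl (Flag.ext hl h1)
  · exact .inr (Flag.ext (by simpa using hl) h1)

theorem Flag.line_eq_iff : z'.line = z.line ↔ z' = z ∨ z' = z.swap h :=
  ⟨Flag.eq_or_eq_swap h, by rintro (rfl | rfl) <;> simp⟩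

@[simp] theorem Flag.swap_swap : (z.swap h).swap h = z :=
  ((Flag.eq_or_eq_swap h (z := z.swap h) (z' := z) (by simp)).resolve_left
    (z.swap_ne h).symm).symm

theorem Flag.swap_eq_of_ne (hl : z'.line = z.line) (hn : z' ≠ z) : z.swap h = z' :=
  ((Flag.eq_or_eq_swap h hl).resolve_left hn).symm

theorem Flag.swap_inj : z.swap h = z'.swap h ↔ z = z' :=
  ⟨fun hh => by rw [← z.swap_swap h, hh, Flag.swap_swap], fun hh => by rw [hh]⟩

end swap

/-! ### Presentations by flags -/

open scoped Classical in
/-- A finite type `Φ` of flags with a point and a line for each flag presents the graph `D` if the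
ends of each line are the points of the flags on it. -/
def IsPresentation (D : Diagram r) {Φ : Type} [Fintype Φ] (pt : Φ → D.Pt) (line : Φ → D.E) :
    Prop :=
  ∀ e, D.ends e = (Finset.univ.filter fun z => line z = e).val.map pt

theorem IsLoopless.isPresentation {G : Diagram r} (h : G.IsLoopless) :
    G.IsPresentation (Flag.pt (G := G)) Flag.line := by
  classical
  intro e
  refine (Multiset.Nodup.ext (h e).2 ?_).mpr ?_
  · refine Multiset.Nodup.map_on ?_ (Finset.nodup _)
    intro x hx y hy hxy
    simp only [Finset.mem_val, Finset.mem_filter, Finset.mem_univ, true_and] at hx hy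
    exact Flag.ext (hx.trans hy.symm) hxy
  · intro x
    simp only [Multiset.mem_map, Finset.mem_val, Finset.mem_filter, Finset.mem_univ, true_and]
    constructor
    · intro hx
      exact ⟨⟨e, x, hx⟩, rfl, rfl⟩
    · rintro ⟨z, rfl, rfl⟩
      exact z.mem

open scoped Classical in
theorem IsPresentation.valence_eq {D : Diagram r} {Φ : Type} [Fintype Φ] {pt : Φ → D.Pt}
    {line : Φ → D.E} (h : D.IsPresentation pt line) (x : D.Pt) (t : LineType) :
    D.valence x t = Nat.card {z : Φ // pt z = x ∧ D.lineType (line z) = t} := by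
  unfold valence
  have h1 : ∀ e, (D.ends e).count x
      = (Finset.univ.filter fun z => line z = e ∧ pt z = x).card := by
    intro e
    rw [h e, Multiset.count_map, ← Finset.filter_val, Finset.filter_filter]
    simp only [Finset.card_val]
    congr 1
    ext z
    simp [eq_comm]
  simp only [h1]
  rw [Nat.card_eq_fintype_card, Fintype.card_subtype, ← Finset.card_biUnion]
  · congr 1
    ext z
    simp only [Finset.mem_biUnion, Finset.mem_filter, Finset.mem_univ, true_and]
    constructor
    · rintro ⟨e, he, rfl, hz⟩
      exact ⟨hz, he⟩
    · rintro ⟨hz, he⟩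
      exact ⟨_, he, rfl, hz⟩
  · intro e _ e' _ hee
    refine Finset.disjoint_left.mpr ?_
    intro z hz hz'
    simp only [Finset.mem_filter, Finset.mem_univ, true_and] at hz hz'
    exact hee (hz.1.symm.trans hz'.1)

/-! ### Cuts -/

theorem connectedWithout_iff {G : Diagram r} {D : Set G.E} :
    G.ConnectedWithout D ↔ ∀ χ : G.Pt → Prop,
      (∀ e ∉ D, ∀ x y, G.ends e = {x, y} → (χ x ↔ χ y)) → ∀ x y, χ x ↔ χ y := by
  constructor
  · intro h χ hχ x y
    induction h x y with
    | refl => rfl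
    | tail _ h2 ih =>
      obtain ⟨e, he, hh⟩ := h2
      exact ih.trans (hχ e he _ _ hh)
  · intro h x y
    refine (h (fun y => Relation.ReflTransGen (G.Adj D) x y) ?_ x y).mp .refl
    intro e he a b hab
    constructor
    · intro hx
      exact hx.tail ⟨e, he, hab⟩
    · intro hx
      exact hx.tail ⟨e, he, hab.trans (Multiset.pair_comm _ _)⟩

/-! ### Invariance under isomorphisms and relabellings -/

/-- An isomorphism between graphs with possibly different labels, which are identified by `π`. -/
structure RelabelIso (G G' : Diagram r) (π : Equiv.Perm (Fin r.numExt)) where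
  onV : G.V ≃ G'.V
  onE : G.E ≃ G'.E
  lineType_eq : ∀ e, G'.lineType (onE e) = G.lineType e
  ends_eq : ∀ e, G'.ends (onE e) = (G.ends e).map (Sum.map onV π)

/-- An isomorphism, as a relabelling by the identity. -/
def Iso.toRelabelIso {G G' : Diagram r} (f : Iso G G') : RelabelIso G G' (Equiv.refl _) :=
  ⟨f.onV, f.onE, f.lineType_eq, f.ends_eq⟩

namespace RelabelIso

variable {G G' : Diagram r} {π : Equiv.Perm (Fin r.numExt)}

/-- The bijection on points. -/
def onPt (f : RelabelIso G G' π) : G.Pt ≃ G'.Pt := Equiv.sumCongr f.onV π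

theorem ends_eq' (f : RelabelIso G G' π) (e) :
    G'.ends (f.onE e) = (G.ends e).map f.onPt := f.ends_eq e

theorem valence_eq (f : RelabelIso G G' π) (x t) : G'.valence (f.onPt x) t = G.valence x t := by
  classical
  unfold valence
  rw [← Finset.sum_equiv f.onE (s := Finset.univ.filter fun e => G.lineType e = t)
    (f := fun e => (G.ends e).count x)]
  · intro e; simp [f.lineType_eq]
  · intro e _
    rw [f.ends_eq', Multiset.count_map_eq_count' _ _ f.onPt.injective]

theorem isFeynmanGraph (f : RelabelIso G G' π)
    (hπ : ∀ j, r.extType (π j) = r.extType j) (h : G.IsFeynmanGraph) :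
    G'.IsFeynmanGraph where
  card_ends e := by
    rw [← f.onE.apply_symm_apply e, f.ends_eq, Multiset.card_map, h.card_ends]
  electrons v := by
    have := f.valence_eq (.inl (f.onV.symm v)) .electron
    simp only [onPt, Equiv.sumCongr_apply, Sum.map_inl, Equiv.apply_symm_apply] at this
    rw [this, h.electrons]
  photons v := by
    have := f.valence_eq (.inl (f.onV.symm v)) .photon
    simp only [onPt, Equiv.sumCongr_apply, Sum.map_inl, Equiv.apply_symm_apply] at this
    rw [this, h.photons]
  external j t := by
    have := f.valence_eq (.inr (π.symm j)) t
    simp only [onPt, Equiv.sumCongr_apply, Sum.map_inr, Equiv.apply_symm_apply] at this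
    rw [this, h.external, ← hπ (π.symm j), Equiv.apply_symm_apply]

theorem connectedWithout (f : RelabelIso G G' π) {D : Set G'.E}
    (h : G.ConnectedWithout (f.onE ⁻¹' D)) :
    G'.ConnectedWithout D := by
  rw [connectedWithout_iff] at h ⊢
  intro χ hχ x y
  have := h (fun x => χ (f.onPt x)) ?_ (f.onPt.symm x) (f.onPt.symm y)
  · simpa using this
  · intro e he a b hab
    exact hχ (f.onE e) he _ _ (by rw [f.ends_eq', hab]; simp)

theorem loops_eq (f : RelabelIso G G' π) : G'.loops = G.loops := by
  unfold loops
  rw [Fintype.card_congr f.onV, Fintype.card_congr f.onE]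

theorem isOnePI (f : RelabelIso G G' π)
    (hπ : ∀ j, r.extType (π j) = r.extType j) (h : G.IsOnePI) : G'.IsOnePI where
  isFeynmanGraph := f.isFeynmanGraph hπ h.isFeynmanGraph
  connected := f.connectedWithout (by simpa using h.connected)
  not_tree := by rw [f.loops_eq]; exact h.not_tree
  irreducible e he := by
    refine f.connectedWithout ?_
    have : f.onE ⁻¹' {e} = {f.onE.symm e} := by
      ext x
      simp [Equiv.eq_symm_apply]
    rw [this]
    refine h.irreducible _ ?_
    obtain ⟨v, w, hvw⟩ := he
    refine ⟨f.onV.symm v, f.onV.symm w, ?_⟩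
    have h2 := f.ends_eq' (f.onE.symm e)
    rw [Equiv.apply_symm_apply, hvw] at h2
    apply Multiset.map_injective f.onPt.injective
    rw [← h2]
    simp [onPt]

end RelabelIso

theorem Iso.isOnePI {G G' : Diagram r} (f : Iso G G') (h : G.IsOnePI) : G'.IsOnePI :=
  f.toRelabelIso.isOnePI (fun _ => rfl) h

theorem Iso.loops_eq {G G' : Diagram r} (f : Iso G G') : G'.loops = G.loops :=
  f.toRelabelIso.loops_eq

theorem Iso.ext' {G G' : Diagram r} {f g : Iso G G'} (h : ∀ v, f.onV v = g.onV v)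
    (h' : ∀ e, f.onE e = g.onE e) : f = g := by
  obtain ⟨a, b, _, _⟩ := f
  obtain ⟨a', b', _, _⟩ := g
  obtain rfl : a = a' := Equiv.ext h
  obtain rfl : b = b' := Equiv.ext h'
  rfl

instance (G G' : Diagram r) : Finite (Iso G G') :=
  Finite.of_injective (fun f : Iso G G' => (f.onV, f.onE)) fun f g h => by
    simp only [Prod.mk.injEq] at h
    exact Iso.ext' (fun v => by rw [h.1]) fun v => by rw [h.2]

theorem sym_pos (G : Diagram r) : 0 < G.sym :=
  have : Nonempty (Iso G G) := ⟨Iso.refl G⟩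
  Nat.card_pos

theorem Iso.card_eq_right {G G' : Diagram r} (f : Iso G G') (G'' : Diagram r) :
    Nat.card (Iso G'' G) = Nat.card (Iso G'' G') :=
  Nat.card_congr
    { toFun := fun g => g.trans f
      invFun := fun g => g.trans f.symm
      left_inv := fun g => Iso.ext' (fun _ => by simp [trans, symm]) fun _ => by simp [trans, symm]
      right_inv := fun g => Iso.ext' (fun _ => by simp [trans, symm])
        fun _ => by simp [trans, symm] }

/-! ### One-particle irreducible graphs have no self-loops -/

open scoped Classical in
theorem count_le_valence (G : Diagram r) {x : G.Pt} {e : G.E} :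
    (G.ends e).count x ≤ G.valence x (G.lineType e) :=
  Finset.single_le_sum (f := fun e => (G.ends e).count x) (fun _ _ => Nat.zero_le _)
    (Finset.mem_filter.mpr ⟨Finset.mem_univ e, rfl⟩)

theorem IsFeynmanGraph.exists_ends {G : Diagram r} (h : G.IsFeynmanGraph) (e : G.E) :
    ∃ x y, G.ends e = {x, y} := Multiset.card_eq_two.mp (h.card_ends e)

theorem two_le_numExt : 2 ≤ r.numExt := by cases r <;> simp [Residue.numExt]

/-- A set of points that no remaining line leaves, with a vertex inside and an external label
outside, is disconnected from the rest. -/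
theorem not_connected_of_isolated {G : Diagram r} {D : Set G.E} {v : G.V} {j : Fin r.numExt}
    (s : Set (G.Pt))
    (hv : .inl v ∈ s) (hj : .inr j ∉ s)
    (hs : ∀ e ∉ D, ∀ x y, G.ends e = {x, y} → (x ∈ s ↔ y ∈ s)) : ¬ G.ConnectedWithout D := by
  intro h
  exact hj (((connectedWithout_iff.mp h) (· ∈ s) hs (.inl v) (.inr j)).mp hv)

/-- At a vertex with a self-loop, both electron flags belong to the self-loop. If the photon line
there is internal, it is a bridge. If it is external, it forms, with the vertex, a component that
does not contain the other external lines. -/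
theorem IsOnePI.isLoopless {G : Diagram r} (h : G.IsOnePI) : G.IsLoopless := by
  classical
  intro e
  refine ⟨h.isFeynmanGraph.card_ends e, ?_⟩
  obtain ⟨x, y, hxy⟩ := h.isFeynmanGraph.exists_ends e
  rw [hxy]
  by_contra hn
  have hxy' : x = y := by
    by_contra hne
    exact hn (by simp [hne])
  subst hxy'
  have hc : (G.ends e).count x = 2 := by rw [hxy]; simp
  have hle := G.count_le_valence (x := x) (e := e)
  rw [hc] at hle
  rcases x with v | j
  swap
  · rw [h.isFeynmanGraph.external] at hle
    split_ifs at hle <;> lia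
  -- a self-loop uses two flags of the same type, and there is only one photon flag
  have hty : G.lineType e = .electron := by
    cases hh : G.lineType e with
    | electron => rfl
    | photon => rw [hh, h.isFeynmanGraph.photons] at hle; lia
  -- the only electron line at `v` is the self-loop `e`
  have hel : ∀ e', G.lineType e' = .electron → .inl v ∈ G.ends e' → e' = e := by
    intro e' he' hm
    by_contra hne
    have h2 := h.isFeynmanGraph.electrons v
    unfold valence at h2
    have h3 : ({e, e'} : Finset G.E) ⊆ Finset.univ.filter fun e => G.lineType e = .electron := by
      intro a ha
      simp only [Finset.mem_insert, Finset.mem_singleton] at ha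
      rcases ha with rfl | rfl <;> simp [hty, he']
    have h4 := Finset.sum_le_sum_of_subset (f := fun e => (G.ends e).count (.inl v)) h3
    rw [Finset.sum_pair (Ne.symm hne)] at h4
    have h5 := Multiset.count_pos.mpr hm
    have h6 : ∑ e : G.E with G.lineType e = .electron, (G.ends e).count (.inl v) = 2 := by
      convert h2
    lia
  have hph : ∃ p, G.lineType p = .photon ∧ .inl v ∈ G.ends p := by
    have h2 := h.isFeynmanGraph.photons v
    unfold valence at h2
    obtain ⟨p, hp, hp2⟩ := Finset.exists_ne_zero_of_sum_ne_zero (by rw [h2]; simp)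
    simp only [Finset.mem_filter, Finset.mem_univ, true_and] at hp
    exact ⟨p, hp, Multiset.count_ne_zero.mp hp2⟩
  obtain ⟨p, hpt, hpm⟩ := hph
  have hph' : ∀ e', G.lineType e' = .photon → .inl v ∈ G.ends e' → e' = p := by
    intro e' he' hm
    by_contra hne
    have h2 := h.isFeynmanGraph.photons v
    unfold valence at h2
    have h3 : ({p, e'} : Finset G.E) ⊆ Finset.univ.filter fun e => G.lineType e = .photon := by
      intro a ha
      simp only [Finset.mem_insert, Finset.mem_singleton] at ha
      rcases ha with rfl | rfl <;> simp [hpt, he']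
    have h4 := Finset.sum_le_sum_of_subset (f := fun e => (G.ends e).count (.inl v)) h3
    rw [Finset.sum_pair (Ne.symm hne)] at h4
    have h5 := Multiset.count_pos.mpr hm
    have h5' := Multiset.count_pos.mpr hpm
    have h6 : ∑ e : G.E with G.lineType e = .photon, (G.ends e).count (.inl v) = 1 := by
      convert h2
    lia
  have hall : ∀ e', .inl v ∈ G.ends e' → e' = e ∨ e' = p := by
    intro e' hm
    cases hh : G.lineType e' with
    | electron => exact .inl (hel e' hh hm)
    | photon => exact .inr (hph' e' hh hm)
  have hpe : p ≠ e := by rintro rfl; rw [hty] at hpt; cases hpt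
  obtain ⟨a, ha⟩ := Multiset.exists_cons_of_mem hpm
  have hac : a.card = 1 := by
    have := h.isFeynmanGraph.card_ends p
    rw [ha] at this
    simpa using this
  obtain ⟨y, rfl⟩ := Multiset.card_eq_one.mp hac
  have hpy : G.ends p = {.inl v, y} := ha
  rcases y with w | j
  · -- the photon line at `v` is a bridge
    have j0 : Fin r.numExt := ⟨0, by have := two_le_numExt (r := r); lia⟩
    refine not_connected_of_isolated (j := j0) {.inl v} (v := v) (by simp) (by simp) ?_
      (h.irreducible p ⟨v, w, hpy⟩)
    intro e' he' x y hxy'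
    have key : .inl v ∈ G.ends e' → x = .inl v ∧ y = .inl v := by
      intro hm
      rcases hall e' hm with rfl | rfl
      · rw [hxy] at hxy'
        have hx : x ∈ ({.inl v, .inl v} : Multiset G.Pt) := by rw [hxy']; simp
        have hy : y ∈ ({.inl v, .inl v} : Multiset G.Pt) := by rw [hxy']; simp
        simp at hx hy
        exact ⟨hx, hy⟩
      · exact absurd rfl he'
    simp only [Set.mem_singleton_iff]
    constructor
    · intro hx; exact (key (by rw [hxy', hx]; simp)).2
    · intro hx; exact (key (by rw [hxy', hx]; simp)).1
  · -- the graph has only one external line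
    obtain ⟨j', hj'⟩ : ∃ j' : Fin r.numExt, j' ≠ j := by
      have := two_le_numExt (r := r)
      have : Nontrivial (Fin r.numExt) := Fin.nontrivial_iff_two_le.mpr this
      exact exists_ne j
    have hjl : ∀ e', .inr j ∈ G.ends e' → e' = p := by
      intro e' hm
      by_contra hne
      have hjp : .inr j ∈ G.ends p := by rw [hpy]; simp
      have h1 := h.isFeynmanGraph.external j
      have h2 := (Multiset.count_pos.mpr hm).trans_le G.count_le_valence
      have h2' := (Multiset.count_pos.mpr hjp).trans_le G.count_le_valence
      rw [h1] at h2 h2'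
      have h7 : G.lineType e' = r.extType j := by
        by_contra hc; rw [if_neg (Ne.symm hc)] at h2; lia
      have h8 : G.lineType p = r.extType j := by
        by_contra hc; rw [if_neg (Ne.symm hc)] at h2'; lia
      have h9 := h1 (r.extType j)
      unfold valence at h9
      have h3 : ({p, e'} : Finset G.E) ⊆
          Finset.univ.filter fun e => G.lineType e = r.extType j := by
        intro a ha
        simp only [Finset.mem_insert, Finset.mem_singleton] at ha
        rcases ha with rfl | rfl <;> simp [h7, h8]
      have h4 := Finset.sum_le_sum_of_subset (f := fun e => (G.ends e).count (.inr j)) h3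
      rw [Finset.sum_pair (Ne.symm hne)] at h4
      have h5 := Multiset.count_pos.mpr hm
      have h5' := Multiset.count_pos.mpr hjp
      have h6 : ∑ e : G.E with G.lineType e = r.extType j, (G.ends e).count (.inr j) = 1 := by
        convert h9
        simp
      lia
    refine not_connected_of_isolated (j := j') {.inl v, .inr j} (v := v) (by simp)
      (by simp [hj']) ?_ h.connected
    intro e' _ x y hxy'
    have key : .inl v ∈ G.ends e' ∨ .inr j ∈ G.ends e' →
        ∀ z ∈ G.ends e', z = .inl v ∨ z = .inr j := by
      intro hm
      have : e' = e ∨ e' = p := by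
        rcases hm with hm | hm
        · exact hall e' hm
        · exact .inr (hjl e' hm)
      rcases this with rfl | rfl
      · rw [hxy]; intro z hz; simp at hz; exact .inl hz
      · rw [hpy]; intro z hz; simpa using hz
    simp only [Set.mem_insert_iff, Set.mem_singleton_iff]
    constructor
    · intro hx
      exact key (by rw [hxy']; rcases hx with rfl | rfl <;> simp) y (by rw [hxy']; simp)
    · intro hx
      exact key (by rw [hxy']; rcases hx with rfl | rfl <;> simp) x (by rw [hxy']; simp)

/-! ### Vertices and loops -/

theorem IsFeynmanGraph.card_V {G : Diagram r} (h : G.IsFeynmanGraph) (h0 : 0 < G.loops) :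
    Fintype.card G.V + 2 = 2 * G.loops + r.numExt := by
  have := two_mul_card_E h
  unfold loops at h0 ⊢
  lia

theorem IsFeynmanGraph.loops_eq {G : Diagram r} (h : G.IsFeynmanGraph) {L : ℕ}
    (hL : Fintype.card G.V + 2 = 2 * L + r.numExt) : G.loops = L := by
  have := two_mul_card_E h
  unfold loops
  lia

end Diagram

end QED

namespace QED

/-- The number of lines of each type that meet at a vertex. -/
def LineType.mult : LineType → ℕ
  | .electron => 2
  | .photon => 1

namespace Diagram

variable {r : Residue}

/-! ### Isomorphisms in terms of flags -/

section presentation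

variable {D D' : Diagram r} {Φ : Type} [Fintype Φ] {pt : Φ → D.Pt} {line : Φ → D.E}

theorem IsPresentation.mem (hP : D.IsPresentation pt line) (z : Φ) : pt z ∈ D.ends (line z) := by
  classical
  rw [hP]
  exact Multiset.mem_map_of_mem _ (by simp)

/-- The bijection on flags induced by an isomorphism. -/
def Iso.onFlag (hP : D.IsPresentation pt line) (i : Iso D D') (z : Φ) : D'.Flag :=
  ⟨i.onE (line z), Sum.map i.onV id (pt z), by
    rw [i.ends_eq]; exact Multiset.mem_map_of_mem _ (hP.mem z)⟩

theorem Iso.onFlag_injective (hP : D.IsPresentation pt line) (h' : D'.IsLoopless) (i : Iso D D') :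
    Function.Injective (i.onFlag hP) := by
  classical
  intro z z' hz
  simp only [onFlag, Flag.mk.injEq, EmbeddingLike.apply_eq_iff_eq] at hz
  obtain ⟨h1, h2⟩ := hz
  have hn := (h' (i.onE (line z))).2
  rw [i.ends_eq, hP, Multiset.map_map] at hn
  exact Multiset.inj_on_of_nodup_map hn z (by simp) z' (by simp [h1]) h2

theorem Iso.onFlag_surjective (hP : D.IsPresentation pt line) (i : Iso D D') :
    Function.Surjective (i.onFlag hP) := by
  classical
  intro w
  have hw := w.mem
  obtain ⟨e, he⟩ := i.onE.surjective w.line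
  rw [← he, i.ends_eq, hP, Multiset.map_map] at hw
  simp only [Function.comp_apply, Multiset.mem_map, Finset.mem_val, Finset.mem_filter,
    Finset.mem_univ, true_and] at hw
  obtain ⟨z, rfl, hz⟩ := hw
  exact ⟨z, Flag.ext he hz⟩

theorem Iso.line_surjective (hP : D.IsPresentation pt line) (h' : D'.IsLoopless) (i : Iso D D') :
    Function.Surjective line := by
  classical
  intro e
  have h1 := (h' (i.onE e)).1
  rw [i.ends_eq, Multiset.card_map, hP, Multiset.card_map] at h1
  obtain ⟨z, hz⟩ := Finset.card_pos.mp (by rw [Finset.card_def, h1]; simp)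
  exact ⟨z, by simpa using hz⟩

/-- A bijection on vertices and a compatible bijection on flags define an isomorphism. -/
theorem exists_iso (hP : D.IsPresentation pt line) (h' : D'.IsLoopless) (onV : D.V ≃ D'.V)
    (h : Φ ≃ D'.Flag) (hpt : ∀ z, (h z).pt = Sum.map onV id (pt z))
    (hty : ∀ z, D'.lineType (h z).line = D.lineType (line z))
    (hline : ∀ z z', (h z).line = (h z').line ↔ line z = line z')
    (hsurj : Function.Surjective line) :
    ∃ i : Iso D D', i.onV = onV ∧ ∀ z, i.onE (line z) = (h z).line := by
  classical
  choose s hs using hsurj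
  have hb : Function.Bijective fun e => (h (s e)).line := by
    constructor
    · intro e e' hh
      have := (hline _ _).mp hh
      rwa [hs, hs] at this
    · intro e'
      obtain ⟨x, hx⟩ := Multiset.card_pos_iff_exists_mem.mp (by rw [(h' e').1]; simp)
      refine ⟨line (h.symm ⟨e', x, hx⟩), ?_⟩
      have := (hline (s (line (h.symm ⟨e', x, hx⟩))) (h.symm ⟨e', x, hx⟩)).mpr (hs _)
      simpa using this
  have hb' : ∀ z, (h (s (line z))).line = (h z).line := fun z => (hline _ _).mpr (hs _)
  refine ⟨⟨onV, Equiv.ofBijective _ hb, ?_, ?_⟩, rfl, hb'⟩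
  · intro e
    simp [hty, hs]
  · intro e
    simp only [Equiv.ofBijective_apply]
    have hP' := h'.isPresentation
    rw [hP', hP, Multiset.map_map]
    have : (Finset.univ.filter fun z : D'.Flag => z.line = (h (s e)).line)
        = (Finset.univ.filter fun z => line z = e).map h.toEmbedding := by
      ext w
      simp only [Finset.mem_filter, Finset.mem_univ, true_and, Finset.mem_map,
        Equiv.coe_toEmbedding]
      constructor
      · intro hw
        refine ⟨h.symm w, ?_, by simp⟩
        have := (hline (h.symm w) (s e)).mp (by simpa using hw)
        rwa [hs] at this
      · rintro ⟨z, rfl, rfl⟩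
        exact (hb' z).symm
    rw [this, Finset.map_val, Multiset.map_map]
    refine Multiset.map_congr rfl fun z _ => ?_
    exact hpt z

end presentation

/-! ### External lines of one-particle irreducible graphs -/

namespace IsOnePI

variable {G : Diagram r} (h : G.IsOnePI)

theorem card_V (h : G.IsOnePI) : Fintype.card G.V + 2 = 2 * G.loops + r.numExt :=
  h.isFeynmanGraph.card_V h.not_tree

theorem nonempty_V (h : G.IsOnePI) : Nonempty G.V := by
  have h1 := h.card_V
  have h2 := h.not_tree
  have h3 := two_le_numExt (r := r)
  exact Fintype.card_pos_iff.mp (by lia)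

/-- An external label has valence one, so that it carries one flag, of the type of the label. -/
theorem existsUnique_labelFlag (h : G.IsOnePI) (j : Fin r.numExt) :
    ∃ z : G.Flag, z.pt = .inr j ∧ G.lineType z.line = r.extType j ∧ ∀ z' : G.Flag,
      z'.pt = .inr j → z' = z := by
  have hv := fun t => (h.isLoopless.isPresentation.valence_eq (.inr j) t).symm.trans
    (h.isFeynmanGraph.external j t)
  have h1 := hv (r.extType j)
  rw [if_pos rfl, Nat.card_eq_one_iff_unique] at h1
  obtain ⟨hs, ⟨z, hz⟩⟩ := h1
  refine ⟨z, hz.1, hz.2, fun z' hz' => ?_⟩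
  by_cases ht : G.lineType z'.line = r.extType j
  · exact congrArg Subtype.val (hs.elim ⟨z', hz', ht⟩ ⟨z, hz⟩)
  · have h2 := hv (G.lineType z'.line)
    rw [if_neg (Ne.symm ht), Finite.card_eq_zero_iff] at h2
    exact (h2.false ⟨z', hz', rfl⟩).elim

/-- The flag at a label. -/
noncomputable def labelFlag (h : G.IsOnePI) (j : Fin r.numExt) : G.Flag :=
  (h.existsUnique_labelFlag j).choose

@[simp] theorem labelFlag_pt (j) : (h.labelFlag j).pt = .inr j :=
  (h.existsUnique_labelFlag j).choose_spec.1

@[simp] theorem labelFlag_type (j) : G.lineType (h.labelFlag j).line = r.extType j :=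
  (h.existsUnique_labelFlag j).choose_spec.2.1

theorem eq_labelFlag {j} {z : G.Flag} (hz : z.pt = .inr j) : z = h.labelFlag j :=
  (h.existsUnique_labelFlag j).choose_spec.2.2 z hz

/-- The graph is connected, in terms of 2-colourings of its points. -/
theorem cut (χ : G.Pt → Prop) (hχ : ∀ z : G.Flag, χ z.pt ↔ χ (z.swap h.isLoopless).pt) (x y) :
    χ x ↔ χ y := by
  refine connectedWithout_iff.mp h.connected χ ?_ x y
  intro e _ a b hab
  have ha : a ∈ G.ends e := by rw [hab]; simp
  have h1 := (Flag.mk e a ha).ends_line h.isLoopless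
  have h2 := hχ ⟨e, a, ha⟩
  rw [hab] at h1
  simp only [Multiset.insert_eq_cons, Multiset.cons_inj_right, Multiset.singleton_inj] at h1
  rwa [← h1] at h2

/-- No internal line is a bridge, in terms of 2-colourings of the points. -/
theorem cut_of_ne (a : G.Flag) (ha : ∃ v, a.pt = .inl v)
    (ha' : ∃ v, (a.swap h.isLoopless).pt = .inl v) (χ : G.Pt → Prop)
    (hχ : ∀ z : G.Flag, z ≠ a → z ≠ a.swap h.isLoopless →
      (χ z.pt ↔ χ (z.swap h.isLoopless).pt)) (x y) : χ x ↔ χ y := by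
  obtain ⟨v, hv⟩ := ha
  obtain ⟨w, hw⟩ := ha'
  have hi : G.IsInternal a.line := ⟨v, w, by rw [a.ends_line h.isLoopless, hv, hw]⟩
  refine connectedWithout_iff.mp (h.irreducible _ hi) χ ?_ x y
  intro e he p q hab
  have hp : p ∈ G.ends e := by rw [hab]; simp
  have h1 := (Flag.mk e p hp).ends_line h.isLoopless
  have h2 := hχ ⟨e, p, hp⟩ (by rintro rfl; exact he rfl)
    (by intro hh; exact he (by rw [← a.swap_line h.isLoopless, ← hh]; rfl))
  rw [hab] at h1
  simp only [Multiset.insert_eq_cons, Multiset.cons_inj_right, Multiset.singleton_inj] at h1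
  rwa [← h1] at h2

theorem exists_leg (j : Fin r.numExt) :
    ∃ u : G.VFlag, u.flag = (h.labelFlag j).swap h.isLoopless := by
  cases hp : ((h.labelFlag j).swap h.isLoopless).pt with
  | inl v =>
    obtain ⟨u, hu, -⟩ := Flag.exists_vflag _ hp
    exact ⟨u, hu⟩
  | inr j' =>
    exfalso
    have hj' := h.eq_labelFlag hp
    obtain ⟨v⟩ := h.nonempty_V
    have := h.cut (fun x => x = .inr j ∨ x = .inr j') ?_ (.inr j) (.inl v)
    · simp at this
    · intro z
      have key : ∀ z : G.Flag, (z.pt = .inr j ∨ z.pt = .inr j') →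
          ((z.swap h.isLoopless).pt = .inr j ∨ (z.swap h.isLoopless).pt = .inr j') := by
        rintro z (hz | hz)
        · rw [h.eq_labelFlag hz]; exact .inr hp
        · rw [h.eq_labelFlag hz, ← hj', Flag.swap_swap]; exact .inl (by simp)
      exact ⟨key z, fun hh => by simpa using key _ hh⟩

/-- The flag at a vertex of the external line with a given label. -/
noncomputable def leg (j : Fin r.numExt) : G.VFlag := (h.exists_leg j).choose

theorem leg_flag (j) : (h.leg j).flag = (h.labelFlag j).swap h.isLoopless :=
  (h.exists_leg j).choose_spec

@[simp] theorem swap_leg (j) : (h.leg j).flag.swap h.isLoopless = h.labelFlag j := by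
  rw [leg_flag, Flag.swap_swap]

@[simp] theorem swap_labelFlag (j) : (h.labelFlag j).swap h.isLoopless = (h.leg j).flag :=
  (h.leg_flag j).symm

@[simp] theorem leg_type (j) : G.lineType (h.leg j).line = r.extType j := by
  rw [← VFlag.flag_line, leg_flag, Flag.swap_line, labelFlag_type]

theorem labelFlag_injective : Function.Injective h.labelFlag := fun i j hh => by
  have := congrArg Flag.pt hh
  simpa using this

theorem leg_injective : Function.Injective h.leg := fun i j hh => by
  apply h.labelFlag_injective
  rw [← swap_leg, hh, swap_leg]

theorem eq_labelFlag_or (z : G.Flag) : (∃ u : G.VFlag, z = u.flag) ∨ ∃ j, z = h.labelFlag j := by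
  cases hp : z.pt with
  | inl v => obtain ⟨u, hu, -⟩ := z.exists_vflag hp; exact .inl ⟨u, hu.symm⟩
  | inr j => exact .inr ⟨j, h.eq_labelFlag hp⟩

theorem flag_ne_labelFlag (u : G.VFlag) (j) : u.flag ≠ h.labelFlag j := fun hh => by
  have := congrArg Flag.pt hh
  simp at this

/-- A flag at a vertex belongs to an internal line or is a leg. -/
theorem eq_leg_or (u : G.VFlag) :
    (∃ u' : G.VFlag, u.flag.swap h.isLoopless = u'.flag) ∨ ∃ j, u = h.leg j := by
  rcases h.eq_labelFlag_or (u.flag.swap h.isLoopless) with hu | ⟨j, hj⟩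
  · exact .inl hu
  · refine .inr ⟨j, VFlag.flag_injective _ ?_⟩
    rw [leg_flag, ← hj, Flag.swap_swap]

theorem swap_ne_flag_leg (j) (u : G.VFlag) : u.flag.swap h.isLoopless ≠ (h.leg j).flag := by
  intro hh
  rw [leg_flag, Flag.swap_inj] at hh
  exact h.flag_ne_labelFlag _ _ hh

/-- Removal of the external lines and of one internal line does not disconnect the vertices. -/
theorem inner_cut (h : G.IsOnePI) (e : G.E) (χ : G.V → Prop)
    (hχ : ∀ u u' : G.VFlag, u.flag.swap h.isLoopless = u'.flag → u.line ≠ e →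
      (χ u.vert ↔ χ u'.vert)) (v w : G.V) : χ v ↔ χ w := by
  let χ' : G.Pt → Prop := Sum.elim χ fun j => χ (h.leg j).vert
  have hleg : ∀ j, χ' (h.labelFlag j).pt ↔ χ' ((h.labelFlag j).swap h.isLoopless).pt := by
    intro j
    simp [χ']
  have hmain : ∀ z : G.Flag, z.line ≠ e → (χ' z.pt ↔ χ' (z.swap h.isLoopless).pt) := by
    intro z hz
    rcases h.eq_labelFlag_or z with ⟨u, rfl⟩ | ⟨j, rfl⟩
    · rcases h.eq_leg_or u with ⟨u', hu'⟩ | ⟨j, rfl⟩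
      · rw [hu']; exact hχ u u' hu' hz
      · rw [swap_leg, leg_flag]; exact (hleg j).symm
    · exact hleg j
  suffices ∀ x y, χ' x ↔ χ' y from this (.inl v) (.inl w)
  by_cases hi : G.IsInternal e
  · obtain ⟨a, b, hab⟩ := hi
    have ha : .inl a ∈ G.ends e := by rw [hab]; simp
    have h1 := (Flag.mk e (.inl a) ha).ends_line h.isLoopless
    rw [hab] at h1
    simp only [Multiset.insert_eq_cons, Multiset.cons_inj_right, Multiset.singleton_inj] at h1
    refine h.cut_of_ne ⟨e, .inl a, ha⟩ ⟨a, rfl⟩ ⟨b, h1.symm⟩ χ' fun z hz hz' => hmain z ?_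
    intro hl
    rcases Flag.eq_or_eq_swap h.isLoopless (z := ⟨e, .inl a, ha⟩) hl with hh | hh
    · exact hz hh
    · exact hz' hh
  · refine h.cut χ' fun z => ?_
    by_cases hz : z.line = e
    · rcases h.eq_labelFlag_or z with ⟨u, rfl⟩ | ⟨j, rfl⟩
      · rcases h.eq_leg_or u with ⟨u', hu'⟩ | ⟨j, rfl⟩
        · refine absurd ⟨u.vert, u'.vert, ?_⟩ hi
          rw [← hz, u.flag.ends_line h.isLoopless, hu']
          rfl
        · rw [swap_leg, leg_flag]; exact (hleg j).symm
      · exact hleg j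
    · exact hmain z hz

theorem exists_vflag (h : G.IsOnePI) (v : G.V) : ∃ u : G.VFlag, u.vert = v := by
  have h1 := h.isLoopless.isPresentation.valence_eq (.inl v) .photon
  rw [h.isFeynmanGraph.photons] at h1
  obtain ⟨⟨z, hz⟩⟩ := (Finite.card_pos_iff (α := {z : G.Flag // z.pt = .inl v ∧ _})).mp
    (by rw [← h1]; simp)
  obtain ⟨u, -, hu⟩ := z.exists_vflag hz.1
  exact ⟨u, hu⟩

theorem exists_vflag_line (h : G.IsOnePI) (e : G.E) : ∃ u : G.VFlag, u.line = e := by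
  obtain ⟨x, hx⟩ := Multiset.card_pos_iff_exists_mem.mp (by rw [(h.isLoopless e).1]; simp)
  rcases h.eq_labelFlag_or ⟨e, x, hx⟩ with ⟨u, hu⟩ | ⟨j, hj⟩
  · exact ⟨u, by rw [← VFlag.flag_line, ← hu]⟩
  · refine ⟨h.leg j, ?_⟩
    rw [← VFlag.flag_line, leg_flag, Flag.swap_line, ← hj]

/-- The valence of a vertex, counted by flags. -/
theorem card_vflag (h : G.IsOnePI) (v : G.V) (t : LineType) :
    Nat.card {u : G.VFlag // u.vert = v ∧ G.lineType u.line = t}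
      = t.mult := by
  have h1 := h.isLoopless.isPresentation.valence_eq (.inl v) t
  have h2 : G.valence (.inl v) t = t.mult := by
    cases t
    · exact h.isFeynmanGraph.electrons v
    · exact h.isFeynmanGraph.photons v
  rw [← h2, h1]
  refine Nat.card_congr (Equiv.ofBijective (fun u => ⟨u.1.flag, by simpa using u.2⟩) ⟨?_, ?_⟩)
  · intro a b hab
    simpa [Subtype.ext_iff] using hab
  · rintro ⟨z, hz, hz'⟩
    obtain ⟨u, rfl, hu⟩ := z.exists_vflag hz
    exact ⟨⟨u, hu, hz'⟩, rfl⟩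

end IsOnePI

end Diagram

/-! ### Graphs given by a matching of flags -/

/-- A finite set of vertices and a finite set of flags with their points and types, together with
the matching `σ` of the flags that glues them to lines. -/
structure FlagGraph (r : Residue) where
  V : Type
  Φ : Type
  [fintypeV : Fintype V]
  [fintypeΦ : Fintype Φ]
  pt : Φ → V ⊕ Fin r.numExt
  ty : Φ → LineType
  σ : Φ → Φ
  σ_σ : ∀ z, σ (σ z) = z
  σ_ne : ∀ z, σ z ≠ z
  ty_σ : ∀ z, ty (σ z) = ty z

attribute [instance] FlagGraph.fintypeV FlagGraph.fintypeΦ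

namespace FlagGraph

variable {r : Residue} (M : FlagGraph r)

/-- Two flags belong to the same line. -/
def setoid : Setoid M.Φ where
  r z z' := z' = z ∨ z' = M.σ z
  iseqv := ⟨fun _ => .inl rfl, by
    rintro z z' (rfl | rfl)
    · exact .inl rfl
    · exact .inr (M.σ_σ z).symm, by
    rintro z z' z'' (rfl | rfl) (rfl | rfl)
    · exact .inl rfl
    · exact .inr rfl
    · exact .inr rfl
    · exact .inl (M.σ_σ z)⟩

/-- The graph whose lines are the pairs of matched flags. -/
noncomputable abbrev diagram : Diagram r where
  V := M.V
  E := Quotient M.setoid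
  fintypeE := Fintype.ofFinite _
  lineType := Quotient.lift M.ty (by
    rintro z z' (rfl | rfl)
    · rfl
    · exact (M.ty_σ z).symm)
  ends := Quotient.lift (fun z => {M.pt z, M.pt (M.σ z)}) (by
    rintro z z' (rfl | rfl)
    · rfl
    · simp only [M.σ_σ]
      exact Multiset.pair_comm _ _)

/-- The line of a flag. -/
def line (z : M.Φ) : M.diagram.E := Quotient.mk M.setoid z

theorem line_surjective : Function.Surjective M.line := Quotient.mk_surjective

theorem line_eq_iff (z z' : M.Φ) : M.line z = M.line z' ↔ z' = z ∨ z' = M.σ z :=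
  Quotient.eq (r := M.setoid)

theorem ends_line (z : M.Φ) : M.diagram.ends (M.line z) = {M.pt z, M.pt (M.σ z)} := rfl

theorem isPresentation : M.diagram.IsPresentation M.pt M.line := by
  classical
  intro e
  obtain ⟨z, rfl⟩ := M.line_surjective e
  rw [ends_line]
  have : (Finset.univ.filter fun z' => M.line z' = M.line z) = {z, M.σ z} := by
    ext z'
    simp only [Finset.mem_filter, Finset.mem_univ, true_and, Finset.mem_insert,
      Finset.mem_singleton]
    rw [eq_comm, line_eq_iff]
  have h2 : ({z, M.σ z} : Finset M.Φ).val.map M.pt = {M.pt z, M.pt (M.σ z)} := by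
    rw [Finset.insert_val_of_notMem (by simpa using (M.σ_ne z).symm)]
    rfl
  rw [← this] at h2
  convert h2.symm

/-- A criterion for one-particle irreducibility in terms of 2-colourings of the points. -/
theorem isOnePI {L : ℕ} (hL : 0 < L)
    (hV : Fintype.card M.V + 2 = 2 * L + r.numExt)
    (hel : ∀ v, Nat.card {z // M.pt z = .inl v ∧ M.ty z = .electron} = 2)
    (hph : ∀ v, Nat.card {z // M.pt z = .inl v ∧ M.ty z = .photon} = 1)
    (hext : ∀ j t, Nat.card {z // M.pt z = .inr j ∧ M.ty z = t} = if r.extType j = t then 1 else 0)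
    (hcut : ∀ χ : M.V ⊕ Fin r.numExt → Prop, (∀ z, χ (M.pt z) ↔ χ (M.pt (M.σ z))) →
      ∀ x y, χ x ↔ χ y)
    (hcut' : ∀ a, (∃ v, M.pt a = .inl v) → (∃ v, M.pt (M.σ a) = .inl v) →
      ∀ χ : M.V ⊕ Fin r.numExt → Prop,
      (∀ z, z ≠ a → z ≠ M.σ a → (χ (M.pt z) ↔ χ (M.pt (M.σ z)))) → ∀ x y, χ x ↔ χ y) :
    M.diagram.IsOnePI ∧ M.diagram.loops = L := by
  have hF : M.diagram.IsFeynmanGraph := by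
    refine ⟨?_, ?_, ?_, ?_⟩
    · intro e
      obtain ⟨z, rfl⟩ := M.line_surjective e
      exact Multiset.card_pair _ _
    · intro v
      rw [M.isPresentation.valence_eq]; exact hel v
    · intro v
      rw [M.isPresentation.valence_eq]; exact hph v
    · intro j t
      rw [M.isPresentation.valence_eq]; exact hext j t
  have hl : M.diagram.loops = L := hF.loops_eq hV
  refine ⟨⟨hF, ?_, by rw [hl]; exact hL, ?_⟩, hl⟩
  · refine Diagram.connectedWithout_iff.mpr fun χ hχ => hcut χ fun z => ?_
    exact hχ (M.line z) (by simp) _ _ (M.ends_line z)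
  · rintro e ⟨v, w, he⟩
    obtain ⟨a, rfl⟩ := M.line_surjective e
    rw [ends_line] at he
    have hm : ∀ x ∈ ({M.pt a, M.pt (M.σ a)} : Multiset (M.V ⊕ Fin r.numExt)), ∃ v, x = .inl v := by
      intro x hx
      have hx' : x ∈ ({.inl v, .inl w} : Multiset (M.V ⊕ Fin r.numExt)) := he ▸ hx
      simp only [Multiset.insert_eq_cons, Multiset.mem_cons, Multiset.mem_singleton] at hx'
      rcases hx' with rfl | rfl <;> exact ⟨_, rfl⟩
    refine Diagram.connectedWithout_iff.mpr fun χ hχ =>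
      hcut' a (hm _ (by simp)) (hm _ (by simp)) χ fun z hz hz' => ?_
    refine hχ (M.line z) ?_ _ _ (M.ends_line z)
    rw [Set.mem_singleton_iff, eq_comm, line_eq_iff]
    tauto

end FlagGraph

end QED

namespace QED

namespace Diagram

variable {r r' : Residue}

/-! ### Boundary and interior of a set of vertices -/

/-- A point is a vertex in `S`. -/
def AtSet {G : Diagram r} (S : Finset G.V) (x : G.Pt) : Prop := ∃ v ∈ S, x = .inl v

@[simp] theorem atSet_inl {G : Diagram r} {S : Finset G.V} {v : G.V} :
    AtSet S (.inl v) ↔ v ∈ S := by simp [AtSet]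

theorem isBoundary_iff {G : Diagram r} (h : G.IsLoopless) {S : Finset G.V} (z : G.Flag) :
    G.IsBoundary S z.line ↔ ¬ (AtSet S z.pt ↔ AtSet S (z.swap h).pt) := by
  classical
  unfold IsBoundary
  rw [z.ends_line h, Multiset.insert_eq_cons, ← Multiset.cons_zero, Multiset.countP_cons,
    Multiset.countP_cons]
  simp only [← AtSet.eq_def]
  by_cases h1 : AtSet S z.pt <;> by_cases h2 : AtSet S (z.swap h).pt <;> simp [h1, h2]

theorem isInside_iff {G : Diagram r} (h : G.IsLoopless) {S : Finset G.V} (z : G.Flag) :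
    G.IsInside S z.line ↔ AtSet S z.pt ∧ AtSet S (z.swap h).pt := by
  unfold IsInside
  rw [z.ends_line h]
  simp [AtSet]

theorem IsBoundary.exists_vflag {G : Diagram r} (h : G.IsOnePI) {S : Finset G.V} {e : G.E}
    (he : G.IsBoundary S e) :
    ∃ w : G.VFlag, w.line = e ∧ w.vert ∈ S ∧ ¬ AtSet S (w.flag.swap h.isLoopless).pt := by
  obtain ⟨u, rfl⟩ := h.exists_vflag_line e
  rw [← VFlag.flag_line, isBoundary_iff h.isLoopless] at he
  by_cases hu : u.vert ∈ S
  · refine ⟨u, rfl, hu, ?_⟩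
    have := atSet_inl.mpr hu
    rw [VFlag.flag_pt] at he
    tauto
  · have h1 : AtSet S (u.flag.swap h.isLoopless).pt := by
      have : ¬ AtSet S u.flag.pt := by simpa using hu
      tauto
    obtain ⟨v, hv, hv'⟩ := h1
    obtain ⟨w, hw, rfl⟩ := Flag.exists_vflag _ hv'
    refine ⟨w, ?_, hv, ?_⟩
    · rw [← VFlag.flag_line, hw, Flag.swap_line, VFlag.flag_line]
    · rw [hw, Flag.swap_swap]; simpa using hu

theorem IsPresentation.exists_of_mem {D : Diagram r} {Φ : Type} [Fintype Φ] {pt : Φ → D.Pt}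
    {line : Φ → D.E} (h : D.IsPresentation pt line) {e : D.E} {x : D.Pt} (hx : x ∈ D.ends e) :
    ∃ z, line z = e ∧ pt z = x := by
  classical
  rw [h] at hx
  simpa using hx

/-! ### Presentation of a subgraph -/

section sub

variable {G : Diagram r} (hG : G.IsOnePI) {S : Finset G.V}
  (lam : {e // G.IsBoundary S e} ≃ Fin r'.numExt)

/-- The flags of the subgraph on `S`. -/
abbrev SubFlag (S : Finset G.V) (r' : Residue) : Type := {w : G.VFlag // w.vert ∈ S} ⊕ Fin r'.numExt

noncomputable instance : Fintype (SubFlag S r') := Fintype.ofFinite _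

/-- The point of a flag of the subgraph. -/
def subPt : SubFlag S r' → {v // v ∈ S} ⊕ Fin r'.numExt :=
  Sum.elim (fun w => .inl ⟨w.1.vert, w.2⟩) .inr

/-- The line of a flag of the subgraph. -/
def subLine : SubFlag S r' → G.E := Sum.elim (fun w => w.1.line) (fun j => (lam.symm j).1)

theorem exists_vert_of_isBoundary (hG : G.IsOnePI) {e : G.E} (he : G.IsBoundary S e) :
    ∃ v ∈ S, .inl v ∈ G.ends e := by
  obtain ⟨w, rfl, hw, -⟩ := he.exists_vflag hG
  exact ⟨_, hw, w.mem⟩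

theorem subLine_mem (hG : G.IsOnePI) (z : SubFlag S r') :
    ∃ v ∈ S, .inl v ∈ G.ends (subLine lam z) := by
  rcases z with w | j
  · exact ⟨w.1.vert, w.2, w.1.mem⟩
  · exact exists_vert_of_isBoundary hG (lam.symm j).2

open scoped Classical in
/-- A line that meets `S` keeps its flags at `S`. If its other flag lies outside of `S`, this flag
is replaced by the one at the label of the line. -/
theorem sub_ends_eq (hG : G.IsOnePI) {e : G.E} (he : ∃ v ∈ S, .inl v ∈ G.ends e) :
    (G.ends e).filterMap
      (Sum.elim (fun v => if h : v ∈ S then some (.inl ⟨v, h⟩) else none) (fun _ => none)) +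
    (if h : G.IsBoundary S e then {.inr (lam ⟨e, h⟩)} else 0)
    = (Finset.univ.filter fun z => subLine lam z = e).val.map (subPt (S := S) (r' := r')) := by
  obtain ⟨v, hv, he⟩ := he
  obtain ⟨w, rfl, rfl⟩ : ∃ w : G.VFlag, w.line = e ∧ w.vert = v := ⟨⟨e, v, he⟩, rfl, rfl⟩
  have hends := w.flag.ends_line hG.isLoopless
  simp only [VFlag.flag_line, VFlag.flag_pt] at hends
  have hb := isBoundary_iff hG.isLoopless (S := S) w.flag
  simp only [VFlag.flag_line, VFlag.flag_pt, atSet_inl, hv, true_iff] at hb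
  have hfib : ∀ w' : G.VFlag, w'.line = w.line ↔ w' = w ∨ w'.flag = w.flag.swap hG.isLoopless := by
    intro w'
    rw [← VFlag.flag_line, ← VFlag.flag_line, Flag.line_eq_iff hG.isLoopless, VFlag.flag_inj]
  by_cases hs : AtSet S (w.flag.swap hG.isLoopless).pt
  · obtain ⟨v', hv', hs'⟩ := id hs
    obtain ⟨w', hw', rfl⟩ := Flag.exists_vflag _ hs'
    have hne : w ≠ w' := by
      rintro rfl
      exact w.flag.swap_ne _ hw'.symm
    have hset : (Finset.univ.filter fun z => subLine lam z = w.line)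
        = {.inl ⟨w, hv⟩, .inl ⟨w', hv'⟩} := by
      ext z
      simp only [Finset.mem_filter, Finset.mem_univ, true_and, Finset.mem_insert,
        Finset.mem_singleton]
      rcases z with ⟨w'', h''⟩ | j
      · simp only [subLine, Sum.elim_inl, Subtype.mk.injEq, Sum.inl.injEq]
        rw [hfib, ← hw', VFlag.flag_inj]
      · simp only [subLine, Sum.elim_inr, reduceCtorEq, or_self, iff_false]
        intro hj
        have := (lam.symm j).2
        rw [hj] at this
        exact hb.mp this hs
    rw [hset, Finset.insert_val_of_notMem (by simpa using hne)]
    rw [dif_neg (by rw [hb]; simpa using hs), hends, hs']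
    simp only [Multiset.insert_eq_cons, ← Multiset.cons_zero]
    rw [Multiset.filterMap_cons_some _ _ _ (b := .inl ⟨w.vert, hv⟩) (by simp [hv]),
      Multiset.filterMap_cons_some _ _ _ (b := .inl ⟨w'.vert, hv'⟩) (by simp [hv'])]
    simp [subPt]
  · have hbd := hb.mpr hs
    have hset : (Finset.univ.filter fun z => subLine lam z = w.line)
        = {.inl ⟨w, hv⟩, .inr (lam ⟨w.line, hbd⟩)} := by
      ext z
      simp only [Finset.mem_filter, Finset.mem_univ, true_and, Finset.mem_insert,
        Finset.mem_singleton]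
      rcases z with ⟨w'', h''⟩ | j
      · simp only [subLine, Sum.elim_inl, Subtype.mk.injEq, Sum.inl.injEq, reduceCtorEq, or_false]
        rw [hfib, or_iff_left]
        intro hh
        exact hs (by rw [← hh]; simpa using h'')
      · simp only [subLine, Sum.elim_inr, reduceCtorEq, false_or, Sum.inr.injEq]
        rw [← Equiv.symm_apply_eq, Subtype.ext_iff]
    rw [hset, Finset.insert_val_of_notMem (by simp)]
    rw [dif_pos hbd, hends]
    simp only [Multiset.insert_eq_cons, ← Multiset.cons_zero]
    rw [Multiset.filterMap_cons_some _ _ _ (b := .inl ⟨w.vert, hv⟩) (by simp [hv]),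
      Multiset.filterMap_cons_none]
    · simp [subPt]
    · cases hp : (w.flag.swap hG.isLoopless).pt with
      | inl v' =>
        have : v' ∉ S := by rw [hp] at hs; simpa using hs
        simp [this]
      | inr j => simp

/-- The line of a flag of the subgraph, as a line of the subgraph. -/
def subE (hG : G.IsOnePI) (z : SubFlag S r') : (G.sub S r' lam).E :=
  ⟨subLine lam z, subLine_mem lam hG z⟩

theorem sub_isPresentation :
    (G.sub S r' lam).IsPresentation (subPt (S := S) (r' := r')) (subE lam hG) := by
  classical
  rintro ⟨e, he⟩
  refine (sub_ends_eq lam hG he).trans ?_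
  congr 2
  ext z
  simp only [Finset.mem_filter, Finset.mem_univ, true_and]
  exact ⟨fun h => Subtype.ext h, fun h => congrArg Subtype.val h⟩

end sub

/-! ### Embeddings of one-particle irreducible graphs as subgraphs -/

/-- An embedding of `D` in `G` as a full subgraph, given by the image of the flags at vertices: it
contains all the flags at its vertices, the two flags of an internal line remain matched, and the
lines at the legs leave the subgraph. -/
structure IsEmb {D : Diagram r'} {G : Diagram r} (hD : D.IsOnePI) (hG : G.IsOnePI)
    (J : D.VFlag → G.VFlag) : Prop where
  onV : ∃ f : D.V → G.V, Function.Injective f ∧ ∀ u, (J u).vert = f u.vert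
  ty : ∀ u, G.lineType (J u).line = D.lineType u.line
  inj : Function.Injective J
  surj : ∀ w : G.VFlag, (∃ u, (J u).vert = w.vert) → ∃ u, J u = w
  swap : ∀ u u' : D.VFlag, u.flag.swap hD.isLoopless = u'.flag →
    (J u).flag.swap hG.isLoopless = (J u').flag
  leg : ∀ j u, (J (hD.leg j)).flag.swap hG.isLoopless ≠ (J u).flag

theorem IsEmb.line_eq_iff {D : Diagram r'} {G : Diagram r} {hD : D.IsOnePI} {hG : G.IsOnePI}
    {J : D.VFlag → G.VFlag} (hJ : IsEmb hD hG J) (u u' : D.VFlag) :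
    (J u').line = (J u).line ↔ u'.line = u.line := by
  rw [← VFlag.flag_line, ← VFlag.flag_line, Flag.line_eq_iff hG.isLoopless,
    ← VFlag.flag_line, ← VFlag.flag_line, Flag.line_eq_iff hD.isLoopless, VFlag.flag_inj,
    VFlag.flag_inj, hJ.inj.eq_iff]
  refine or_congr Iff.rfl ?_
  constructor
  · intro hh
    rcases hD.eq_leg_or u with ⟨w, hw⟩ | ⟨j, rfl⟩
    · rw [hJ.swap _ _ hw, VFlag.flag_inj] at hh
      rw [hJ.inj hh, hw]
    · exact absurd hh.symm (hJ.leg j u')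
  · intro hh
    exact (hJ.swap _ _ hh.symm).symm

/-- An isomorphism of `D` with the subgraph on `S`, for some labelling. -/
abbrev EmbIso (D : Diagram r') (G : Diagram r) (S : Finset G.V) : Type :=
  Σ lam : {e // G.IsBoundary S e} ≃ Fin r'.numExt, Iso D (G.sub S r' lam)

section embIso

variable {D : Diagram r'} {G : Diagram r} (hD : D.IsOnePI) (hG : G.IsOnePI) {S : Finset G.V}

theorem EmbIso.mem (hG : G.IsOnePI) (x : EmbIso D G S) (u : D.VFlag) :
    Sum.inl (x.2.onV u.vert).1 ∈ G.ends (x.2.onE u.line).1 := by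
  have h1 : Sum.inl (x.2.onV u.vert) ∈ (G.sub S r' x.1).ends (x.2.onE u.line) := by
    rw [x.2.ends_eq]
    exact Multiset.mem_map_of_mem (Sum.map x.2.onV id) u.mem
  obtain ⟨⟨w, hw⟩ | j, hz, hz'⟩ := (sub_isPresentation hG x.1).exists_of_mem h1
  · have h2 := Sum.inl.inj hz'
    rw [← hz, ← h2]
    exact w.mem
  · cases hz'

/-- The image of a flag at a vertex. -/
def EmbIso.onVFlag (x : EmbIso D G S) (u : D.VFlag) : G.VFlag :=
  ⟨(x.2.onE u.line).1, (x.2.onV u.vert).1, x.mem hG u⟩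

theorem EmbIso.mem_iff (hD : D.IsOnePI) (x : EmbIso D G S) (v : G.V) :
    v ∈ S ↔ ∃ u, (x.onVFlag hG u).vert = v := by
  constructor
  · intro hv
    obtain ⟨u, hu⟩ := hD.exists_vflag (x.2.onV.symm ⟨v, hv⟩)
    refine ⟨u, (congrArg (fun v => (x.2.onV v).1) hu).trans ?_⟩
    exact congrArg Subtype.val (x.2.onV.apply_symm_apply _)
  · rintro ⟨u, rfl⟩
    exact (x.2.onV u.vert).2

/-- The flags of a full subgraph at its vertices are all the flags of `G` at these vertices, and
the boundary lines are the ones that become external. -/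
theorem EmbIso.isEmb (x : EmbIso D G S) : IsEmb hD hG (x.onVFlag hG) := by
  have hsub : (G.sub S r' x.1).IsOnePI := x.2.isOnePI hD
  have hinj : Function.Injective (x.onVFlag hG) := by
    intro a b hab
    simp only [onVFlag, VFlag.mk.injEq] at hab
    exact VFlag.ext (x.2.onE.injective (Subtype.ext hab.1)) (x.2.onV.injective (Subtype.ext hab.2))
  refine ⟨⟨fun v => (x.2.onV v).1, fun a b hab => x.2.onV.injective (Subtype.ext hab),
    fun _ => rfl⟩, fun u => x.2.lineType_eq u.line, hinj, ?_, ?_, ?_⟩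
  · rintro w ⟨u, hu⟩
    have hw : w.vert ∈ S := by rw [← hu]; exact (x.2.onV u.vert).2
    obtain ⟨f, hf⟩ := x.2.onFlag_surjective hD.isLoopless.isPresentation
      ⟨subE x.1 hG (.inl ⟨w, hw⟩), subPt (.inl ⟨w, hw⟩), (sub_isPresentation hG x.1).mem _⟩
    have h1 := congrArg Flag.line hf
    have h2 := congrArg Flag.pt hf
    change Sum.map x.2.onV id f.pt = _ at h2
    rcases hD.eq_labelFlag_or f with ⟨u', rfl⟩ | ⟨j, rfl⟩
    · refine ⟨u', VFlag.ext ?_ ?_⟩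
      · exact congrArg Subtype.val h1
      · exact congrArg Subtype.val (Sum.inl.inj h2)
    · rw [hD.labelFlag_pt] at h2
      cases h2
  · intro u u' hu
    refine Flag.swap_eq_of_ne _ ?_ ?_
    · have : u'.line = u.line := by rw [← VFlag.flag_line, ← hu]; simp
      simp [onVFlag, this]
    · rw [Ne, VFlag.flag_inj, hinj.eq_iff]
      rintro rfl
      exact u'.flag.swap_ne _ hu
  · intro j u hh
    have h1 := congrArg Flag.line hh
    simp only [Flag.swap_line, VFlag.flag_line, onVFlag] at h1
    have h2 : (hD.leg j).flag.line = u.flag.line := x.2.onE.injective (Subtype.ext h1)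
    rcases (Flag.line_eq_iff hD.isLoopless).mp h2 with h3 | h3
    · rw [VFlag.flag_inj] at h3
      subst h3
      exact Flag.swap_ne _ _ hh
    · rw [← Flag.swap_inj hD.isLoopless, Flag.swap_swap, hD.swap_leg] at h3
      exact hD.flag_ne_labelFlag _ _ h3.symm

theorem mem_ends_sub_inr (lam : {e // G.IsBoundary S e} ≃ Fin r'.numExt)
    (hG : G.IsOnePI) {e : (G.sub S r' lam).E} {j} (h : .inr j ∈ (G.sub S r' lam).ends e) :
    e.1 = (lam.symm j).1 := by
  obtain ⟨⟨w, hw⟩ | j', rfl, hz'⟩ := (sub_isPresentation hG lam).exists_of_mem h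
  · cases hz'
  · cases hz'
    rfl

theorem EmbIso.onVFlag_leg_line (x : EmbIso D G S) (j) :
    (x.onVFlag hG (hD.leg j)).line = (x.1.symm j).1 := by
  refine mem_ends_sub_inr x.1 hG ?_
  rw [x.2.ends_eq]
  have h1 := (hD.leg j).flag.ends_line hD.isLoopless
  rw [hD.swap_leg, VFlag.flag_line] at h1
  rw [h1]
  simp

theorem EmbIso.onVFlag_injective (hD : D.IsOnePI) :
    Function.Injective (EmbIso.onVFlag hG (D := D) (S := S)) := by
  rintro ⟨lam, i⟩ ⟨lam', i'⟩ hh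
  have hlam : lam = lam' := by
    rw [← Equiv.symm_bijective.injective.eq_iff]
    ext j
    have h1 := onVFlag_leg_line hD hG ⟨lam, i⟩ j
    have h2 := onVFlag_leg_line hD hG ⟨lam', i'⟩ j
    rw [hh] at h1
    exact h1.symm.trans h2
  subst hlam
  congr 1
  refine Iso.ext' (fun v => ?_) fun e => ?_
  · obtain ⟨u, rfl⟩ := hD.exists_vflag v
    exact Subtype.ext (congrArg VFlag.vert (congrFun hh u))
  · obtain ⟨u, rfl⟩ := hD.exists_vflag_line e
    exact Subtype.ext (congrArg VFlag.line (congrFun hh u))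

/-- The flags of a graph are the flags at vertices and at labels. -/
noncomputable def IsOnePI.flagEquiv : D.VFlag ⊕ Fin r'.numExt ≃ D.Flag :=
  Equiv.ofBijective (Sum.elim VFlag.flag hD.labelFlag) <| by
    constructor
    · rintro (u | j) (u' | j') hh
      · simpa using hh
      · exact absurd hh (hD.flag_ne_labelFlag _ _)
      · exact absurd hh.symm (hD.flag_ne_labelFlag _ _)
      · exact congrArg _ (hD.labelFlag_injective hh)
    · intro z
      rcases hD.eq_labelFlag_or z with ⟨u, rfl⟩ | ⟨j, rfl⟩
      · exact ⟨.inl u, rfl⟩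
      · exact ⟨.inr j, rfl⟩

theorem IsEmb.leg_isBoundary {J : D.VFlag → G.VFlag} (hJ : IsEmb hD hG J)
    (hS : ∀ v, v ∈ S ↔ ∃ u, (J u).vert = v) (j) : G.IsBoundary S (J (hD.leg j)).line := by
  rw [← VFlag.flag_line, isBoundary_iff hG.isLoopless]
  have h1 : AtSet S (J (hD.leg j)).flag.pt := by
    rw [VFlag.flag_pt, atSet_inl, hS]; exact ⟨_, rfl⟩
  simp only [h1, true_iff]
  rintro ⟨v, hv, hv'⟩
  obtain ⟨w, hw, rfl⟩ := Flag.exists_vflag _ hv'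
  obtain ⟨u, rfl⟩ := hJ.surj w ((hS _).mp hv)
  exact hJ.leg j u hw.symm

theorem IsEmb.exists_leg_of_isBoundary {J : D.VFlag → G.VFlag} (hJ : IsEmb hD hG J)
    (hS : ∀ v, v ∈ S ↔ ∃ u, (J u).vert = v) {e : G.E} (he : G.IsBoundary S e) :
    ∃ j, (J (hD.leg j)).line = e := by
  obtain ⟨w, rfl, hw, hw'⟩ := he.exists_vflag hG
  obtain ⟨u, rfl⟩ := hJ.surj w ((hS _).mp hw)
  rcases hD.eq_leg_or u with ⟨u', hu'⟩ | ⟨j, rfl⟩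
  · refine absurd ?_ hw'
    rw [hJ.swap _ _ hu', VFlag.flag_pt, atSet_inl, hS]
    exact ⟨_, rfl⟩
  · exact ⟨j, rfl⟩

/-- An embedding in terms of flags determines the labelling of the boundary lines, by the images of
the legs, and then the isomorphism with the subgraph. -/
theorem IsEmb.exists_embIso {J : D.VFlag → G.VFlag} (hJ : IsEmb hD hG J)
    (hS : ∀ v, v ∈ S ↔ ∃ u, (J u).vert = v) : ∃ x : EmbIso D G S, x.onVFlag hG = J := by
  classical
  obtain ⟨f, hf, hfv⟩ := hJ.onV
  have hlegs : Function.Bijective fun j =>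
      (⟨(J (hD.leg j)).line, hJ.leg_isBoundary hD hG hS j⟩ : {e // G.IsBoundary S e}) := by
    constructor
    · intro j j' hh
      simp only [Subtype.mk.injEq] at hh
      rw [hJ.line_eq_iff, ← VFlag.flag_line, ← VFlag.flag_line,
        Flag.line_eq_iff hD.isLoopless] at hh
      rcases hh with hh | hh
      · rw [VFlag.flag_inj] at hh; exact hD.leg_injective hh
      · exact absurd hh.symm (hD.swap_ne_flag_leg _ _)
    · rintro ⟨e, he⟩
      obtain ⟨j, rfl⟩ := hJ.exists_leg_of_isBoundary hD hG hS he
      exact ⟨j, rfl⟩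
  let lam : {e // G.IsBoundary S e} ≃ Fin r'.numExt := (Equiv.ofBijective _ hlegs).symm
  have hlam : ∀ j, (lam.symm j).1 = (J (hD.leg j)).line := fun j => rfl
  have hV : Function.Bijective fun v : D.V => (⟨f v, by
      rw [hS]; obtain ⟨u, rfl⟩ := hD.exists_vflag v; exact ⟨u, hfv u⟩⟩ : {v // v ∈ S}) := by
    constructor
    · intro a b hab
      exact hf (congrArg Subtype.val hab)
    · rintro ⟨v, hv⟩
      obtain ⟨u, hu⟩ := (hS v).mp hv
      exact ⟨u.vert, Subtype.ext ((hfv u).symm.trans hu)⟩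
  have hF : Function.Bijective fun u : D.VFlag => (⟨J u, by rw [hS]; exact ⟨u, rfl⟩⟩ :
      {w : G.VFlag // w.vert ∈ S}) := by
    constructor
    · intro a b hab
      exact hJ.inj (congrArg Subtype.val hab)
    · rintro ⟨w, hw⟩
      obtain ⟨u, hu⟩ := hJ.surj w ((hS _).mp hw)
      exact ⟨u, Subtype.ext hu⟩
  let eV := Equiv.ofBijective _ hV
  let eF := Equiv.ofBijective _ hF
  let h : SubFlag S r' ≃ D.Flag := (Equiv.sumCongr eF (Equiv.refl _)).symm.trans hD.flagEquiv
  have h1 : ∀ u, h (.inl (eF u)) = u.flag := by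
    intro u
    simp only [h, Equiv.trans_apply, Equiv.sumCongr_symm, Equiv.sumCongr_apply, Sum.map_inl,
      Equiv.symm_apply_apply]
    rfl
  have h2 : ∀ j, h (.inr j) = hD.labelFlag j := by
    intro j; rfl
  -- a flag at a vertex on the line of a given flag of the subgraph
  have key : ∀ z : SubFlag S r', ∃ u : D.VFlag, (h z).line = u.line ∧
      subLine lam z = (J u).line := by
    rintro (w | j)
    · obtain ⟨u, rfl⟩ := eF.surjective w
      exact ⟨u, by rw [h1]; rfl, rfl⟩
    · refine ⟨hD.leg j, ?_, hlam j⟩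
      rw [h2, ← hD.swap_leg, Flag.swap_line, VFlag.flag_line]
  obtain ⟨i, hiV, hiE⟩ := exists_iso (D := G.sub S r' lam) (sub_isPresentation hG lam)
    hD.isLoopless eV.symm h
    (by
      rintro (w | j)
      · obtain ⟨u, rfl⟩ := eF.surjective w
        rw [h1]
        have h3 : (⟨(J u).vert, (eF u).2⟩ : {v // v ∈ S}) = eV u.vert := Subtype.ext (hfv u)
        change Sum.inl u.vert = Sum.inl (eV.symm ⟨(J u).vert, (eF u).2⟩)
        rw [h3, Equiv.symm_apply_apply]
      · rw [h2, hD.labelFlag_pt]; rfl)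
    (by
      intro z
      obtain ⟨u, hu, hu'⟩ := key z
      rw [hu]
      change _ = G.lineType (subLine lam z)
      rw [hu', hJ.ty])
    (by
      intro z z'
      obtain ⟨u, hu, hu'⟩ := key z
      obtain ⟨u₂, hu₂, hu₂'⟩ := key z'
      rw [hu, hu₂]
      refine Iff.trans ?_ Subtype.ext_iff.symm
      change _ ↔ subLine lam z = subLine lam z'
      rw [hu', hu₂', hJ.line_eq_iff])
    (by
      rintro ⟨e, v, hv, he⟩
      exact ⟨.inl ⟨⟨e, v, he⟩, hv⟩, rfl⟩)
  refine ⟨⟨lam, i.symm⟩, funext fun u => VFlag.ext ?_ ?_⟩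
  · have h3 := hiE (.inl (eF u))
    rw [h1, VFlag.flag_line] at h3
    exact (congrArg Subtype.val (i.onE.eq_symm_apply.mpr h3)).symm
  · change (i.onV.symm u.vert).1 = _
    rw [hiV]
    exact (hfv u).symm

end embIso

end Diagram

end QED

namespace QED

namespace Diagram

variable {r r' : Residue}

/-! ### Labellings of a subgraph -/

section labelling

variable {G : Diagram r} (hG : G.IsOnePI) {S : Finset G.V}

theorem lineType_symm_of_isOnePI {lam : {e // G.IsBoundary S e} ≃ Fin r'.numExt}
    (hG : G.IsOnePI) (h : (G.sub S r' lam).IsOnePI) (j) :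
    G.lineType (lam.symm j).1 = r'.extType j := by
  have h1 := EmbIso.onVFlag_leg_line h hG ⟨lam, Iso.refl _⟩ j
  have h2 := (EmbIso.isEmb h hG ⟨lam, Iso.refl _⟩).ty (h.leg j)
  rw [h1, h.leg_type] at h2
  exact h2

theorem isOnePI_sub_trans {lam : {e // G.IsBoundary S e} ≃ Fin r'.numExt}
    (h : (G.sub S r' lam).IsOnePI) (π : Equiv.Perm (Fin r'.numExt))
    (hπ : ∀ j, r'.extType (π j) = r'.extType j) : (G.sub S r' (lam.trans π)).IsOnePI := by
  classical
  refine RelabelIso.isOnePI (G := G.sub S r' lam) (π := π) ⟨Equiv.refl _, Equiv.refl _,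
    fun _ => rfl, fun e => ?_⟩ hπ h
  change Multiset.filterMap _ (G.ends e.1) + _ = Multiset.map (Sum.map id π)
    (Multiset.filterMap _ (G.ends e.1) + _)
  rw [Multiset.map_add]
  congr 1
  · rw [Multiset.map_filterMap]
    refine congrArg (fun f => Multiset.filterMap f _) (funext fun x => ?_)
    rcases x with v | j
    · by_cases hv : v ∈ S <;> simp [hv]
    · simp
  · change (if h : G.IsBoundary S e.1 then _ else _) = _
    split_ifs
    · rfl
    · rfl

/-- The residue of a subgraph does not depend on its labelling: it is determined by the number and
the types of the boundary lines. -/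
theorem Labelling.fst_eq (hG : G.IsOnePI) (l l' : G.Labelling S) : l.1 = l'.1 := by
  obtain ⟨r₁, lam₁, h₁⟩ := l
  obtain ⟨r₂, lam₂, h₂⟩ := l'
  have hc : r₁.numExt = r₂.numExt := by
    have := Fintype.card_congr (lam₁.symm.trans lam₂)
    simpa using this
  have key : ∀ j : Fin r₁.numExt, r₂.extType (lam₂ (lam₁.symm j)) = r₁.extType j := by
    intro j
    rw [← lineType_symm_of_isOnePI hG h₁, ← lineType_symm_of_isOnePI hG h₂,
      Equiv.symm_apply_apply]
  have h2 : ∀ r₁ r₂ : Residue, r₁.numExt = r₂.numExt → (∃ (i : Fin r₁.numExt) (j : Fin r₂.numExt),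
      r₁.numExt = 2 → r₂.extType j = r₁.extType i) → r₁ = r₂ := by decide
  have j0 : Fin r₁.numExt := ⟨0, by have := two_le_numExt (r := r₁); lia⟩
  exact h2 _ _ hc ⟨j0, _, fun _ => key j0⟩

/-- Exactly one pair of external lines can be exchanged: the two electron lines of a vertex graph
or of an electron self-energy, or the two photon lines of a photon self-energy. -/
theorem card_typed_perm (r : Residue) :
    Nat.card {π : Equiv.Perm (Fin r.numExt) // ∀ j, r.extType (π j) = r.extType j} = 2 := by
  rw [Nat.card_eq_fintype_card]
  cases r <;> decide

/-- The labellings are a torsor under the permutations of the external lines that respect the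
types. -/
theorem card_labelling (hG : G.IsOnePI) (l : G.Labelling S) : Nat.card (G.Labelling S) = 2 := by
  obtain ⟨r₁, lam₁, h₁⟩ := l
  rw [← card_typed_perm r₁]
  symm
  refine Nat.card_congr (Equiv.ofBijective
    (fun π => (⟨r₁, lam₁.trans π.1, isOnePI_sub_trans h₁ π.1 π.2⟩ : G.Labelling S)) ⟨?_, ?_⟩)
  · rintro ⟨π, hπ⟩ ⟨π', hπ'⟩ hh
    have h2 := congrArg Subtype.val (eq_of_heq (Sigma.mk.inj hh).2)
    have : π = π' := by
      ext1 j
      have := congrArg (fun f : {e // G.IsBoundary S e} ≃ Fin r₁.numExt => f (lam₁.symm j)) h2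
      simpa using this
    simp [this]
  · intro l'
    obtain rfl : r₁ = l'.1 := Labelling.fst_eq hG ⟨r₁, lam₁, h₁⟩ l'
    obtain ⟨r₂, lam₂, h₂⟩ := l'
    refine ⟨⟨lam₁.symm.trans lam₂, fun j => ?_⟩, ?_⟩
    · have h3 := lineType_symm_of_isOnePI hG h₂ (lam₂ (lam₁.symm j))
      rw [Equiv.symm_apply_apply] at h3
      exact h3.symm.trans (lineType_symm_of_isOnePI hG h₁ j)
    · refine congrArg (Sigma.mk _) (Subtype.ext ?_)
      change lam₁.trans (lam₁.symm.trans lam₂) = lam₂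
      ext1 e
      simp

theorem EmbIso.isVertexSub_iff {D : Diagram r'} (hD : D.IsOnePI) (hG : G.IsOnePI)
    (x : EmbIso D G S) : G.IsVertexSub S ↔ r' = .vertex := by
  have l : G.Labelling S := ⟨r', x.1, x.2.isOnePI hD⟩
  constructor
  · rintro ⟨l', hl'⟩
    rw [← hl']
    exact Labelling.fst_eq hG ⟨r', x.1, x.2.isOnePI hD⟩ l'
  · intro h
    exact ⟨⟨r', x.1, x.2.isOnePI hD⟩, h⟩

end labelling

/-! ### Contraction -/

/-- The embeddings of a family of one-particle irreducible graphs as disjoint subgraphs. -/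
structure IsPieces {ι : Type} {t : ι → Residue} {D : ∀ i, Diagram (t i)}
    (hD : ∀ i, (D i).IsOnePI) {G : Diagram r} (hG : G.IsOnePI)
    (J : ∀ i, (D i).VFlag → G.VFlag) : Prop where
  isEmb : ∀ i, IsEmb (hD i) hG (J i)
  disj : ∀ i i' u u', (J i u).vert = (J i' u').vert → i = i'

section contract

variable {ι : Type} {t : ι → Residue} {D : ∀ i, Diagram (t i)}
  {hD : ∀ i, (D i).IsOnePI} {G : Diagram r} {hG : G.IsOnePI} {J : ∀ i, (D i).VFlag → G.VFlag}

theorem IsPieces.flag_eq (hJ : IsPieces hD hG J) {i i' u u'}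
    (h : (J i u).flag = (J i' u').flag) : i = i' :=
  hJ.disj i i' u u' (by rw [VFlag.flag_inj] at h; rw [h])

variable (hD hG J) in
/-- Two flags belong to the same line, or to the two external lines of a self-energy graph. -/
def Linked (a b : G.Flag) : Prop :=
  b = a.swap hG.isLoopless ∨
    ∃ i, t i ≠ .vertex ∧ ∃ j j', a = (J i ((hD i).leg j)).flag ∧ b = (J i ((hD i).leg j')).flag

variable (J) in
/-- Two flags have the same point after contraction of the vertex graphs. -/
def SamePt (a b : G.Flag) : Prop :=
  a.pt = b.pt ∨ ∃ i, t i = .vertex ∧ ∃ u u', a = (J i u).flag ∧ b = (J i u').flag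

variable (hD J) in
/-- The flags that survive the contraction: those outside of the pieces, and the legs of the
vertex graphs. -/
def Survives (z : G.Flag) : Prop :=
  (∀ i u, z ≠ (J i u).flag) ∨ ∃ i, t i = .vertex ∧ ∃ j, z = (J i ((hD i).leg j)).flag

/-- The description of the isomorphisms of the contracted graph with `Γ'` in terms of flags: `k`
sends the flags of `Γ'` to the surviving flags. Two flags of `Γ'` have the same point if the
contraction of the vertex graphs identifies their points, and the same line if they belong to one
chain of lines and self-energies. By `legs`, there are no closed chains of self-energies. -/
structure IsContraction {Γ' : Diagram r} (hD : ∀ i, (D i).IsOnePI) (hG : G.IsOnePI)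
    (hΓ' : Γ'.IsOnePI) (J : ∀ i, (D i).VFlag → G.VFlag) (k : Γ'.Flag → G.Flag) : Prop where
  inj : Function.Injective k
  range : ∀ z, (∃ y, k y = z) ↔ Survives hD J z
  ty : ∀ z, G.lineType (k z).line = Γ'.lineType z.line
  label : ∀ j, k (hΓ'.labelFlag j) = hG.labelFlag j
  pt : ∀ z z', z.pt = z'.pt ↔ SamePt J (k z) (k z')
  line : ∀ z z', z.line = z'.line ↔ Relation.EqvGen (Linked hD hG J) (k z) (k z')
  legs : ∀ i, t i ≠ .vertex → ∀ j, ∃ z,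
    Relation.EqvGen (Linked hD hG J) (J i ((hD i).leg j)).flag (k z)

variable {S : ι → Finset G.V}

section points

variable (hJ : IsPieces hD hG J) (hS : ∀ i v, v ∈ S i ↔ ∃ u, (J i u).vert = v)

theorem IsPieces.eq_of_mem (hJ : IsPieces hD hG J)
    (hS : ∀ i v, v ∈ S i ↔ ∃ u, (J i u).vert = v) {i i' v} (h : v ∈ S i) (h' : v ∈ S i') :
    i = i' := by
  obtain ⟨u, rfl⟩ := (hS _ _).mp h
  obtain ⟨u', h'⟩ := (hS _ _).mp h'
  exact hJ.disj _ _ _ _ h'.symm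

theorem IsPieces.isVertexSub_iff (hJ : IsPieces hD hG J)
    (hS : ∀ i v, v ∈ S i ↔ ∃ u, (J i u).vert = v) (i) :
    G.IsVertexSub (S i) ↔ t i = .vertex := by
  obtain ⟨x, -⟩ := (hJ.isEmb i).exists_embIso (hD i) hG (hS i)
  exact x.isVertexSub_iff (hD i) hG

theorem IsPieces.exists_vflag (hJ : IsPieces hD hG J)
    (hS : ∀ i v, v ∈ S i ↔ ∃ u, (J i u).vert = v) {i} {w : G.VFlag} (h : w.vert ∈ S i) :
    ∃ u, J i u = w := (hJ.isEmb i).surj w ((hS _ _).mp h)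

variable [Fintype ι]

open scoped Classical in
/-- The set of the vertex sets of a family of subgraphs. -/
noncomputable def pieceSet (S : ι → Finset G.V) : Finset (Finset G.V) := Finset.univ.image S

@[simp] theorem mem_pieceSet {B : Finset G.V} : B ∈ pieceSet S ↔ ∃ i, S i = B := by
  classical
  simp [pieceSet]

theorem contractPoint_outside {v : G.V} (hv : ∀ B ∈ pieceSet S, v ∉ B) :
    G.contractPoint (pieceSet S) (.inl v) = some (.inl (.inl ⟨v, hv⟩)) := by
  simp only [contractPoint]
  rw [dif_pos hv]

theorem IsPieces.contractPoint_vertex (hJ : IsPieces hD hG J)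
    (hS : ∀ i v, v ∈ S i ↔ ∃ u, (J i u).vert = v) {i} {v : G.V} (hv : v ∈ S i)
    (h : S i ∈ pieceSet S ∧ G.IsVertexSub (S i)) :
    G.contractPoint (pieceSet S) (.inl v) = some (.inl (.inr ⟨S i, h⟩)) := by
  have h1 : ¬ ∀ B ∈ pieceSet S, v ∉ B := fun hh => hh _ h.1 hv
  have h2 : ∃ B, (B ∈ pieceSet S ∧ G.IsVertexSub B) ∧ v ∈ B := ⟨S i, h, hv⟩
  simp only [contractPoint]
  rw [dif_neg h1, dif_pos h2]
  obtain ⟨i', hi'⟩ := mem_pieceSet.mp h2.choose_spec.1.1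
  have h3 : i = i' := hJ.eq_of_mem hS hv (by rw [hi']; exact h2.choose_spec.2)
  subst h3
  simp only [hi']

theorem IsPieces.contractPoint_self (hJ : IsPieces hD hG J)
    (hS : ∀ i v, v ∈ S i ↔ ∃ u, (J i u).vert = v) {i} {v : G.V} (hv : v ∈ S i)
    (ht : t i ≠ .vertex) : G.contractPoint (pieceSet S) (.inl v) = none := by
  have h1 : ¬ ∀ B ∈ pieceSet S, v ∉ B := fun hh => hh _ (mem_pieceSet.mpr ⟨i, rfl⟩) hv
  simp only [contractPoint]
  rw [dif_neg h1, dif_neg]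
  rintro ⟨B, ⟨hB, hB'⟩, hvB⟩
  obtain ⟨i', rfl⟩ := mem_pieceSet.mp hB
  obtain rfl := hJ.eq_of_mem hS hv hvB
  exact ht ((hJ.isVertexSub_iff hS i).mp hB')

/-- The line of a flag does not lie inside of a piece. -/
def NotInside (S : ι → Finset G.V) (z : G.Flag) : Prop := ∀ B ∈ pieceSet S, ¬ G.IsInside B z.line

/-- The lines at the legs of a piece survive the contraction, since pieces have no vertices in
common and a leg leaves its own piece. -/
theorem IsPieces.notInside_leg (hJ : IsPieces hD hG J)
    (hS : ∀ i v, v ∈ S i ↔ ∃ u, (J i u).vert = v) (i j) :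
    NotInside S (J i ((hD i).leg j)).flag := by
  intro B hB hin
  obtain ⟨i', rfl⟩ := mem_pieceSet.mp hB
  rw [isInside_iff hG.isLoopless] at hin
  have h1 : (J i ((hD i).leg j)).vert ∈ S i := (hS _ _).mpr ⟨_, rfl⟩
  have h2 := hin.1
  rw [VFlag.flag_pt, atSet_inl] at h2
  obtain rfl := hJ.eq_of_mem hS h1 h2
  obtain ⟨v, hv, hv'⟩ := hin.2
  obtain ⟨w, hw, rfl⟩ := Flag.exists_vflag _ hv'
  obtain ⟨u, rfl⟩ := hJ.exists_vflag hS hv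
  exact (hJ.isEmb i).leg j u hw.symm

/-- A flag survives when its line is not inside of a vertex graph or a self-energy and its point is
not removed: a flag at a self-energy disappears even where its line remains as part of a longer
line. -/
theorem IsPieces.survives_iff (hJ : IsPieces hD hG J)
    (hS : ∀ i v, v ∈ S i ↔ ∃ u, (J i u).vert = v) (z : G.Flag) :
    Survives hD J z ↔ NotInside S z ∧ (G.contractPoint (pieceSet S) z.pt).isSome := by
  constructor
  · rintro (h | ⟨i, ht, j, rfl⟩)
    · constructor
      · intro B hB hin
        obtain ⟨i, rfl⟩ := mem_pieceSet.mp hB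
        rw [isInside_iff hG.isLoopless] at hin
        obtain ⟨v, hv, hv'⟩ := hin.1
        obtain ⟨w, hw, rfl⟩ := Flag.exists_vflag _ hv'
        obtain ⟨u, rfl⟩ := hJ.exists_vflag hS hv
        exact h i u hw.symm
      · cases hp : z.pt with
        | inr j => simp [contractPoint]
        | inl v =>
          obtain ⟨w, rfl, rfl⟩ := Flag.exists_vflag _ hp
          rw [contractPoint_outside]
          · rfl
          · intro B hB hv
            obtain ⟨i, rfl⟩ := mem_pieceSet.mp hB
            obtain ⟨u, rfl⟩ := hJ.exists_vflag hS hv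
            exact h i u rfl
    · refine ⟨hJ.notInside_leg hS i j, ?_⟩
      rw [VFlag.flag_pt, hJ.contractPoint_vertex hS ((hS i _).mpr ⟨_, rfl⟩)
        ⟨mem_pieceSet.mpr ⟨i, rfl⟩, (hJ.isVertexSub_iff hS i).mpr ht⟩]
      rfl
  · rintro ⟨h1, h2⟩
    by_cases h : ∀ i u, z ≠ (J i u).flag
    · exact .inl h
    · push Not at h
      obtain ⟨i, u, rfl⟩ := h
      have hu : (J i u).vert ∈ S i := (hS _ _).mpr ⟨_, rfl⟩
      by_cases ht : t i = .vertex
      · refine .inr ⟨i, ht, ?_⟩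
        rcases (hD i).eq_leg_or u with ⟨u', hu'⟩ | ⟨j, rfl⟩
        · exfalso
          refine h1 (S i) (mem_pieceSet.mpr ⟨i, rfl⟩) ?_
          rw [isInside_iff hG.isLoopless, (hJ.isEmb i).swap _ _ hu', VFlag.flag_pt, VFlag.flag_pt,
            atSet_inl, atSet_inl]
          exact ⟨hu, (hS _ _).mpr ⟨_, rfl⟩⟩
        · exact ⟨j, rfl⟩
      · rw [VFlag.flag_pt, hJ.contractPoint_self hS hu ht] at h2
        cases h2

/-- Contraction identifies the points of two surviving flags only within one vertex graph. -/
theorem IsPieces.contractPoint_eq_iff (hJ : IsPieces hD hG J)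
    (hS : ∀ i v, v ∈ S i ↔ ∃ u, (J i u).vert = v) {a b : G.Flag} (ha : Survives hD J a)
    (hb : Survives hD J b) :
    G.contractPoint (pieceSet S) a.pt = G.contractPoint (pieceSet S) b.pt ↔ SamePt J a b := by
  -- the contracted point of a surviving flag: a label, a vertex outside of the pieces, or a piece
  have key : ∀ a, Survives hD J a →
      ((∃ j, a.pt = .inr j ∧ G.contractPoint (pieceSet S) a.pt = some (.inr j)) ∨
      (∃ v h, a.pt = .inl v ∧ G.contractPoint (pieceSet S) a.pt = some (.inl (.inl ⟨v, h⟩)))) ∨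
      (∃ i h, t i = .vertex ∧ (∃ u, a = (J i u).flag) ∧
        G.contractPoint (pieceSet S) a.pt = some (.inl (.inr ⟨S i, h⟩))) := by
    rintro a (h | ⟨i, ht, j, rfl⟩)
    · left
      cases hp : a.pt with
      | inr j => exact .inl ⟨j, rfl, rfl⟩
      | inl v =>
        obtain ⟨w, rfl, rfl⟩ := Flag.exists_vflag _ hp
        refine .inr ⟨w.vert, ?_, rfl, contractPoint_outside _⟩
        intro B hB hv
        obtain ⟨i, rfl⟩ := mem_pieceSet.mp hB
        obtain ⟨u, rfl⟩ := hJ.exists_vflag hS hv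
        exact h i u rfl
    · right
      exact ⟨i, ⟨mem_pieceSet.mpr ⟨i, rfl⟩, (hJ.isVertexSub_iff hS i).mpr ht⟩, ht, ⟨_, rfl⟩,
        hJ.contractPoint_vertex hS ((hS i _).mpr ⟨_, rfl⟩) _⟩
  constructor
  · intro h
    rcases key a ha with (⟨j, h1, h2⟩ | ⟨v, hv, h1, h2⟩) | ⟨i, hi, ht, ⟨u, hu⟩, h2⟩ <;>
    rcases key b hb with (⟨j', h1', h2'⟩ | ⟨v', hv', h1', h2'⟩) | ⟨i', hi', ht', ⟨u', hu'⟩, h2'⟩ <;>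
    rw [h2, h2'] at h <;>
    simp only [Option.some.injEq, Sum.inl.injEq, Sum.inr.injEq, Subtype.mk.injEq,
      reduceCtorEq] at h
    · left; rw [h1, h1', h]
    · left; rw [h1, h1', h]
    · have h3 : (J i u).vert ∈ S i := (hS _ _).mpr ⟨_, rfl⟩
      have h4 : i = i' := hJ.eq_of_mem hS h3 (h ▸ h3)
      subst h4
      exact .inr ⟨i, ht, u, u', hu, hu'⟩
  · rintro (h | ⟨i, ht, u, u', rfl, rfl⟩)
    · rw [h]
    · have hi : S i ∈ pieceSet S ∧ G.IsVertexSub (S i) :=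
        ⟨mem_pieceSet.mpr ⟨i, rfl⟩, (hJ.isVertexSub_iff hS i).mpr ht⟩
      rw [VFlag.flag_pt, VFlag.flag_pt, hJ.contractPoint_vertex hS ((hS i _).mpr ⟨_, rfl⟩) hi,
        hJ.contractPoint_vertex hS ((hS i _).mpr ⟨_, rfl⟩) hi]

theorem extType_eq_of_ne_vertex {r : Residue} (h : r ≠ .vertex) (j j' : Fin r.numExt) :
    r.extType j = r.extType j' := by
  revert j j'
  cases r <;> first | exact absurd rfl h | decide

/-- The line of `z` in the contracted graph. -/
def contractLine (S : ι → Finset G.V) (z : G.Flag) (h : NotInside S z) :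
    (G.contract (pieceSet S)).E := Quot.mk _ ⟨z.line, h⟩

/-- The lines that are joined by contraction are the chains of lines and self-energies. -/
theorem IsPieces.contractLine_eq_iff (hJ : IsPieces hD hG J)
    (hS : ∀ i v, v ∈ S i ↔ ∃ u, (J i u).vert = v) {a b : G.Flag} (ha : NotInside S a)
    (hb : NotInside S b) :
    contractLine S a ha = contractLine S b hb ↔ Relation.EqvGen (Linked hD hG J) a b := by
  classical
  have hsame : ∀ a b : G.Flag, a.line = b.line → Relation.EqvGen (Linked hD hG J) a b := by
    intro a b h
    rcases (Flag.line_eq_iff hG.isLoopless).mp h.symm with rfl | rfl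
    · exact .refl _
    · exact .rel _ _ (.inl rfl)
  constructor
  · intro h
    have h1 := Quot.eqvGen_exact h
    suffices ∀ e e', Relation.EqvGen (G.Joined (pieceSet S)) e e' → ∀ a b : G.Flag, a.line = e.1 →
        b.line = e'.1 → Relation.EqvGen (Linked hD hG J) a b from this _ _ h1 a b rfl rfl
    intro e e' h
    induction h with
    | rel e e' h =>
      intro a b ha hb
      obtain ⟨-, B, hB, hv, hbd, hbd'⟩ := h
      obtain ⟨i, rfl⟩ := mem_pieceSet.mp hB
      rw [hJ.isVertexSub_iff hS] at hv
      obtain ⟨j, hj⟩ := (hJ.isEmb i).exists_leg_of_isBoundary (hD i) hG (hS i) hbd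
      obtain ⟨j', hj'⟩ := (hJ.isEmb i).exists_leg_of_isBoundary (hD i) hG (hS i) hbd'
      refine (hsame a (J i ((hD i).leg j)).flag (ha.trans hj.symm)).trans _ _ _ ?_
      refine .trans _ _ _ (.rel _ _ (.inr ⟨i, hv, j, j', rfl, rfl⟩)) ?_
      exact hsame _ _ (hj'.trans hb.symm)
    | refl e => intro a b ha hb; exact hsame a b (ha.trans hb.symm)
    | symm e e' _ ih => intro a b ha hb; exact (ih b a hb ha).symm
    | trans e e' e'' _ _ ih1 ih2 =>
      intro a b ha hb
      obtain ⟨u, hu⟩ := hG.exists_vflag_line e'.1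
      exact (ih1 a u.flag ha hu).trans _ _ _ (ih2 u.flag b hu hb)
  · intro h
    let cl : G.E → Option (Quot (G.Joined (pieceSet S))) := fun e =>
      if h : ∀ B ∈ pieceSet S, ¬ G.IsInside B e then some (Quot.mk _ ⟨e, h⟩) else none
    have hval : ∀ (a : G.Flag) (h : NotInside S a), cl a.line = some (Quot.mk _ ⟨a.line, h⟩) :=
      fun a h => dif_pos h
    have hcl : ∀ a b, Linked hD hG J a b → cl a.line = cl b.line := by
      rintro a b (rfl | ⟨i, ht, j, j', rfl, rfl⟩)
      · rw [Flag.swap_line]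
      · rw [hval _ (hJ.notInside_leg hS i j), hval _ (hJ.notInside_leg hS i j')]
        refine congrArg some (Quot.sound ⟨?_, S i, mem_pieceSet.mpr ⟨i, rfl⟩, ?_, ?_, ?_⟩)
        · simp only [VFlag.flag_line]
          rw [(hJ.isEmb i).ty, (hJ.isEmb i).ty, (hD i).leg_type, (hD i).leg_type]
          exact extType_eq_of_ne_vertex ht _ _
        · rwa [hJ.isVertexSub_iff hS]
        · exact (hJ.isEmb i).leg_isBoundary (hD i) hG (hS i) j
        · exact (hJ.isEmb i).leg_isBoundary (hD i) hG (hS i) j'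
    have : cl a.line = cl b.line := by
      clear ha hb
      induction h with
      | rel a b h => exact hcl a b h
      | refl => rfl
      | symm a b _ ih => exact ih.symm
      | trans a b c _ _ ih1 ih2 => exact ih1.trans ih2
    rw [hval a ha, hval b hb] at this
    exact Option.some.inj this

end points

end contract

end Diagram

end QED

namespace QED

/-! ### Isomorphisms of the contracted graph in terms of flags -/

theorem count_filterMap_val {α β : Type*} [DecidableEq β] (s : Finset α) (g : α → Option β)
    (y : β) : (s.val.filterMap g).count y = (s.filter fun a => g a = some y).card := by
  classical
  induction s using Finset.induction_on with
  | empty => simp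
  | insert a s ha ih =>
    rw [Finset.insert_val_of_notMem ha, Finset.filter_insert]
    cases h : g a with
    | none =>
      rw [Multiset.filterMap_cons_none _ _ h, ih]
      simp
    | some b =>
      rw [Multiset.filterMap_cons_some _ _ _ h, Multiset.count_cons, ih]
      by_cases hb : b = y
      · rw [if_pos hb.symm, if_pos (by rw [hb]), Finset.card_insert_of_notMem (by simp [ha])]
      · rw [if_neg (Ne.symm hb), if_neg (by simpa using hb)]
        simp

namespace Diagram

variable {r r' : Residue}

section contract

variable {ι : Type} [Fintype ι] {G : Diagram r} (hG : G.IsOnePI) (S : ι → Finset G.V)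

/-- The flags of the contracted graph. -/
abbrev ContractFlag : Type :=
  {z : G.Flag // NotInside S z ∧ (G.contractPoint (pieceSet S) z.pt).isSome}

noncomputable instance : Fintype (ContractFlag S) := Fintype.ofFinite _

variable {S}

/-- The point of a flag of the contracted graph. -/
noncomputable def ContractFlag.pt (z : ContractFlag S) :
    G.ContractV (pieceSet S) ⊕ Fin r.numExt :=
  (G.contractPoint (pieceSet S) z.1.pt).get z.2.2

/-- The line of a flag of the contracted graph. -/
def ContractFlag.line (z : ContractFlag S) : (G.contract (pieceSet S)).E :=
  contractLine S z.1 z.2.1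

theorem ContractFlag.pt_eq_iff (z : ContractFlag S) (x) :
    z.pt = x ↔ G.contractPoint (pieceSet S) z.1.pt = some x := by
  rw [pt, Option.eq_some_iff_get_eq]
  simp [z.2.2]

open scoped Classical in
/-- The two ends of a line of the contracted graph come from the surviving flags on the lines of
`G` of which it consists. -/
theorem contract_ends_eq (hG : G.IsOnePI) (c : Quot (G.Joined (pieceSet S))) :
    (∑ e : {e : G.E // ∀ B ∈ pieceSet S, ¬ G.IsInside B e} with
        Quot.mk (G.Joined (pieceSet S)) e = c,
      (G.ends e.1).filterMap (G.contractPoint (pieceSet S)))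
    = (Finset.univ.filter fun z : ContractFlag S => z.line = c).val.map ContractFlag.pt := by
  ext y
  rw [Multiset.count_sum']
  have h1 : ∀ e : {e : G.E // ∀ B ∈ pieceSet S, ¬ G.IsInside B e},
      ((G.ends e.1).filterMap (G.contractPoint (pieceSet S))).count y
      = (Finset.univ.filter fun z : ContractFlag S => z.1.line = e.1 ∧ z.pt = y).card := by
    intro e
    rw [hG.isLoopless.isPresentation e.1, Multiset.filterMap_map, count_filterMap_val]
    refine (Finset.card_bij (fun z _ => z.1) ?_ ?_ ?_).symm
    · rintro z hz
      simp only [Finset.mem_filter, Finset.mem_univ, true_and] at hz ⊢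
      exact ⟨hz.1, (z.pt_eq_iff y).mp hz.2⟩
    · rintro z _ z' _ h
      exact Subtype.ext h
    · intro z hz
      simp only [Finset.mem_filter, Finset.mem_univ, true_and, Function.comp_apply] at hz
      have h2 : NotInside S z := by
        unfold NotInside
        rw [hz.1]
        exact e.2
      refine ⟨⟨z, h2, by rw [hz.2]; rfl⟩, ?_, rfl⟩
      simp only [Finset.mem_filter, Finset.mem_univ, true_and]
      exact ⟨hz.1, (ContractFlag.pt_eq_iff _ _).mpr hz.2⟩
  simp only [h1]
  rw [Multiset.count_map, ← Finset.filter_val, Finset.filter_filter, Finset.card_val,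
    ← Finset.card_biUnion]
  · congr 1
    ext z
    simp only [Finset.mem_biUnion, Finset.mem_filter, Finset.mem_univ, true_and]
    constructor
    · rintro ⟨e, he, hz, hy⟩
      refine ⟨?_, hy.symm⟩
      rw [← he]
      exact congrArg (Quot.mk _) (Subtype.ext hz)
    · rintro ⟨hz, hy⟩
      exact ⟨⟨z.1.line, z.2.1⟩, hz, rfl, hy.symm⟩
  · intro e _ e' _ hee
    refine Finset.disjoint_left.mpr ?_
    intro z hz hz'
    simp only [Finset.mem_filter, Finset.mem_univ, true_and] at hz hz'
    exact hee (Subtype.ext (hz.1.symm.trans hz'.1))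

theorem contract_isPresentation (hG : G.IsOnePI) :
    (G.contract (pieceSet S)).IsPresentation (ContractFlag.pt (S := S)) ContractFlag.line :=
  fun c => contract_ends_eq hG c

variable {Γ' : Diagram r} (hΓ' : Γ'.IsOnePI)

/-- The bijection on flags induced by an isomorphism with the contracted graph. -/
noncomputable def Iso.contractFlagEquiv (φ : Iso (G.contract (pieceSet S)) Γ') :
    ContractFlag S ≃ Γ'.Flag :=
  Equiv.ofBijective (φ.onFlag (contract_isPresentation hG))
    ⟨φ.onFlag_injective _ hΓ'.isLoopless, φ.onFlag_surjective _⟩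

/-- An isomorphism of the contracted graph with `Γ'` lifts the flags of `Γ'` to flags of `G`. -/
noncomputable def Iso.lift (φ : Iso (G.contract (pieceSet S)) Γ') (z : Γ'.Flag) : G.Flag :=
  ((φ.contractFlagEquiv hG hΓ').symm z).1

theorem Iso.lift_onFlag (φ : Iso (G.contract (pieceSet S)) Γ') (a : ContractFlag S) :
    φ.lift hG hΓ' (φ.onFlag (contract_isPresentation hG) a) = a.1 := by
  unfold lift
  exact congrArg Subtype.val ((φ.contractFlagEquiv hG hΓ').symm_apply_apply a)

variable {t : ι → Residue} {D : ∀ i, Diagram (t i)} {hD : ∀ i, (D i).IsOnePI}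
  {J : ∀ i, (D i).VFlag → G.VFlag} {hG}

/-- An isomorphism of the contracted graph with `Γ'` satisfies the description in terms of flags.
-/
theorem IsPieces.lift_isContraction (hJ : IsPieces hD hG J)
    (hS : ∀ i v, v ∈ S i ↔ ∃ u, (J i u).vert = v) (φ : Iso (G.contract (pieceSet S)) Γ') :
    IsContraction hD hG hΓ' J (φ.lift hG hΓ') := by
  have hsurj := φ.onFlag_surjective (contract_isPresentation hG)
  refine ⟨?_, ?_, ?_, ?_, ?_, ?_, ?_⟩
  · intro z z' h
    exact (φ.contractFlagEquiv hG hΓ').symm.injective (Subtype.ext h)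
  · intro z
    rw [hJ.survives_iff hS]
    constructor
    · rintro ⟨y, rfl⟩
      exact ((φ.contractFlagEquiv hG hΓ').symm y).2
    · intro h
      exact ⟨_, φ.lift_onFlag hG hΓ' ⟨z, h⟩⟩
  · intro z
    obtain ⟨a, rfl⟩ := hsurj z
    rw [Iso.lift_onFlag]
    exact (φ.lineType_eq a.line).symm
  · intro j
    obtain ⟨a, ha⟩ := hsurj (hΓ'.labelFlag j)
    rw [← ha, Iso.lift_onFlag]
    apply hG.eq_labelFlag
    have h1 := congrArg Flag.pt ha
    rw [hΓ'.labelFlag_pt] at h1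
    change Sum.map φ.onV id a.pt = _ at h1
    cases hp : a.pt with
    | inl c => rw [hp] at h1; cases h1
    | inr j' =>
      rw [hp] at h1
      obtain rfl : j' = j := Sum.inr.inj h1
      rw [ContractFlag.pt_eq_iff] at hp
      cases hq : a.1.pt with
      | inr j'' => rw [hq] at hp; simpa [contractPoint] using hp
      | inl v =>
        rw [hq] at hp
        simp only [contractPoint] at hp
        split_ifs at hp <;> simp at hp
  · intro z z'
    obtain ⟨a, rfl⟩ := hsurj z
    obtain ⟨b, rfl⟩ := hsurj z'
    rw [Iso.lift_onFlag, Iso.lift_onFlag, ← hJ.contractPoint_eq_iff hS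
      ((hJ.survives_iff hS _).mpr a.2) ((hJ.survives_iff hS _).mpr b.2)]
    change Sum.map φ.onV id a.pt = Sum.map φ.onV id b.pt ↔ _
    have hinj : Function.Injective (Sum.map φ.onV (id : Fin r.numExt → Fin r.numExt)) :=
      Sum.map_injective.mpr ⟨φ.onV.injective, Function.injective_id⟩
    refine hinj.eq_iff.trans ((a.pt_eq_iff _).trans ?_)
    rw [show G.contractPoint (pieceSet S) b.1.pt = some b.pt from (b.pt_eq_iff _).mp rfl]
  · intro z z'
    obtain ⟨a, rfl⟩ := hsurj z
    obtain ⟨b, rfl⟩ := hsurj z'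
    rw [Iso.lift_onFlag, Iso.lift_onFlag, ← hJ.contractLine_eq_iff hS a.2.1 b.2.1]
    exact φ.onE.injective.eq_iff
  · intro i ht j
    obtain ⟨a, ha⟩ := φ.line_surjective (contract_isPresentation hG) hΓ'.isLoopless
      (contractLine S (J i ((hD i).leg j)).flag (hJ.notInside_leg hS i j))
    refine ⟨φ.onFlag (contract_isPresentation hG) a, ?_⟩
    rw [Iso.lift_onFlag]
    exact (hJ.contractLine_eq_iff hS _ _).mp ha.symm

theorem IsPieces.exists_contractFlag (hJ : IsPieces hD hG J)
    (hS : ∀ i v, v ∈ S i ↔ ∃ u, (J i u).vert = v) (c : G.ContractV (pieceSet S)) :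
    ∃ a : ContractFlag S, a.pt = .inl c := by
  rcases c with ⟨v, hv⟩ | ⟨B, hB⟩
  · obtain ⟨u, rfl⟩ := hG.exists_vflag v
    have h1 := contractPoint_outside hv
    have h2 : Survives hD J u.flag := by
      left
      rintro i w hw
      rw [VFlag.flag_inj] at hw
      exact hv (S i) (mem_pieceSet.mpr ⟨i, rfl⟩) ((hS _ _).mpr ⟨w, by rw [hw]⟩)
    refine ⟨⟨u.flag, (hJ.survives_iff hS _).mp h2⟩, ?_⟩
    rw [ContractFlag.pt_eq_iff]
    exact h1
  · obtain ⟨i, rfl⟩ := mem_pieceSet.mp hB.1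
    have ht := (hJ.isVertexSub_iff hS i).mp hB.2
    have j0 : Fin (t i).numExt := ⟨0, by have := two_le_numExt (r := t i); lia⟩
    refine ⟨⟨(J i ((hD i).leg j0)).flag,
      (hJ.survives_iff hS _).mp (.inr ⟨i, ht, j0, rfl⟩)⟩, ?_⟩
    rw [ContractFlag.pt_eq_iff]
    exact hJ.contractPoint_vertex hS ((hS _ _).mpr ⟨_, rfl⟩) hB

/-- An isomorphism is determined by its effect on flags, as every vertex and every line of the
contracted graph carries a surviving flag. -/
theorem IsPieces.lift_injective (hJ : IsPieces hD hG J)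
    (hS : ∀ i v, v ∈ S i ↔ ∃ u, (J i u).vert = v) :
    Function.Injective (Iso.lift (S := S) hG hΓ') := by
  intro φ ψ h
  have hP := contract_isPresentation (S := S) hG
  have key : ∀ a, φ.onFlag hP a = ψ.onFlag hP a := by
    intro a
    apply (φ.contractFlagEquiv hG hΓ').symm.injective
    apply Subtype.ext
    change φ.lift hG hΓ' _ = φ.lift hG hΓ' _
    rw [Iso.lift_onFlag, h, Iso.lift_onFlag]
  refine Iso.ext' (fun c => ?_) fun e => ?_
  · obtain ⟨a, ha⟩ := hJ.exists_contractFlag hS c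
    have h1 := congrArg Flag.pt (key a)
    change Sum.map φ.onV id a.pt = Sum.map ψ.onV id a.pt at h1
    rw [ha] at h1
    exact Sum.inl.inj h1
  · obtain ⟨a, rfl⟩ := φ.line_surjective hP hΓ'.isLoopless e
    exact congrArg Flag.line (key a)

/-- The description in terms of flags comes from an isomorphism. By the condition on the legs,
every line of the contracted graph carries a surviving flag, even if it is obtained from the lines
at a self-energy. -/
theorem IsContraction.exists_iso (hJ : IsPieces hD hG J)
    (hS : ∀ i v, v ∈ S i ↔ ∃ u, (J i u).vert = v) {k : Γ'.Flag → G.Flag}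
    (hk : IsContraction hD hG hΓ' J k) :
    ∃ φ : Iso (G.contract (pieceSet S)) Γ', φ.lift hG hΓ' = k := by
  have hP := contract_isPresentation (S := S) hG
  have hb : Function.Bijective fun z =>
      (⟨k z, (hJ.survives_iff hS _).mp ((hk.range _).mp ⟨z, rfl⟩)⟩ : ContractFlag S) := by
    constructor
    · intro z z' h
      exact hk.inj (congrArg Subtype.val h)
    · rintro ⟨z, hz⟩
      obtain ⟨y, rfl⟩ := (hk.range z).mpr ((hJ.survives_iff hS _).mpr hz)
      exact ⟨y, rfl⟩
  let kk : Γ'.Flag ≃ ContractFlag S := Equiv.ofBijective _ hb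
  have hkk : ∀ z, (kk z).1 = k z := fun _ => rfl
  have hpt : ∀ a b, (kk.symm a).pt = (kk.symm b).pt ↔ a.pt = b.pt := by
    intro a b
    rw [hk.pt, ← hkk, ← hkk, Equiv.apply_symm_apply, Equiv.apply_symm_apply,
      ← hJ.contractPoint_eq_iff hS ((hJ.survives_iff hS _).mpr a.2)
        ((hJ.survives_iff hS _).mpr b.2),
      ContractFlag.pt_eq_iff,
      show G.contractPoint (pieceSet S) b.1.pt = some b.pt from (b.pt_eq_iff _).mp rfl]
  have hlab : ∀ j, (kk (hΓ'.labelFlag j)).pt = .inr j := by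
    intro j
    rw [ContractFlag.pt_eq_iff, hkk, hk.label, hG.labelFlag_pt]
    rfl
  choose a ha using hJ.exists_contractFlag hS
  -- `g` maps a vertex of the contracted graph to the vertex of a flag of `Γ'` there
  have hv : ∀ c, ∃ w, (kk.symm (a c)).pt = .inl w := by
    intro c
    cases hp : (kk.symm (a c)).pt with
    | inl w => exact ⟨w, rfl⟩
    | inr j =>
      have h1 := hΓ'.eq_labelFlag hp
      have h2 := hlab j
      rw [← h1, Equiv.apply_symm_apply, ha] at h2
      cases h2
  choose g hg using hv
  have hgb : Function.Bijective g := by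
    constructor
    · intro c c' h
      have h1 : (kk.symm (a c)).pt = (kk.symm (a c')).pt := by rw [hg, hg, h]
      rw [hpt, ha, ha] at h1
      exact Sum.inl.inj h1
    · intro w
      obtain ⟨u, rfl⟩ := hΓ'.exists_vflag w
      cases hp : (kk u.flag).pt with
      | inl c =>
        refine ⟨c, ?_⟩
        have h1 : (kk.symm (a c)).pt = (kk.symm (kk u.flag)).pt := by rw [hpt, ha, hp]
        rw [hg, Equiv.symm_apply_apply] at h1
        exact Sum.inl.inj h1
      | inr j =>
        exfalso
        have h1 : (kk.symm (kk u.flag)).pt = (kk.symm (kk (hΓ'.labelFlag j))).pt := by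
          rw [hpt, hp, hlab]
        simp at h1
  obtain ⟨φ, hφV, hφE⟩ := Diagram.exists_iso (D := G.contract (pieceSet S)) hP hΓ'.isLoopless
    (Equiv.ofBijective g hgb) kk.symm
    (by
      intro b
      cases hp : b.pt with
      | inl c =>
        have h1 : (kk.symm b).pt = (kk.symm (a c)).pt := by rw [hpt, ha, hp]
        rw [h1, hg]
        rfl
      | inr j =>
        have h1 : (kk.symm b).pt = (kk.symm (kk (hΓ'.labelFlag j))).pt := by rw [hpt, hp, hlab]
        rw [h1, Equiv.symm_apply_apply, hΓ'.labelFlag_pt]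
        rfl)
    (by
      intro b
      rw [← hk.ty, ← hkk, Equiv.apply_symm_apply]
      rfl)
    (by
      intro b b'
      rw [hk.line, ← hkk, ← hkk, Equiv.apply_symm_apply, Equiv.apply_symm_apply]
      exact (hJ.contractLine_eq_iff hS b.2.1 b'.2.1).symm)
    (by
      intro c
      obtain ⟨⟨e, he⟩, rfl⟩ := Quot.exists_rep c
      obtain ⟨w, rfl⟩ := hG.exists_vflag_line e
      have hw : NotInside S w.flag := he
      by_cases hs : Survives hD J w.flag
      · exact ⟨⟨w.flag, (hJ.survives_iff hS _).mp hs⟩, rfl⟩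
      · have h1 : ∃ i u, w.flag = (J i u).flag := by
          by_contra hcon
          push Not at hcon
          exact hs (.inl hcon)
        obtain ⟨i, u, hu⟩ := h1
        rw [VFlag.flag_inj] at hu
        subst hu
        rcases (hD i).eq_leg_or u with ⟨u', hu'⟩ | ⟨j, rfl⟩
        · exfalso
          refine hw (S i) (mem_pieceSet.mpr ⟨i, rfl⟩) ?_
          rw [isInside_iff hG.isLoopless, (hJ.isEmb i).swap _ _ hu', VFlag.flag_pt, VFlag.flag_pt,
            atSet_inl, atSet_inl]
          exact ⟨(hS _ _).mpr ⟨_, rfl⟩, (hS _ _).mpr ⟨_, rfl⟩⟩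
        · -- the line of a leg of a self-energy belongs to a chain that contains a surviving flag
          have ht : t i ≠ .vertex := fun ht => hs (.inr ⟨i, ht, j, rfl⟩)
          obtain ⟨z, hz⟩ := hk.legs i ht j
          refine ⟨kk z, ?_⟩
          exact ((hJ.contractLine_eq_iff hS hw (kk z).2.1).mpr hz).symm)
  refine ⟨φ, funext fun z => ?_⟩
  have h1 : φ.onFlag hP (kk z) = z := by
    refine Flag.ext ?_ ?_
    · refine (hφE (kk z)).trans ?_
      rw [Equiv.symm_apply_apply]
    · change Sum.map φ.onV id (kk z).pt = _
      rw [hφV]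
      cases hp : (kk z).pt with
      | inl c =>
        have h1 : (kk.symm (kk z)).pt = (kk.symm (a c)).pt := by rw [hpt, ha, hp]
        rw [hg, Equiv.symm_apply_apply] at h1
        exact h1.symm
      | inr j =>
        have h1 : (kk.symm (kk z)).pt = (kk.symm (kk (hΓ'.labelFlag j))).pt := by
          rw [hpt, hp, hlab]
        rw [Equiv.symm_apply_apply, Equiv.symm_apply_apply, hΓ'.labelFlag_pt] at h1
        exact h1.symm
  conv_lhs => rw [← h1]
  rw [Iso.lift_onFlag, hkk]

end contract

end Diagram

end QED

namespace QED

/-! ### Insertion of self-energies into lines -/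

section insertion

variable {B κ : Type}

/-- Two flags belong to the same line, or to the same self-energy. -/
def Chained (σ : B ⊕ κ × Bool → B ⊕ κ × Bool) (a b : B ⊕ κ × Bool) : Prop :=
  b = σ a ∨ ∃ i c c', a = .inr (i, c) ∧ b = .inr (i, c')

/-- A matching `σ` of the flags in `B` and of the two legs of each self-energy in `κ` that becomes
the matching `s` of `B` when each self-energy is contracted to a line: the flags of `B` in a chain
of lines and self-energies are a matched pair, and each self-energy lies in such a chain. The flags
that do not satisfy `O` belong to external lines, into which nothing is inserted. -/
structure IsInsertion (s : B → B) (O : B → Prop) (ty : B ⊕ κ × Bool → LineType)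
    (σ : B ⊕ κ × Bool → B ⊕ κ × Bool) : Prop where
  invol : ∀ z, σ (σ z) = z
  ne : ∀ z, σ z ≠ z
  ty : ∀ z, ty (σ z) = ty z
  base : ∀ x y, Relation.EqvGen (Chained σ) (.inl x) (.inl y) ↔ y = x ∨ y = s x
  reach : ∀ i c, ∃ x, Relation.EqvGen (Chained σ) (.inr (i, c)) (.inl x)
  ext : ∀ x, ¬ O x → σ (.inl x) = .inl (s x)

/-- A property that is preserved by the steps of a relation is constant on the classes of the
equivalence relation generated by it. -/
theorem EqvGen.iff_of_invariant {α : Type*} {R : α → α → Prop} {p : α → Prop}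
    (hp : ∀ a b, R a b → (p a ↔ p b)) {a b : α} (h : Relation.EqvGen R a b) : p a ↔ p b := by
  induction h with
  | rel a b h => exact hp a b h
  | refl => rfl
  | symm a b _ ih => exact ih.symm
  | trans a b c _ _ ih1 ih2 => exact ih1.trans ih2

/-- There are no closed chains that consist of self-energies only. -/
theorem IsInsertion.exists_base {s : B → B} {O : B → Prop} {ty : B ⊕ κ × Bool → LineType}
    {σ : B ⊕ κ × Bool → B ⊕ κ × Bool} (h : IsInsertion s O ty σ) (z) :
    ∃ x, Relation.EqvGen (Chained σ) z (.inl x) := by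
  rcases z with x | ⟨i, c⟩
  · exact ⟨x, .refl _⟩
  · exact h.reach i c

theorem even_card_of_involution {α : Type*} (s : Finset α) (f : α → α) (h1 : ∀ a ∈ s, f a ∈ s)
    (h2 : ∀ a ∈ s, f (f a) = a) (h3 : ∀ a ∈ s, f a ≠ a) : Even s.card := by
  classical
  have : ∑ _x ∈ s, (1 : ZMod 2) = 0 :=
    Finset.sum_involution (fun a _ => f a) (fun _ _ => by decide) (fun a ha _ => h3 a ha)
      (fun a ha => h1 a ha) (fun a ha => h2 a ha)
  rw [Finset.sum_const, nsmul_eq_mul, mul_one] at this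
  exact (ZMod.natCast_eq_zero_iff_even).mp this

/-- A 2-colouring of the flags that is constant on self-energies and on all lines except possibly
one, and constant on the flags in `B`, is constant: otherwise the flags of the other colour form an
even number of legs, all but one of which are matched with each other. -/
theorem IsInsertion.colour_eq [Finite B] [Finite κ] {s : B → B} {O : B → Prop}
    {ty : B ⊕ κ × Bool → LineType}
    {σ : B ⊕ κ × Bool → B ⊕ κ × Bool} (h : IsInsertion s O ty σ) (f : B ⊕ κ × Bool)
    (c : B ⊕ κ × Bool → Prop) (hself : ∀ i b b', c (.inr (i, b)) ↔ c (.inr (i, b')))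
    (hσ : ∀ z, z ≠ f → z ≠ σ f → (c z ↔ c (σ z))) (hB : ∀ x y, c (.inl x) ↔ c (.inl y)) (z x) :
    c z ↔ c (.inl x) := by
  classical
  by_cases hf : c f ↔ c (σ f)
  · have hσ' : ∀ z, c z ↔ c (σ z) := by
      intro z
      by_cases h1 : z = f
      · rw [h1]; exact hf
      by_cases h2 : z = σ f
      · rw [h2, h.invol]; exact hf.symm
      exact hσ z h1 h2
    obtain ⟨y, hy⟩ := h.exists_base z
    refine (EqvGen.iff_of_invariant (p := c) ?_ hy).trans (hB y x)
    rintro a b (rfl | ⟨i, e, e', rfl, rfl⟩)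
    · exact hσ' a
    · exact hself i e e'
  · exfalso
    have := Fintype.ofFinite B
    have := Fintype.ofFinite κ
    -- one of the two flags of the exceptional line has the wrong colour
    obtain ⟨g, hg, hg', hgσ⟩ : ∃ g, ¬ (c g ↔ c (.inl x)) ∧ (c (σ g) ↔ c (.inl x)) ∧
        ∀ z, z ≠ g → z ≠ σ g → (c z ↔ c (σ z)) := by
      by_cases hx : c f ↔ c (.inl x)
      · refine ⟨σ f, ?_, ?_, ?_⟩
        · rw [← hx]; tauto
        · rw [h.invol]; exact hx
        · rw [h.invol]; intro z h1 h2; exact hσ z h2 h1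
      · exact ⟨f, hx, by tauto, hσ⟩
    let K : Finset (B ⊕ κ × Bool) := Finset.univ.filter fun z => ¬ (c z ↔ c (.inl x))
    have hK : ∀ z, z ∈ K ↔ ¬ (c z ↔ c (.inl x)) := by intro z; simp [K]
    -- `K` is the set of flags of the wrong colour; the two legs of a self-energy are a pair in it
    have h1 : Even K.card := by
      refine even_card_of_involution K
        (Sum.elim .inl fun p => .inr (p.1, !p.2)) ?_ ?_ ?_
      · rintro (y | ⟨i, b⟩) hz
        · exact hz
        · rw [hK] at hz ⊢
          change ¬ (c (.inr (i, !b)) ↔ c (.inl x))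
          rw [← hself i b]
          exact hz
      · rintro (y | ⟨i, b⟩) hz <;> simp
      · rintro (y | ⟨i, b⟩) hz
        · rw [hK] at hz
          exact absurd (hB y x) hz
        · simp
    -- the two flags of an ordinary line are a pair in the complement of the exceptional flag `g`
    have h2 : Even (K.erase g).card := by
      refine even_card_of_involution _ σ ?_ (fun z _ => h.invol z) (fun z _ => h.ne z)
      intro z hz
      rw [Finset.mem_erase, hK] at hz ⊢
      have hz2 : z ≠ σ g := by
        rintro rfl
        exact hz.2 hg'
      refine ⟨fun hh => hz2 (by rw [← hh, h.invol]), ?_⟩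
      rw [← hgσ z hz.1 hz2]
      exact hz.2
    have h3 := Finset.card_erase_add_one ((hK g).mpr hg)
    rw [← h3, Nat.even_add_one] at h1
    exact h1 h2

end insertion

/-- If the steps of `R` from and to the image of the injection `h` are the images of the steps of
`Q`, then `h` carries the equivalence relations generated by `Q` and `R` to each other. -/
theorem EqvGen.iff_of_embedding {α β : Type*} {Q : α → α → Prop} {R : β → β → Prop} {h : α → β}
    (hinj : Function.Injective h) (h1 : ∀ a b, Q a b → R (h a) (h b))
    (h2 : ∀ a y, R (h a) y → ∃ b, y = h b ∧ Q a b) (h3 : ∀ y b, R y (h b) → ∃ a, y = h a ∧ Q a b)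
    (a b : α) : Relation.EqvGen R (h a) (h b) ↔ Relation.EqvGen Q a b := by
  constructor
  · intro hh
    suffices ∀ x y, Relation.EqvGen R x y →
        (∀ a, x = h a → ∃ b, y = h b ∧ Relation.EqvGen Q a b) ∧
        (∀ b, y = h b → ∃ a, x = h a ∧ Relation.EqvGen Q a b) by
      obtain ⟨b', hb', hq⟩ := (this _ _ hh).1 a rfl
      rwa [hinj hb']
    intro x y hxy
    induction hxy with
    | rel x y hxy =>
      constructor
      · rintro a rfl
        obtain ⟨b, hb, hq⟩ := h2 a y hxy
        exact ⟨b, hb, .rel _ _ hq⟩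
      · rintro b rfl
        obtain ⟨a, ha, hq⟩ := h3 x b hxy
        exact ⟨a, ha, .rel _ _ hq⟩
    | refl x => exact ⟨fun a ha => ⟨a, ha, .refl _⟩, fun a ha => ⟨a, ha, .refl _⟩⟩
    | symm x y _ ih =>
      constructor
      · intro a ha
        obtain ⟨b, hb, hq⟩ := ih.2 a ha
        exact ⟨b, hb, hq.symm⟩
      · intro a ha
        obtain ⟨b, hb, hq⟩ := ih.1 a ha
        exact ⟨b, hb, hq.symm⟩
    | trans x y z _ _ ih1 ih2 =>
      constructor
      · intro a ha
        obtain ⟨b, hb, hq⟩ := ih1.1 a ha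
        obtain ⟨c, hc, hq'⟩ := ih2.1 b hb
        exact ⟨c, hc, hq.trans _ _ _ hq'⟩
      · intro c hc
        obtain ⟨b, hb, hq⟩ := ih2.2 c hc
        obtain ⟨a, ha, hq'⟩ := ih1.2 b hb
        exact ⟨a, ha, hq'.trans _ _ _ hq⟩
  · intro hh
    induction hh with
    | rel a b hab => exact .rel _ _ (h1 a b hab)
    | refl => exact .refl _
    | symm a b _ ih => exact ih.symm
    | trans a b c _ _ ih1 ih2 => exact ih1.trans _ _ _ ih2

/-- The labels of the two legs of a self-energy. -/
noncomputable def Residue.boolEquiv {r : Residue} (h : r ≠ .vertex) : Bool ≃ Fin r.numExt :=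
  Fintype.equivOfCardEq (by
    cases r
    · exact absurd rfl h
    · rfl
    · rfl)

namespace Diagram

variable {r r' : Residue}

/-- The flags at vertices that belong to internal lines. -/
def InnerFlag {D : Diagram r} (hD : D.IsOnePI) : Type :=
  {u : D.VFlag // ∃ u' : D.VFlag, u.flag.swap hD.isLoopless = u'.flag}

namespace InnerFlag

variable {D : Diagram r} {hD : D.IsOnePI}

noncomputable instance : Fintype (InnerFlag hD) := by
  unfold InnerFlag
  exact Fintype.ofFinite _

/-- The other flag of an internal line. -/
noncomputable def swap (u : InnerFlag hD) : InnerFlag hD :=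
  ⟨u.2.choose, u.1, by rw [← u.2.choose_spec, Flag.swap_swap]⟩

theorem swap_flag (u : InnerFlag hD) : u.swap.1.flag = u.1.flag.swap hD.isLoopless :=
  u.2.choose_spec.symm

theorem swap_eq {u u' : InnerFlag hD} (h : u.1.flag.swap hD.isLoopless = u'.1.flag) :
    u.swap = u' := by
  apply Subtype.ext
  apply VFlag.flag_injective
  rw [swap_flag, h]

theorem swap_swap (u : InnerFlag hD) : u.swap.swap = u := by
  apply Subtype.ext
  apply VFlag.flag_injective
  rw [swap_flag, swap_flag, Flag.swap_swap]

theorem swap_ne (u : InnerFlag hD) : u.swap ≠ u := by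
  intro h
  have := swap_flag u
  rw [h] at this
  exact u.1.flag.swap_ne _ this.symm

end InnerFlag

/-- Three different flags at a vertex are all its flags. -/
theorem IsOnePI.exists_eq_of_injective {G : Diagram r} (hG : G.IsOnePI) (hr : r' = .vertex)
    {leg : Fin r'.numExt → G.VFlag} {w : G.V} (hw : ∀ j, (leg j).vert = w)
    (hinj : Function.Injective leg) {u : G.VFlag} (h : u.vert = w) : ∃ j, leg j = u := by
  classical
  have hcard : Fintype.card {u : G.VFlag // u.vert = w} = 3 := by
    have h1 := hG.card_vflag w .electron
    have h2 := hG.card_vflag w .photon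
    rw [Nat.card_eq_fintype_card, Fintype.card_subtype] at h1 h2
    rw [Fintype.card_subtype, ← Finset.card_filter_add_card_filter_not
      (fun u => G.lineType u.line = .electron), Finset.filter_filter, Finset.filter_filter, h1]
    have : (Finset.univ.filter fun u : G.VFlag => u.vert = w ∧
        ¬ G.lineType u.line = .electron) = Finset.univ.filter fun u : G.VFlag =>
        u.vert = w ∧ G.lineType u.line = .photon := by
      ext u
      simp only [Finset.mem_filter, Finset.mem_univ, true_and]
      refine and_congr_right fun _ => ?_
      cases G.lineType u.line <;> simp
    rw [this, h2]
    rfl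
  have hinj' : Function.Injective (fun j => (⟨leg j, hw j⟩ : {u : G.VFlag // u.vert = w})) :=
    fun j j' hh => hinj (congrArg Subtype.val hh)
  have hn : Fintype.card (Fin r'.numExt) = 3 := by
    rw [hr]; rfl
  obtain ⟨j, hj⟩ := ((Fintype.bijective_iff_injective_and_card _).mpr
    ⟨hinj', hn.trans hcard.symm⟩).2 ⟨u, h⟩
  exact ⟨j, congrArg Subtype.val hj⟩

variable {ι : Type} {t : ι → Residue} {D : ∀ i, Diagram (t i)}

/-- The insertion places of the vertex graphs among the `D i`: different vertices `root i` of `Γ'`,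
and identifications of the external lines of `D i` with the lines at `root i`. -/
structure Rooting (D : ∀ i, Diagram (t i)) (Γ' : Diagram r) where
  root : {i // t i = .vertex} → Γ'.V
  leg : ∀ i : {i // t i = .vertex}, Fin (t i).numExt → Γ'.VFlag
  root_inj : Function.Injective root
  leg_vert : ∀ i j, (leg i j).vert = root i
  leg_ty : ∀ i j, Γ'.lineType (leg i j).line = (t i).extType j
  leg_inj : ∀ i, Function.Injective (leg i)

/-- The flags of `Γ'` and the legs of the self-energies among the `D i`. -/
abbrev GlueFlag (t : ι → Residue) (Γ' : Diagram r) : Type :=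
  Γ'.Flag ⊕ {i // t i ≠ .vertex} × Bool

/-- The type of the external lines of `D i`. -/
noncomputable def glueType (t : ι → Residue) (Γ' : Diagram r) : GlueFlag t Γ' → LineType :=
  Sum.elim (fun z => Γ'.lineType z.line) fun p => (t p.1).extType (Residue.boolEquiv p.1.2 p.2)

/-- The flag belongs to an internal line. -/
def Flag.IsInternal {Γ' : Diagram r} (h : Γ'.IsLoopless) (z : Γ'.Flag) : Prop :=
  (∃ v, z.pt = .inl v) ∧ ∃ v, (z.swap h).pt = .inl v

/-- The insertion places of the self-energies among the `D i`. -/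
abbrev Gluing (t : ι → Residue) {Γ' : Diagram r} (hΓ' : Γ'.IsOnePI) : Type :=
  {σ : GlueFlag t Γ' → GlueFlag t Γ' //
    IsInsertion (Flag.swap hΓ'.isLoopless) (Flag.IsInternal hΓ'.isLoopless) (glueType t Γ') σ}

namespace Rooting

variable {Γ' : Diagram r} (p : Rooting D Γ')

theorem leg_eq_iff {i i' j j'} : (p.leg i j).flag = (p.leg i' j').flag ↔
    (⟨i, j⟩ : Σ i : {i // t i = .vertex}, Fin (t i).numExt) = ⟨i', j'⟩ := by
  constructor
  · intro h
    rw [VFlag.flag_inj] at h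
    have h1 : i = i' := p.root_inj (by rw [← p.leg_vert i j, h, p.leg_vert])
    subst h1
    rw [p.leg_inj i h]
  · intro h
    cases h
    rfl

theorem exists_leg (hΓ' : Γ'.IsOnePI) {u : Γ'.VFlag} {i} (h : u.vert = p.root i) :
    ∃ j, p.leg i j = u :=
  hΓ'.exists_eq_of_injective i.2 (p.leg_vert i) (p.leg_inj i) h

variable (hD : ∀ i, (D i).IsOnePI)

/-- The vertices after insertion. -/
abbrev InsV : Type := {w : Γ'.V // ∀ i, p.root i ≠ w} ⊕ Σ i, (D i).V

/-- `x` is the point, after insertion, of the flag `z` of `Γ'`. -/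
def BasePt (z : Γ'.Flag) (x : p.InsV ⊕ Fin r.numExt) : Prop :=
  (∃ i j, z = (p.leg i j).flag ∧ x = .inl (.inr ⟨i.1, ((hD i).leg j).vert⟩)) ∨
  (∃ w h, z.pt = .inl w ∧ x = .inl (.inl ⟨w, h⟩)) ∨ ∃ j, z.pt = .inr j ∧ x = .inr j

/-- Flags at a replaced vertex move to the vertex of the inserted graph at the corresponding leg,
and the other flags keep their points. -/
theorem exists_basePt (hΓ' : Γ'.IsOnePI) (z : Γ'.Flag) : ∃ x, p.BasePt hD z x := by
  cases hp : z.pt with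
  | inr j => exact ⟨.inr j, .inr (.inr ⟨j, hp, rfl⟩)⟩
  | inl w =>
    by_cases h : ∀ i, p.root i ≠ w
    · exact ⟨.inl (.inl ⟨w, h⟩), .inr (.inl ⟨w, h, hp, rfl⟩)⟩
    · push Not at h
      obtain ⟨i, rfl⟩ := h
      obtain ⟨u, rfl, hu⟩ := z.exists_vflag hp
      obtain ⟨j, rfl⟩ := p.exists_leg hΓ' hu
      exact ⟨_, .inl ⟨i, j, rfl, rfl⟩⟩

/-- The point, after insertion, of a flag of `Γ'`. -/
noncomputable def basePt (hΓ' : Γ'.IsOnePI) (z : Γ'.Flag) : p.InsV ⊕ Fin r.numExt :=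
  (p.exists_basePt hD hΓ' z).choose

theorem basePt_spec (hΓ' : Γ'.IsOnePI) (z : Γ'.Flag) : p.BasePt hD z (p.basePt hD hΓ' z) :=
  (p.exists_basePt hD hΓ' z).choose_spec

theorem basePt_leg (hΓ' : Γ'.IsOnePI) (i j) :
    p.basePt hD hΓ' (p.leg i j).flag = .inl (.inr ⟨i.1, ((hD i).leg j).vert⟩) := by
  rcases p.basePt_spec hD hΓ' (p.leg i j).flag with ⟨i', j', h, hx⟩ | ⟨w, hw, h, hx⟩ | ⟨j', h, hx⟩
  · rw [hx]
    rw [leg_eq_iff] at h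
    cases h
    rfl
  · rw [VFlag.flag_pt, Sum.inl.injEq, p.leg_vert] at h
    exact absurd h (hw i)
  · cases h

theorem basePt_of_not_leg (hΓ' : Γ'.IsOnePI) {z : Γ'.Flag} (h : ∀ i j, z ≠ (p.leg i j).flag) :
    (∃ w h, z.pt = .inl w ∧ p.basePt hD hΓ' z = .inl (.inl ⟨w, h⟩)) ∨
      ∃ j, z.pt = .inr j ∧ p.basePt hD hΓ' z = .inr j :=
  (p.basePt_spec hD hΓ' z).resolve_left fun ⟨i, j, hz, _⟩ => h i j hz

theorem basePt_label (hΓ' : Γ'.IsOnePI) {z : Γ'.Flag} {j} (h : z.pt = .inr j) :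
    p.basePt hD hΓ' z = .inr j := by
  rcases p.basePt_of_not_leg hD hΓ' (z := z) (by rintro i j rfl; cases h) with
    ⟨w, hw, hp, hx⟩ | ⟨j', hp, hx⟩
  · rw [hp] at h; cases h
  · rw [hp] at h; cases h; exact hx

theorem basePt_free (hΓ' : Γ'.IsOnePI) {z : Γ'.Flag} {w} (h : z.pt = .inl w)
    (hw : ∀ i, p.root i ≠ w) : p.basePt hD hΓ' z = .inl (.inl ⟨w, hw⟩) := by
  rcases p.basePt_of_not_leg hD hΓ' (z := z) (by
    rintro i j rfl
    rw [VFlag.flag_pt, Sum.inl.injEq, p.leg_vert] at h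
    exact hw i h) with ⟨w', hw', hp, hx⟩ | ⟨j', hp, hx⟩
  · rw [hp] at h; cases h; exact hx
  · rw [hp] at h; cases h

/-- The flags after insertion: those at the two ends of the internal lines of the `D i`, and the
remaining ones. -/
abbrev InsFlag (Γ' : Diagram r) (hD : ∀ i, (D i).IsOnePI) : Type :=
  (Σ i, InnerFlag (hD i)) ⊕ GlueFlag t Γ'

/-- The points, after insertion, of the flags of `Γ'` and of the legs of the self-energies. -/
noncomputable def gluePt (hΓ' : Γ'.IsOnePI) : GlueFlag t Γ' → p.InsV ⊕ Fin r.numExt :=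
  Sum.elim (p.basePt hD hΓ')
    fun q => .inl (.inr ⟨q.1.1, ((hD q.1).leg (Residue.boolEquiv q.1.2 q.2)).vert⟩)

/-- The points of the flags after insertion. -/
noncomputable def insPt (hΓ' : Γ'.IsOnePI) : InsFlag Γ' hD → p.InsV ⊕ Fin r.numExt :=
  Sum.elim (fun u => .inl (.inr ⟨u.1, u.2.1.vert⟩)) (p.gluePt hD hΓ')

/-- The types of the flags after insertion. -/
noncomputable def insType (Γ' : Diagram r) : InsFlag Γ' hD → LineType :=
  Sum.elim (fun u => (D u.1).lineType u.2.1.line) (glueType t Γ')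

open scoped Classical in
/-- The flag to which a leg of `D i` is glued. -/
noncomputable def legGlue (i : ι) (j : Fin (t i).numExt) : GlueFlag t Γ' :=
  if h : t i = .vertex then .inl (p.leg ⟨i, h⟩ j).flag
  else .inr (⟨i, h⟩, (Residue.boolEquiv h).symm j)

theorem legGlue_vertex (i : {i // t i = .vertex}) (j) :
    p.legGlue i.1 j = .inl (p.leg i j).flag := by
  rw [legGlue, dif_pos i.2]

theorem legGlue_self (i : {i // t i ≠ .vertex}) (j) :
    p.legGlue i.1 j = .inr (i, (Residue.boolEquiv i.2).symm j) := by
  rw [legGlue, dif_neg i.2]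

theorem inr_eq_legGlue (i : {i // t i ≠ .vertex}) (b) :
    .inr (i, b) = p.legGlue i.1 (Residue.boolEquiv i.2 b) := by
  rw [legGlue_self, Equiv.symm_apply_apply]

theorem legGlue_inj {i i' j j'} (h : p.legGlue i j = p.legGlue i' j') :
    (⟨i, j⟩ : Σ i, Fin (t i).numExt) = ⟨i', j'⟩ := by
  by_cases hi : t i = .vertex <;> by_cases hi' : t i' = .vertex
  · rw [p.legGlue_vertex ⟨i, hi⟩, p.legGlue_vertex ⟨i', hi'⟩, Sum.inl.injEq, leg_eq_iff] at h
    cases h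
    rfl
  · rw [p.legGlue_vertex ⟨i, hi⟩, p.legGlue_self ⟨i', hi'⟩] at h
    cases h
  · rw [p.legGlue_self ⟨i, hi⟩, p.legGlue_vertex ⟨i', hi'⟩] at h
    cases h
  · rw [p.legGlue_self ⟨i, hi⟩, p.legGlue_self ⟨i', hi'⟩, Sum.inr.injEq, Prod.mk.injEq] at h
    obtain ⟨h1, h2⟩ := h
    cases h1
    rw [Equiv.apply_eq_iff_eq] at h2
    rw [h2]

theorem gluePt_legGlue (hΓ' : Γ'.IsOnePI) (i j) :
    p.gluePt hD hΓ' (p.legGlue i j) = .inl (.inr ⟨i, ((hD i).leg j).vert⟩) := by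
  by_cases hi : t i = .vertex
  · rw [p.legGlue_vertex ⟨i, hi⟩]
    exact p.basePt_leg hD hΓ' ⟨i, hi⟩ j
  · rw [p.legGlue_self ⟨i, hi⟩]
    simp [gluePt]

theorem glueType_legGlue (i j) : glueType t Γ' (p.legGlue i j) = (t i).extType j := by
  by_cases hi : t i = .vertex
  · rw [p.legGlue_vertex ⟨i, hi⟩]
    exact p.leg_ty ⟨i, hi⟩ j
  · rw [p.legGlue_self ⟨i, hi⟩]
    simp [glueType]

theorem glue_cases (z : GlueFlag t Γ') :
    (∃ i j, z = p.legGlue i j) ∨ ∃ w, (∀ i j, w ≠ (p.leg i j).flag) ∧ z = .inl w := by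
  rcases z with w | ⟨i, b⟩
  · by_cases h : ∀ i j, w ≠ (p.leg i j).flag
    · exact .inr ⟨w, h, rfl⟩
    · push Not at h
      obtain ⟨i, j, rfl⟩ := h
      exact .inl ⟨i.1, j, (p.legGlue_vertex i j).symm⟩
  · exact .inl ⟨i.1, _, p.inr_eq_legGlue i b⟩

open scoped Classical in
/-- The flags of `D i` as flags of the graph after insertion. -/
noncomputable def pieceFlag (i : ι) (u : (D i).VFlag) : InsFlag Γ' hD :=
  if h : ∃ u' : (D i).VFlag, u.flag.swap (hD i).isLoopless = u'.flag then .inl ⟨i, u, h⟩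
  else .inr (p.legGlue i (((hD i).eq_leg_or u).resolve_left h).choose)

theorem pieceFlag_inner {i} (u : InnerFlag (hD i)) : p.pieceFlag hD i u.1 = .inl ⟨i, u⟩ := by
  rw [pieceFlag, dif_pos u.2]
  rfl

theorem pieceFlag_leg (i j) : p.pieceFlag hD i ((hD i).leg j) = .inr (p.legGlue i j) := by
  have h : ¬ ∃ u' : (D i).VFlag, ((hD i).leg j).flag.swap (hD i).isLoopless = u'.flag := by
    rintro ⟨u', hu'⟩
    rw [IsOnePI.swap_leg] at hu'
    exact (hD i).flag_ne_labelFlag _ _ hu'.symm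
  rw [pieceFlag, dif_neg h]
  congr 2
  exact ((hD i).leg_injective
    (((hD i).eq_leg_or ((hD i).leg j)).resolve_left h).choose_spec).symm

theorem vflag_cases {D : Diagram r} (hD : D.IsOnePI) (u : D.VFlag) :
    (∃ u' : InnerFlag hD, u = u'.1) ∨ ∃ j, u = hD.leg j := by
  rcases hD.eq_leg_or u with h | h
  · exact .inl ⟨⟨u, h⟩, rfl⟩
  · exact .inr h

theorem insPt_pieceFlag (hΓ' : Γ'.IsOnePI) (i) (u : (D i).VFlag) :
    p.insPt hD hΓ' (p.pieceFlag hD i u) = .inl (.inr ⟨i, u.vert⟩) := by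
  rcases vflag_cases (hD i) u with ⟨u, rfl⟩ | ⟨j, rfl⟩
  · rw [pieceFlag_inner]; rfl
  · rw [pieceFlag_leg]; exact p.gluePt_legGlue hD hΓ' i j

theorem insType_pieceFlag (i) (u : (D i).VFlag) :
    insType hD Γ' (p.pieceFlag hD i u) = (D i).lineType u.line := by
  rcases vflag_cases (hD i) u with ⟨u, rfl⟩ | ⟨j, rfl⟩
  · rw [pieceFlag_inner]; rfl
  · rw [pieceFlag_leg, IsOnePI.leg_type]; exact p.glueType_legGlue i j

theorem pieceFlag_inj {i i' u u'} (h : p.pieceFlag hD i u = p.pieceFlag hD i' u') :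
    (⟨i, u⟩ : Σ i, (D i).VFlag) = ⟨i', u'⟩ := by
  rcases vflag_cases (hD i) u with ⟨u, rfl⟩ | ⟨j, rfl⟩ <;>
    rcases vflag_cases (hD i') u' with ⟨u', rfl⟩ | ⟨j', rfl⟩
  · rw [pieceFlag_inner, pieceFlag_inner, Sum.inl.injEq] at h
    cases h
    rfl
  · rw [pieceFlag_inner, pieceFlag_leg] at h
    cases h
  · rw [pieceFlag_inner, pieceFlag_leg] at h
    cases h
  · rw [pieceFlag_leg, pieceFlag_leg, Sum.inr.injEq] at h
    cases p.legGlue_inj h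
    rfl

theorem insFlag_cases (z : InsFlag Γ' hD) :
    (∃ i u, z = p.pieceFlag hD i u) ∨
      ∃ w, (∀ i j, w ≠ (p.leg i j).flag) ∧ z = .inr (.inl w) := by
  rcases z with ⟨i, u⟩ | z
  · exact .inl ⟨i, u.1, (p.pieceFlag_inner hD u).symm⟩
  · rcases p.glue_cases z with ⟨i, j, rfl⟩ | ⟨w, hw, rfl⟩
    · exact .inl ⟨i, (hD i).leg j, (p.pieceFlag_leg hD i j).symm⟩
    · exact .inr ⟨w, hw, rfl⟩

theorem eq_pieceFlag_of_insPt (hΓ' : Γ'.IsOnePI) {z i v}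
    (h : p.insPt hD hΓ' z = .inl (.inr ⟨i, v⟩)) : ∃ u, u.vert = v ∧ z = p.pieceFlag hD i u := by
  rcases p.insFlag_cases hD z with ⟨i', u, rfl⟩ | ⟨w, hw, rfl⟩
  · rw [insPt_pieceFlag] at h
    cases h
    exact ⟨u, rfl, rfl⟩
  · rcases p.basePt_of_not_leg hD hΓ' hw with ⟨v', hv', h1, h2⟩ | ⟨j, h1, h2⟩
    · cases h2.symm.trans h
    · cases h2.symm.trans h

theorem insPt_eq_free_iff (hΓ' : Γ'.IsOnePI) {z w} :
    p.insPt hD hΓ' z = .inl (.inl w) ↔ ∃ x : Γ'.Flag, z = .inr (.inl x) ∧ x.pt = .inl w.1 := by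
  constructor
  · intro h
    rcases p.insFlag_cases hD z with ⟨i', u, rfl⟩ | ⟨x, hx, rfl⟩
    · rw [insPt_pieceFlag] at h
      cases h
    · rcases p.basePt_of_not_leg hD hΓ' hx with ⟨v', hv', h1, h2⟩ | ⟨j, h1, h2⟩
      · cases h2.symm.trans h
        exact ⟨x, rfl, h1⟩
      · cases h2.symm.trans h
  · rintro ⟨x, rfl, hx⟩
    exact p.basePt_free hD hΓ' hx w.2

theorem insPt_eq_label_iff (hΓ' : Γ'.IsOnePI) {z j} :
    p.insPt hD hΓ' z = .inr j ↔ z = .inr (.inl (hΓ'.labelFlag j)) := by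
  constructor
  · intro h
    rcases p.insFlag_cases hD z with ⟨i', u, rfl⟩ | ⟨x, hx, rfl⟩
    · rw [insPt_pieceFlag] at h
      cases h
    · rcases p.basePt_of_not_leg hD hΓ' hx with ⟨v', hv', h1, h2⟩ | ⟨j', h1, h2⟩
      · cases h2.symm.trans h
      · cases h2.symm.trans h
        rw [hΓ'.eq_labelFlag h1]
  · rintro rfl
    exact p.basePt_label hD hΓ' (by simp)

variable [Fintype ι]

open scoped Classical in
/-- The graph that results from the insertion of the `D i` in `Γ'`, as a matching of flags. -/
noncomputable def insertion (hΓ' : Γ'.IsOnePI) (σ : Gluing t hΓ') : FlagGraph r where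
  V := p.InsV
  Φ := InsFlag Γ' hD
  fintypeΦ := inferInstance
  pt := p.insPt hD hΓ'
  ty := insType hD Γ'
  σ := Sum.map (fun u => ⟨u.1, u.2.swap⟩) σ.1
  σ_σ := by
    rintro (⟨i, u⟩ | f)
    · simp [InnerFlag.swap_swap]
    · simp [σ.2.invol]
  σ_ne := by
    rintro (⟨i, u⟩ | f)
    · simpa using InnerFlag.swap_ne u
    · simpa using σ.2.ne f
  ty_σ := by
    rintro (⟨i, u⟩ | f)
    · simp only [Sum.map_inl, insType, Sum.elim_inl]
      rw [← VFlag.flag_line, InnerFlag.swap_flag, Flag.swap_line, VFlag.flag_line]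
    · simpa [insType] using σ.2.ty f

end Rooting

end Diagram

end QED

namespace QED
namespace Diagram
namespace Rooting

variable {r : Residue} {ι : Type} {t : ι → Residue} {D : ∀ i, Diagram (t i)}
  {Γ' : Diagram r} (p : Rooting D Γ') (hD : ∀ i, (D i).IsOnePI) (hΓ' : Γ'.IsOnePI)
  (σ : Gluing t hΓ')

/-! ### The graph after insertion is one-particle irreducible -/

/-- The lines that are formed by a flag chain containing an internal line of the graph after
insertion are internal lines of `Γ'`. -/
theorem isInternal_of_chained {f : GlueFlag t Γ'} (hf : ∃ v, p.gluePt hD hΓ' f = .inl v)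
    (hf' : ∃ v, p.gluePt hD hΓ' (σ.1 f) = .inl v) {x : Γ'.Flag}
    (hx : Relation.EqvGen (Chained σ.1) f (.inl x)) : x.IsInternal hΓ'.isLoopless := by
  by_contra hn
  have h1 := σ.2.ext x hn
  have h2 : σ.1 (.inl (x.swap hΓ'.isLoopless)) = .inl x := by rw [← h1, σ.2.invol]
  -- an external line of `Γ'` is a complete chain
  have key : f = .inl x ∨ f = .inl (x.swap hΓ'.isLoopless) := by
    refine (EqvGen.iff_of_invariant
      (p := fun z => z = .inl x ∨ z = .inl (x.swap hΓ'.isLoopless)) ?_ hx).mpr (.inl rfl)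
    rintro a b (rfl | ⟨i, c, c', rfl, rfl⟩)
    · constructor
      · rintro (rfl | rfl)
        · exact .inr h1
        · exact .inl h2
      · rintro (h | h)
        · right; rw [← σ.2.invol a, h, h1]
        · left; rw [← σ.2.invol a, h, h2]
    · simp
  have hl : ∀ y : Γ'.Flag, (∃ v, p.gluePt hD hΓ' (.inl y) = .inl v) → ∃ v, y.pt = .inl v := by
    rintro y ⟨v, hv⟩
    cases hy : y.pt with
    | inl w => exact ⟨w, rfl⟩
    | inr j =>
      have := p.basePt_label hD hΓ' hy
      cases this.symm.trans hv
  refine hn ?_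
  rcases key with rfl | rfl
  · rw [h1] at hf'
    exact ⟨hl _ hf, hl _ hf'⟩
  · rw [h2] at hf'
    exact ⟨hl _ hf', hl _ hf⟩

/-- Each vertex after insertion keeps the flags that it had in `Γ'` or in its component. -/
theorem card_flags_vertex (v : p.InsV) (s : LineType) :
    Nat.card {z // p.insPt hD hΓ' z = .inl v ∧ insType hD Γ' z = s} = s.mult := by
  rcases v with w | ⟨i, v⟩
  · rw [← hΓ'.card_vflag w.1 s]
    refine (Nat.card_congr (Equiv.ofBijective (fun u => ⟨.inr (.inl u.1.flag),
      (p.insPt_eq_free_iff hD hΓ').mpr ⟨_, rfl, by rw [VFlag.flag_pt, u.2.1]⟩, u.2.2⟩)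
      ⟨?_, ?_⟩)).symm
    · intro a b hab
      simpa [Subtype.ext_iff] using hab
    · rintro ⟨z, hz, hz'⟩
      obtain ⟨x, rfl, hx⟩ := (p.insPt_eq_free_iff hD hΓ').mp hz
      obtain ⟨u, rfl, hu⟩ := x.exists_vflag hx
      exact ⟨⟨u, hu, hz'⟩, rfl⟩
  · rw [← (hD i).card_vflag v s]
    refine (Nat.card_congr (Equiv.ofBijective (fun u => ⟨p.pieceFlag hD i u.1, by
      rw [insPt_pieceFlag, u.2.1], by rw [insType_pieceFlag, u.2.2]⟩) ⟨?_, ?_⟩)).symm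
    · intro a b hab
      have := p.pieceFlag_inj hD (congrArg Subtype.val hab)
      apply Subtype.ext
      simpa using this
    · rintro ⟨z, hz, hz'⟩
      obtain ⟨u, hu, rfl⟩ := p.eq_pieceFlag_of_insPt hD hΓ' hz
      rw [insType_pieceFlag] at hz'
      exact ⟨⟨u, hu, hz'⟩, rfl⟩

variable [Fintype ι]

section cut

variable {χ : p.InsV ⊕ Fin r.numExt → Prop} {a : InsFlag Γ' hD}

/-- A 2-colouring that changes along at most one line is constant on each inserted component, since
a component stays connected when one internal line is removed. -/
theorem piece_monochrome
    (hχ : ∀ z, z ≠ a → z ≠ (p.insertion hD hΓ' σ).σ a →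
      (χ (p.insPt hD hΓ' z) ↔ χ (p.insPt hD hΓ' ((p.insertion hD hΓ' σ).σ z))))
    (i) (v w : (D i).V) :
    χ (.inl (.inr ⟨i, v⟩)) ↔ χ (.inl (.inr ⟨i, w⟩)) := by
  obtain ⟨e, he⟩ : ∃ e : (D i).E, ∀ u : InnerFlag (hD i), u.1.line ≠ e →
      .inl ⟨i, u⟩ ≠ a ∧ .inl ⟨i, u⟩ ≠ (p.insertion hD hΓ' σ).σ a := by
    by_cases ha : ∃ u, a = .inl ⟨i, u⟩
    · obtain ⟨u0, rfl⟩ := ha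
      refine ⟨u0.1.line, fun u hu => ⟨?_, ?_⟩⟩
      · intro h
        cases h
        exact hu rfl
      · intro h
        have h' : (.inl ⟨i, u⟩ : InsFlag Γ' hD) = .inl ⟨i, u0.swap⟩ := h
        cases h'
        apply hu
        rw [← VFlag.flag_line, InnerFlag.swap_flag, Flag.swap_line, VFlag.flag_line]
    · obtain ⟨u0, -⟩ := (hD i).exists_vflag v
      refine ⟨u0.line, fun u _ => ⟨fun h => ha ⟨u, h.symm⟩, fun h => ha ⟨u.swap, ?_⟩⟩⟩
      rw [← (p.insertion hD hΓ' σ).σ_σ a, ← h]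
      rfl
  refine (hD i).inner_cut e (fun v => χ (.inl (.inr ⟨i, v⟩))) ?_ v w
  intro u u' hu hue
  let x : InnerFlag (hD i) := ⟨u, u', hu⟩
  let x' : InnerFlag (hD i) := ⟨u', u, by rw [← hu, Flag.swap_swap]⟩
  have h1 := he x hue
  have h2 := hχ _ h1.1 h1.2
  have h3 : x.swap = x' := InnerFlag.swap_eq hu
  have h4 : (p.insertion hD hΓ' σ).σ (.inl ⟨i, x⟩) = .inl ⟨i, x.swap⟩ := rfl
  rw [h4, h3] at h2
  exact h2

/-- A 2-colouring of the points after insertion that is constant on the components restricts to the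
points of `Γ'`. -/
theorem glue_eq_of_pt_eq
    (hmono : ∀ i (v w : (D i).V), χ (.inl (.inr ⟨i, v⟩)) ↔ χ (.inl (.inr ⟨i, w⟩)))
    {z z' : Γ'.Flag} (h : z.pt = z'.pt) :
    χ (p.basePt hD hΓ' z) ↔ χ (p.basePt hD hΓ' z') := by
  cases hz : z.pt with
  | inr j => rw [hΓ'.eq_labelFlag hz, hΓ'.eq_labelFlag (h.symm.trans hz)]
  | inl w =>
    by_cases hw : ∀ i, p.root i ≠ w
    · rw [p.basePt_free hD hΓ' hz hw, p.basePt_free hD hΓ' (h ▸ hz) hw]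
    · push Not at hw
      obtain ⟨i, rfl⟩ := hw
      obtain ⟨u, rfl, hu⟩ := z.exists_vflag hz
      obtain ⟨j, rfl⟩ := p.exists_leg hΓ' hu
      obtain ⟨u', rfl, hu'⟩ := z'.exists_vflag (h ▸ hz)
      obtain ⟨j', rfl⟩ := p.exists_leg hΓ' hu'
      rw [basePt_leg, basePt_leg]
      exact hmono _ _ _

/-- A 2-colouring that changes along at most one line, which is internal if it exists, is constant.
It is constant on the components, and then defines a 2-colouring of the points of `Γ'` that changes
at most along the line whose chain contains the exceptional one. As `Γ'` is one-particle
irreducible, this colouring is constant, and finally so is the colouring of the self-energies in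
the chains. -/
theorem insertion_cut
    (ha : ((∃ v, p.insPt hD hΓ' a = .inl v) ∧
        ∃ v, p.insPt hD hΓ' ((p.insertion hD hΓ' σ).σ a) = .inl v) ∨
      (χ (p.insPt hD hΓ' a) ↔ χ (p.insPt hD hΓ' ((p.insertion hD hΓ' σ).σ a))))
    (hχ : ∀ z, z ≠ a → z ≠ (p.insertion hD hΓ' σ).σ a →
      (χ (p.insPt hD hΓ' z) ↔ χ (p.insPt hD hΓ' ((p.insertion hD hΓ' σ).σ z)))) (x y) :
    χ x ↔ χ y := by
  have hmono := p.piece_monochrome hD hΓ' σ hχ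
  let c : GlueFlag t Γ' → Prop := fun z => χ (p.gluePt hD hΓ' z)
  have hN : 0 < r.numExt := lt_of_lt_of_le (by simp) (two_le_numExt (r := r))
  -- if the exceptional line lies in a component, then no other line is exceptional, and the flag of
  -- an external line can take its role
  obtain ⟨f, hf, hcσ⟩ : ∃ f : GlueFlag t Γ',
      (((∃ v, p.gluePt hD hΓ' f = .inl v) ∧ ∃ v, p.gluePt hD hΓ' (σ.1 f) = .inl v) ∨
        (c f ↔ c (σ.1 f))) ∧ ∀ z, z ≠ f → z ≠ σ.1 f → (c z ↔ c (σ.1 z)) := by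
    rcases a with u | f
    · have : ∀ z, c z ↔ c (σ.1 z) := fun z => hχ (.inr z) (by simp) (fun h => by cases h)
      exact ⟨.inl (hΓ'.labelFlag ⟨0, hN⟩), .inr (this _), fun z _ _ => this z⟩
    · refine ⟨f, ha, fun z h1 h2 => hχ (.inr z) (by simpa using h1) fun h => h2 ?_⟩
      exact Sum.inr_injective h
  have hself : ∀ (i : {i // t i ≠ .vertex}) b b', c (.inr (i, b)) ↔ c (.inr (i, b')) :=
    fun i b b' => hmono _ _ _
  let χ' : Γ'.Pt → Prop := fun x => ∃ z : Γ'.Flag, z.pt = x ∧ c (.inl z)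
  have hχ' : ∀ z : Γ'.Flag, χ' z.pt ↔ c (.inl z) := fun z =>
    ⟨fun ⟨z', h1, h2⟩ => (p.glue_eq_of_pt_eq hD hΓ' hmono h1).mp h2, fun h => ⟨z, rfl, h⟩⟩
  have hB : ∀ x y : Γ'.Flag, c (.inl x) ↔ c (.inl y) := by
    intro x y
    rw [← hχ' x, ← hχ' y]
    obtain ⟨x0, hx0⟩ := σ.2.exists_base f
    -- the colour is constant on the chains that do not contain `f`
    have hp : ∀ z : Γ'.Flag, (z ≠ x0 ∧ z ≠ x0.swap hΓ'.isLoopless ∨ (c f ↔ c (σ.1 f))) →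
        (χ' z.pt ↔ χ' (z.swap hΓ'.isLoopless).pt) := by
      intro z hz
      rw [hχ', hχ']
      have hchain : Relation.EqvGen (Chained σ.1) (.inl z) (.inl (z.swap hΓ'.isLoopless)) :=
        (σ.2.base _ _).mpr (.inr rfl)
      rcases hz with ⟨hz1, hz2⟩ | hcf
      · have h1 : ¬ Relation.EqvGen (Chained σ.1) f (.inl z) := by
          intro h
          rcases (σ.2.base _ _).mp ((hx0.symm).trans _ _ _ h) with h | h
          · exact hz1 h
          · exact hz2 h
        have h2 : ¬ Relation.EqvGen (Chained σ.1) f (.inl (z.swap hΓ'.isLoopless)) :=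
          fun h => h1 (h.trans _ _ _ hchain.symm)
        -- the chain of `f` is the only one with an exceptional line
        have h3 := EqvGen.iff_of_invariant
          (p := fun w => Relation.EqvGen (Chained σ.1) f w ∨ c w) ?_ hchain
        · simpa [h1, h2] using h3
        intro w w' hw
        by_cases hfw : Relation.EqvGen (Chained σ.1) f w
        · have : Relation.EqvGen (Chained σ.1) f w' := hfw.trans _ _ _ (.rel _ _ hw)
          simp [this, hfw]
        · have hfw' : ¬ Relation.EqvGen (Chained σ.1) f w' :=
            fun h => hfw (h.trans _ _ _ (.symm _ _ (.rel _ _ hw)))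
          simp only [hfw, hfw', false_or]
          rcases hw with rfl | ⟨i, b, b', rfl, rfl⟩
          · refine hcσ w ?_ ?_
            · rintro rfl; exact hfw (.refl _)
            · rintro rfl; exact hfw (.rel _ _ (.inl rfl))
          · exact hself i b b'
      · refine EqvGen.iff_of_invariant (p := c) ?_ hchain
        rintro w w' (rfl | ⟨i, b, b', rfl, rfl⟩)
        · by_cases h1 : w = f
          · rw [h1]; exact hcf
          by_cases h2 : w = σ.1 f
          · rw [h2, σ.2.invol]; exact hcf.symm
          exact hcσ w h1 h2
        · exact hself i b b'
    rcases hf with ⟨h1, h2⟩ | hcf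
    · have hi := p.isInternal_of_chained hD hΓ' σ h1 h2 hx0
      exact hΓ'.cut_of_ne x0 hi.1 hi.2 χ' (fun z hz hz' => hp z (.inl ⟨hz, hz'⟩)) _ _
    · exact hΓ'.cut χ' (fun z => hp z (.inr hcf)) _ _
  have hall : ∀ x, ∃ z, χ x ↔ c z := by
    rintro ((w | ⟨i, v⟩) | j)
    · obtain ⟨u, hu⟩ := hΓ'.exists_vflag w.1
      refine ⟨.inl u.flag, ?_⟩
      have := p.basePt_free hD hΓ' (z := u.flag) (w := w.1) (by rw [VFlag.flag_pt, hu]) w.2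
      change _ ↔ χ (p.basePt hD hΓ' u.flag)
      rw [this]
    · refine ⟨p.legGlue i ⟨0, lt_of_lt_of_le (by simp) (two_le_numExt (r := t i))⟩, ?_⟩
      change _ ↔ χ (p.gluePt hD hΓ' _)
      rw [gluePt_legGlue]
      exact hmono _ _ _
    · refine ⟨.inl (hΓ'.labelFlag j), ?_⟩
      change _ ↔ χ (p.basePt hD hΓ' _)
      rw [p.basePt_label hD hΓ' (hΓ'.labelFlag_pt j)]
  have hc := σ.2.colour_eq f c hself hcσ hB
  obtain ⟨z, hz⟩ := hall x
  obtain ⟨z', hz'⟩ := hall y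
  rw [hz, hz', hc z (hΓ'.labelFlag ⟨0, hN⟩), hc z' (hΓ'.labelFlag ⟨0, hN⟩)]

end cut

open scoped Classical in
/-- By Euler's formula for trivalent graphs, the number of vertices after insertion is the one that
belongs to the sum of the loop numbers. A vertex graph has one vertex more than a self-energy with
the same number of loops, and it replaces a vertex. -/
theorem card_insV (p : Rooting D Γ') (hD : ∀ i, (D i).IsOnePI) (hΓ' : Γ'.IsOnePI) :
    Fintype.card p.InsV + 2 = 2 * (Γ'.loops + ∑ i, (D i).loops) + r.numExt := by
  classical
  have h1 : Fintype.card {w : Γ'.V // ∀ i, p.root i ≠ w} + Fintype.card {i // t i = .vertex}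
      = Fintype.card Γ'.V := by
    have h2 : Fintype.card {i // t i = .vertex} =
        Fintype.card {w : Γ'.V // ¬ ∀ i, p.root i ≠ w} := by
      refine Fintype.card_congr (Equiv.ofBijective (fun i => ⟨p.root i, fun h => h i rfl⟩) ⟨?_, ?_⟩)
      · intro i i' h
        exact p.root_inj (congrArg Subtype.val h)
      · rintro ⟨w, hw⟩
        push Not at hw
        obtain ⟨i, rfl⟩ := hw
        exact ⟨i, rfl⟩
    rw [h2, Fintype.card_subtype_compl]
    exact Nat.add_sub_cancel' (Fintype.card_subtype_le _)
  have h3 : ∑ i, Fintype.card (D i).V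
      = 2 * (∑ i, (D i).loops) + Fintype.card {i // t i = .vertex} := by
    rw [Fintype.card_subtype, Finset.card_filter, Finset.mul_sum, ← Finset.sum_add_distrib]
    refine Finset.sum_congr rfl fun i _ => ?_
    have := (hD i).card_V
    have h5 : (t i).numExt = 2 + if t i = .vertex then 1 else 0 := by
      cases t i <;> rfl
    lia
  have h4 := hΓ'.card_V
  have h5 : Fintype.card p.InsV = Fintype.card {w : Γ'.V // ∀ i, p.root i ≠ w}
      + ∑ i, Fintype.card (D i).V := by
    rw [Fintype.card_sum, Fintype.card_sigma]
  lia

/-- Insertion of one-particle irreducible graphs in a one-particle irreducible graph gives a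
one-particle irreducible graph, with additive loop numbers. -/
theorem insertion_isOnePI : (p.insertion hD hΓ' σ).diagram.IsOnePI ∧
    (p.insertion hD hΓ' σ).diagram.loops = Γ'.loops + ∑ i, (D i).loops := by
  refine FlagGraph.isOnePI _ ?_ ?_ (fun v => p.card_flags_vertex hD hΓ' v .electron)
    (fun v => p.card_flags_vertex hD hΓ' v .photon) ?_ ?_ ?_
  · have := hΓ'.not_tree
    lia
  · rw [← p.card_insV hD hΓ']
    congr
  · intro j s
    have h1 : ∀ z, (p.insertion hD hΓ' σ).pt z = .inr j ↔ z = .inr (.inl (hΓ'.labelFlag j)) :=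
      fun z => p.insPt_eq_label_iff hD hΓ'
    have h2 : (p.insertion hD hΓ' σ).ty (.inr (.inl (hΓ'.labelFlag j))) = r.extType j :=
      hΓ'.labelFlag_type j
    simp only [h1]
    split_ifs with hs
    · rw [Nat.card_eq_one_iff_unique]
      exact ⟨⟨fun a b => Subtype.ext (a.2.1.trans b.2.1.symm)⟩, ⟨⟨_, rfl, h2.trans hs⟩⟩⟩
    · rw [Finite.card_eq_zero_iff]
      refine ⟨?_⟩
      rintro ⟨z, rfl, hz⟩
      exact hs (h2.symm.trans hz)
  · -- without an exceptional line, any flag can take its role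
    intro χ hχ
    have hN : 0 < r.numExt := lt_of_lt_of_le (by simp) (two_le_numExt (r := r))
    exact p.insertion_cut hD hΓ' σ (a := .inr (.inl (hΓ'.labelFlag ⟨0, hN⟩)))
      (.inr (hχ (.inr (.inl (hΓ'.labelFlag ⟨0, hN⟩))))) fun z _ _ => hχ z
  · intro a ha ha' χ hχ
    exact p.insertion_cut hD hΓ' σ (.inl ⟨ha, ha'⟩) hχ

end Rooting
end Diagram
end QED

namespace QED
namespace Diagram

variable {r : Residue} {ι : Type} {t : ι → Residue} {D : ∀ i, Diagram (t i)}
  {Γ' : Diagram r} {G : Diagram r}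

/-! ### Graphs with a subgraph and its contraction are insertions -/

namespace Rooting

theorem exists_leg_of_eq_pieceFlag {p : Rooting D Γ'} {hD : ∀ i, (D i).IsOnePI} {z : Γ'.Flag} {i}
    {u : (D i).VFlag} (h : .inr (.inl z) = p.pieceFlag hD i u) :
    ∃ (hi : t i = .vertex) (j : _), u = (hD i).leg j ∧ z = (p.leg ⟨i, hi⟩ j).flag := by
  rcases vflag_cases (hD i) u with ⟨u, rfl⟩ | ⟨j, rfl⟩
  · rw [pieceFlag_inner] at h
    cases h
  · rw [pieceFlag_leg, Sum.inr.injEq] at h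
    by_cases hi : t i = .vertex
    · rw [p.legGlue_vertex ⟨i, hi⟩, Sum.inl.injEq] at h
      exact ⟨hi, j, rfl, h⟩
    · rw [p.legGlue_self ⟨i, hi⟩] at h
      cases h

/-- The chains of lines and self-energies of the graph after insertion are the chains of flags that
are contracted to a line. -/
theorem linked_iff_chained {p : Rooting D Γ'} {hD : ∀ i, (D i).IsOnePI} {hG : G.IsOnePI}
    {J : ∀ i, (D i).VFlag → G.VFlag} {h : GlueFlag t Γ' → G.Flag}
    {σ : GlueFlag t Γ' → GlueFlag t Γ'} (hinj : Function.Injective h)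
    (hσ : ∀ z, h (σ z) = (h z).swap hG.isLoopless)
    (hJ : ∀ i j, h (p.legGlue i j) = (J i ((hD i).leg j)).flag) (a b : GlueFlag t Γ') :
    Relation.EqvGen (Linked hD hG J) (h a) (h b) ↔ Relation.EqvGen (Chained σ) a b := by
  have hσσ : ∀ z, σ (σ z) = z := fun z => hinj (by rw [hσ, hσ, Flag.swap_swap])
  refine EqvGen.iff_of_embedding hinj ?_ ?_ ?_ a b
  · rintro a b (rfl | ⟨i, c, c', rfl, rfl⟩)
    · exact .inl (hσ a)
    · refine .inr ⟨i.1, i.2, Residue.boolEquiv i.2 c, Residue.boolEquiv i.2 c', ?_, ?_⟩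
      · rw [p.inr_eq_legGlue, hJ]
      · rw [p.inr_eq_legGlue, hJ]
  · rintro a y (rfl | ⟨i, hi, j, j', ha, rfl⟩)
    · exact ⟨σ a, (hσ a).symm, .inl rfl⟩
    · rw [← hJ] at ha
      obtain rfl := hinj ha
      exact ⟨_, (hJ i j').symm, .inr ⟨⟨i, hi⟩, _, _, p.legGlue_self ⟨i, hi⟩ j,
        p.legGlue_self ⟨i, hi⟩ j'⟩⟩
  · rintro y b (hb | ⟨i, hi, j, j', rfl, hb⟩)
    · refine ⟨σ b, ?_, .inl (hσσ b).symm⟩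
      rw [hσ, hb, Flag.swap_swap]
    · rw [← hJ] at hb
      obtain rfl := hinj hb
      exact ⟨_, (hJ i j).symm, .inr ⟨⟨i, hi⟩, _, _, p.legGlue_self ⟨i, hi⟩ j,
        p.legGlue_self ⟨i, hi⟩ j'⟩⟩

variable (p : Rooting D Γ') (hD : ∀ i, (D i).IsOnePI) (hΓ' : Γ'.IsOnePI)
  (σ : Gluing t hΓ') (hG : G.IsOnePI)

variable {p hD hΓ' σ hG} in
theorem exists_insPt (v : p.InsV) : ∃ z, p.insPt hD hΓ' z = .inl v := by
  have h := p.card_flags_vertex hD hΓ' v .photon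
  obtain ⟨⟨z, hz⟩⟩ := (Nat.card_pos_iff.mp (by rw [h]; simp [LineType.mult])).1
  exact ⟨z, hz.1⟩

variable {p hΓ' σ} in
/-- No line joins two legs of the same inserted graph. -/
theorem glue_legGlue_ne (i j j') : σ.1 (p.legGlue i j) ≠ p.legGlue i j' := by
  intro hh
  by_cases hi : t i = .vertex
  · rw [p.legGlue_vertex ⟨i, hi⟩, p.legGlue_vertex ⟨i, hi⟩] at hh
    have h1 := (σ.2.base (p.leg ⟨i, hi⟩ j).flag (p.leg ⟨i, hi⟩ j').flag).mp
      (.rel _ _ (.inl hh.symm))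
    rcases h1 with h1 | h1
    · rw [h1] at hh
      exact σ.2.ne _ hh
    · apply Flag.swap_pt_ne hΓ'.isLoopless (p.leg ⟨i, hi⟩ j).flag
      rw [← h1, VFlag.flag_pt, VFlag.flag_pt, p.leg_vert, p.leg_vert]
  · rw [p.legGlue_self ⟨i, hi⟩, p.legGlue_self ⟨i, hi⟩] at hh
    generalize (Residue.boolEquiv hi).symm j = b at hh
    generalize (Residue.boolEquiv hi).symm j' = b' at hh
    -- the two legs would form a chain that contains no flag of `Γ'`
    have hb : b' = !b := by
      have h1 : b' ≠ b := by
        rintro rfl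
        exact σ.2.ne _ hh
      cases b <;> cases b' <;> simp_all
    have hh' : σ.1 (.inr (⟨i, hi⟩, b')) = .inr (⟨i, hi⟩, b) := by rw [← hh, σ.2.invol]
    have hall : ∀ c, ∃ c', σ.1 (.inr (⟨i, hi⟩, c)) = .inr (⟨i, hi⟩, c') := by
      intro c
      by_cases hc : c = b
      · rw [hc]; exact ⟨_, hh⟩
      · have : c = b' := by
          rw [hb]
          cases c <;> cases b <;> simp_all
        rw [this]; exact ⟨_, hh'⟩
    obtain ⟨x, hx⟩ := σ.2.reach ⟨i, hi⟩ b
    have := (EqvGen.iff_of_invariant (p := fun z => ∃ c, z = .inr (⟨i, hi⟩, c)) ?_ hx).mp ⟨b, rfl⟩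
    · obtain ⟨c, hc⟩ := this
      cases hc
    · rintro y z (rfl | ⟨i', c, c', rfl, rfl⟩)
      · constructor
        · rintro ⟨c, rfl⟩
          exact hall c
        · rintro ⟨c, hc⟩
          obtain ⟨c', hc'⟩ := hall c
          exact ⟨c', by rw [← hc', ← hc, σ.2.invol]⟩
      · simp

variable [Fintype ι]

/-- The description of the isomorphisms of the graph after insertion with `G` in terms of
flags. -/
structure IsRealization (H : InsFlag Γ' hD → G.Flag) : Prop where
  bij : Function.Bijective H
  pt : ∀ z z', (H z).pt = (H z').pt ↔ p.insPt hD hΓ' z = p.insPt hD hΓ' z'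
  ty : ∀ z, G.lineType (H z).line = insType hD Γ' z
  swap : ∀ z, H ((p.insertion hD hΓ' σ).σ z) = (H z).swap hG.isLoopless
  label : ∀ j, H (.inr (.inl (hΓ'.labelFlag j))) = hG.labelFlag j

variable {p hD hΓ' σ hG}

theorem IsRealization.pt_inr_iff {H : InsFlag Γ' hD → G.Flag} (h : p.IsRealization hD hΓ' σ hG H)
    {z j} : (H z).pt = .inr j ↔ p.insPt hD hΓ' z = .inr j := by
  have h1 := h.pt z (.inr (.inl (hΓ'.labelFlag j)))
  rw [h.label, hG.labelFlag_pt] at h1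
  rw [h1]
  rw [show p.insPt hD hΓ' (.inr (.inl (hΓ'.labelFlag j))) = .inr j from
    p.basePt_label hD hΓ' (hΓ'.labelFlag_pt j)]

/-- An isomorphism of the graph after insertion with `G` satisfies the description in terms of
flags. -/
theorem isRealization_onFlag (x : Iso (p.insertion hD hΓ' σ).diagram G) :
    p.IsRealization hD hΓ' σ hG (x.onFlag (p.insertion hD hΓ' σ).isPresentation) := by
  have hP := (p.insertion hD hΓ' σ).isPresentation
  have hinj := x.onFlag_injective hP hG.isLoopless
  have hmap : Function.Injective (Sum.map x.onV (id : Fin r.numExt → Fin r.numExt)) :=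
    Sum.map_injective.mpr ⟨x.onV.injective, Function.injective_id⟩
  refine ⟨⟨hinj, x.onFlag_surjective hP⟩, ?_, ?_, ?_, ?_⟩
  · intro z z'
    exact hmap.eq_iff
  · intro z
    exact x.lineType_eq _
  · intro z
    refine (Flag.swap_eq_of_ne hG.isLoopless ?_ ?_).symm
    · exact congrArg x.onE (((p.insertion hD hΓ' σ).line_eq_iff _ _).mpr
        (.inr ((p.insertion hD hΓ' σ).σ_σ z).symm))
    · exact fun hh => (p.insertion hD hΓ' σ).σ_ne z (hinj hh)
  · intro j
    apply hG.eq_labelFlag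
    change Sum.map x.onV id (p.insPt hD hΓ' (.inr (.inl (hΓ'.labelFlag j)))) = _
    rw [show p.insPt hD hΓ' (.inr (.inl (hΓ'.labelFlag j))) = .inr j from
      p.basePt_label hD hΓ' (hΓ'.labelFlag_pt j)]
    rfl

theorem onFlag_injective_of_insertion :
    Function.Injective (Iso.onFlag (D' := G) (p.insertion hD hΓ' σ).isPresentation) := by
  intro x y h
  refine Iso.ext' (fun v => ?_) fun e => ?_
  · obtain ⟨z, hz⟩ := exists_insPt (hD := hD) (hΓ' := hΓ') v
    have h1 : Sum.map x.onV id (p.insPt hD hΓ' z) = Sum.map y.onV id (p.insPt hD hΓ' z) :=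
      congrArg Flag.pt (congrFun h z)
    rw [hz] at h1
    exact Sum.inl.inj h1
  · obtain ⟨z, rfl⟩ := (p.insertion hD hΓ' σ).line_surjective e
    exact congrArg Flag.line (congrFun h z)

/-- The description in terms of flags comes from an isomorphism. -/
theorem IsRealization.exists_iso {H : InsFlag Γ' hD → G.Flag}
    (h : p.IsRealization hD hΓ' σ hG H) : ∃ x : Iso (p.insertion hD hΓ' σ).diagram G,
      x.onFlag (p.insertion hD hΓ' σ).isPresentation = H := by
  have hP := (p.insertion hD hΓ' σ).isPresentation
  choose z hz using exists_insPt (p := p) (hD := hD) (hΓ' := hΓ')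
  have hg : ∀ v, ∃ w, (H (z v)).pt = .inl w := by
    intro v
    cases hp : (H (z v)).pt with
    | inl w => exact ⟨w, rfl⟩
    | inr j =>
      rw [h.pt_inr_iff, hz] at hp
      cases hp
  choose g hg using hg
  have hgpt : ∀ a, (H a).pt = Sum.map g id (p.insPt hD hΓ' a) := by
    intro a
    cases ha : p.insPt hD hΓ' a with
    | inl v =>
      rw [← hz, ← h.pt] at ha
      rw [ha, hg]
      rfl
    | inr j => exact h.pt_inr_iff.mpr ha
  have hgb : Function.Bijective g := by
    constructor
    · intro v v' hv
      have h1 : (H (z v)).pt = (H (z v')).pt := by rw [hg, hg, hv]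
      rw [h.pt, hz, hz] at h1
      exact Sum.inl.inj h1
    · intro w
      obtain ⟨u, rfl⟩ := hG.exists_vflag w
      obtain ⟨a, ha⟩ := h.bij.2 u.flag
      have h1 := hgpt a
      rw [ha, VFlag.flag_pt] at h1
      cases hv : p.insPt hD hΓ' a with
      | inl v =>
        rw [hv] at h1
        exact ⟨v, (Sum.inl.inj h1).symm⟩
      | inr j =>
        rw [hv] at h1
        cases h1
  obtain ⟨x, hxV, hxE⟩ := Diagram.exists_iso hP hG.isLoopless (Equiv.ofBijective g hgb)
    (Equiv.ofBijective H h.bij) hgpt h.ty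
    (by
      intro a b
      rw [(p.insertion hD hΓ' σ).line_eq_iff]
      change (H a).line = (H b).line ↔ _
      rw [eq_comm, Flag.line_eq_iff hG.isLoopless, ← h.swap]
      exact or_congr h.bij.1.eq_iff h.bij.1.eq_iff)
    (p.insertion hD hΓ' σ).line_surjective
  refine ⟨x, funext fun a => Flag.ext (hxE a) ?_⟩
  change Sum.map x.onV id (p.insPt hD hΓ' a) = _
  rw [hxV]
  exact (hgpt a).symm

/-- The embedding of `D i` in the graph after insertion. -/
theorem IsRealization.exists_piece {H : InsFlag Γ' hD → G.Flag}
    (h : p.IsRealization hD hΓ' σ hG H) (i) (u : (D i).VFlag) :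
    ∃ w : G.VFlag, w.flag = H (p.pieceFlag hD i u) := by
  rcases hG.eq_labelFlag_or (H (p.pieceFlag hD i u)) with ⟨w, hw⟩ | ⟨j, hj⟩
  · exact ⟨w, hw.symm⟩
  · have := congrArg Flag.pt hj
    rw [hG.labelFlag_pt, h.pt_inr_iff, insPt_pieceFlag] at this
    cases this

section forward

variable {H : InsFlag Γ' hD → G.Flag} (h : p.IsRealization hD hΓ' σ hG H)
  {J : ∀ i, (D i).VFlag → G.VFlag} (hJ : ∀ i u, (J i u).flag = H (p.pieceFlag hD i u))

theorem IsRealization.vert_eq_iff (h : p.IsRealization hD hΓ' σ hG H)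
    (hJ : ∀ i u, (J i u).flag = H (p.pieceFlag hD i u)) {i i'} {u : (D i).VFlag}
    {u' : (D i').VFlag} : (J i u).vert = (J i' u').vert ↔
      (⟨i, u.vert⟩ : Σ i, (D i).V) = ⟨i', u'.vert⟩ := by
  have h1 := h.pt (p.pieceFlag hD i u) (p.pieceFlag hD i' u')
  rw [← hJ, ← hJ, insPt_pieceFlag, insPt_pieceFlag, VFlag.flag_pt, VFlag.flag_pt] at h1
  simpa using h1

/-- The inserted components are disjoint subgraphs of the graph after insertion. -/
theorem IsRealization.isPieces (h : p.IsRealization hD hΓ' σ hG H)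
    (hJ : ∀ i u, (J i u).flag = H (p.pieceFlag hD i u)) : IsPieces hD hG J := by
  have hinj : ∀ i, Function.Injective (J i) := by
    intro i u u' hu
    rw [← VFlag.flag_inj, hJ, hJ, h.bij.1.eq_iff] at hu
    simpa using p.pieceFlag_inj hD hu
  refine ⟨fun i => ⟨?_, ?_, hinj i, ?_, ?_, ?_⟩, ?_⟩
  · choose f hf using (hD i).exists_vflag
    refine ⟨fun v => (J i (f v)).vert, ?_, ?_⟩
    · intro v v' hv
      rw [h.vert_eq_iff hJ, hf, hf] at hv
      simpa using hv
    · intro u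
      rw [h.vert_eq_iff hJ, hf]
  · intro u
    rw [← VFlag.flag_line, hJ, h.ty, insType_pieceFlag]
  · rintro w ⟨u, hu⟩
    obtain ⟨z, hz⟩ := h.bij.2 w.flag
    have h1 : (H z).pt = (H (p.pieceFlag hD i u)).pt := by
      rw [hz, ← hJ, VFlag.flag_pt, VFlag.flag_pt, hu]
    rw [h.pt, insPt_pieceFlag] at h1
    obtain ⟨u', -, rfl⟩ := p.eq_pieceFlag_of_insPt hD hΓ' h1
    exact ⟨u', by rw [← VFlag.flag_inj, hJ, hz]⟩
  · intro u u' hu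
    let x : InnerFlag (hD i) := ⟨u, u', hu⟩
    let x' : InnerFlag (hD i) := ⟨u', u, by rw [← hu, Flag.swap_swap]⟩
    have h1 : x.swap = x' := InnerFlag.swap_eq hu
    have h2 := h.swap (.inl ⟨i, x⟩)
    have h3 : (p.insertion hD hΓ' σ).σ (.inl ⟨i, x⟩) = .inl ⟨i, x.swap⟩ := rfl
    rw [h3, h1, ← pieceFlag_inner, ← pieceFlag_inner, ← hJ, ← hJ] at h2
    exact h2.symm
  · intro j u hh
    rw [hJ, hJ, pieceFlag_leg] at hh
    replace hh : .inr (σ.1 (p.legGlue i j)) = p.pieceFlag hD i u :=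
      h.bij.1 ((h.swap (.inr (p.legGlue i j))).trans hh)
    rcases vflag_cases (hD i) u with ⟨u, rfl⟩ | ⟨j', rfl⟩
    · rw [pieceFlag_inner] at hh
      cases hh
    · rw [pieceFlag_leg, Sum.inr.injEq] at hh
      exact glue_legGlue_ne i j j' hh
  · intro i i' u u' hu
    rw [h.vert_eq_iff hJ] at hu
    exact congrArg Sigma.fst hu

/-- Contraction of the inserted components gives `Γ'` back. -/
theorem IsRealization.isContraction (h : p.IsRealization hD hΓ' σ hG H)
    (hJ : ∀ i u, (J i u).flag = H (p.pieceFlag hD i u)) :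
    IsContraction hD hG hΓ' J fun z => H (.inr (.inl z)) := by
  have hlink := linked_iff_chained (p := p) (hG := hG) (J := J) (h := fun z => H (.inr z))
    (σ := σ.1) (fun a b hab => Sum.inr_injective (h.bij.1 hab)) (fun z => h.swap (.inr z))
    (fun i j => by rw [hJ, pieceFlag_leg])
  have hleg : ∀ i j, H (.inr (.inl (p.leg i j).flag)) = (J i.1 ((hD i).leg j)).flag := by
    intro i j
    rw [hJ, pieceFlag_leg, p.legGlue_vertex i j]
  have hleg' : ∀ {z : Γ'.Flag} {i} {u : (D i).VFlag}, H (.inr (.inl z)) = (J i u).flag →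
      ∃ (hi : t i = .vertex) (j : _), u = (hD i).leg j ∧ z = (p.leg ⟨i, hi⟩ j).flag := by
    intro z i u hz
    rw [hJ, h.bij.1.eq_iff] at hz
    exact exists_leg_of_eq_pieceFlag hz
  refine ⟨?_, ?_, ?_, h.label, ?_, ?_, ?_⟩
  · intro a b hab
    simpa using h.bij.1 hab
  · intro z
    constructor
    · rintro ⟨y, rfl⟩
      by_cases hy : ∃ i j, y = (p.leg i j).flag
      · obtain ⟨i, j, rfl⟩ := hy
        exact .inr ⟨i.1, i.2, j, hleg i j⟩
      · left
        intro i u hu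
        obtain ⟨hi, j, -, rfl⟩ := hleg' hu
        exact hy ⟨_, _, rfl⟩
    · rintro (hz | ⟨i, hi, j, rfl⟩)
      · obtain ⟨a, rfl⟩ := h.bij.2 z
        rcases p.insFlag_cases hD a with ⟨i, u, rfl⟩ | ⟨w, hw, rfl⟩
        · exact absurd (hJ i u).symm (hz i u)
        · exact ⟨w, rfl⟩
      · exact ⟨_, hleg ⟨i, hi⟩ j⟩
  · intro z
    exact h.ty _
  · intro z z'
    have hbase : ∀ z : Γ'.Flag, (∃ i j, z = (p.leg i j).flag) ∨
        (∃ w, z.pt = .inl w.1 ∧ p.insPt hD hΓ' (.inr (.inl z)) = .inl (.inl w)) ∨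
        ∃ j, z.pt = .inr j ∧ p.insPt hD hΓ' (.inr (.inl z)) = .inr j := by
      intro z
      by_cases hz : ∃ i j, z = (p.leg i j).flag
      · exact .inl hz
      · push Not at hz
        rcases p.basePt_of_not_leg hD hΓ' hz with ⟨w, hw, h1, h2⟩ | h1
        · exact .inr (.inl ⟨⟨w, hw⟩, h1, h2⟩)
        · exact .inr (.inr h1)
    constructor
    · intro hz
      rcases hbase z with ⟨i, j, rfl⟩ | ⟨w, h1, h2⟩ | ⟨j, h1, h2⟩
      · obtain ⟨u, rfl, hu⟩ := z'.exists_vflag hz.symm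
        obtain ⟨j', rfl⟩ := p.exists_leg hΓ' (hu.trans (p.leg_vert i j))
        exact .inr ⟨i.1, i.2, _, _, hleg i j, hleg i j'⟩
      · left
        rw [h.pt, h2]
        exact ((p.insPt_eq_free_iff hD hΓ').mpr ⟨z', rfl, hz.symm.trans h1⟩).symm
      · rw [hΓ'.eq_labelFlag h1, hΓ'.eq_labelFlag (hz.symm.trans h1)]
        exact .inl rfl
    · rintro (hz | ⟨i, hi, u, u', hu, hu'⟩)
      · rw [h.pt] at hz
        rcases hbase z with ⟨i, j, rfl⟩ | ⟨w, h1, h2⟩ | ⟨j, h1, h2⟩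
        · rw [← p.legGlue_vertex, ← pieceFlag_leg, insPt_pieceFlag] at hz
          obtain ⟨u, hu, hu'⟩ := p.eq_pieceFlag_of_insPt hD hΓ' hz.symm
          obtain ⟨hi, j', -, rfl⟩ := exists_leg_of_eq_pieceFlag hu'
          rw [VFlag.flag_pt, VFlag.flag_pt, p.leg_vert, p.leg_vert]
        · rw [h2] at hz
          obtain ⟨x, hx, hx'⟩ := (p.insPt_eq_free_iff hD hΓ').mp hz.symm
          rw [Sum.inr.injEq, Sum.inl.injEq] at hx
          rw [h1, hx, hx']
        · rw [h2] at hz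
          have := (p.insPt_eq_label_iff hD hΓ').mp hz.symm
          rw [Sum.inr.injEq, Sum.inl.injEq] at this
          rw [h1, this, hΓ'.labelFlag_pt]
      · obtain ⟨_, j, -, rfl⟩ := hleg' hu
        obtain ⟨_, j', -, rfl⟩ := hleg' hu'
        rw [VFlag.flag_pt, VFlag.flag_pt, p.leg_vert, p.leg_vert]
  · intro z z'
    rw [hlink, σ.2.base, eq_comm, Flag.line_eq_iff hΓ'.isLoopless]
  · intro i hi j
    obtain ⟨x, hx⟩ := σ.2.reach ⟨i, hi⟩ ((Residue.boolEquiv hi).symm j)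
    refine ⟨x, ?_⟩
    rw [← hlink, ← p.legGlue_self ⟨i, hi⟩ j, ← pieceFlag_leg, ← hJ] at hx
    exact hx

end forward

end Rooting

end Diagram

end QED

namespace QED
namespace Diagram

variable {r : Residue} {ι : Type} {t : ι → Residue} {D : ∀ i, Diagram (t i)}
  {Γ' : Diagram r} {G : Diagram r}

/-! ### Reconstruction of the insertion places -/

section backward

variable {hD : ∀ i, (D i).IsOnePI} {hΓ' : Γ'.IsOnePI} {hG : G.IsOnePI}
  {J : ∀ i, (D i).VFlag → G.VFlag} {k : Γ'.Flag → G.Flag}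

theorem IsContraction.survives (hk : IsContraction hD hG hΓ' J k) (z) : Survives hD J (k z) :=
  (hk.range _).mp ⟨z, rfl⟩

theorem IsPieces.leg_of_survives (hJ : IsPieces hD hG J) {i} {u : (D i).VFlag}
    (h : Survives hD J (J i u).flag) : t i = .vertex ∧ ∃ j, u = (hD i).leg j := by
  rcases h with h | ⟨i', hi', j, h⟩
  · exact absurd rfl (h i u)
  · obtain rfl := hJ.flag_eq h
    rw [VFlag.flag_inj, ((hJ.isEmb i).inj).eq_iff] at h
    exact ⟨hi', j, h⟩

/-- A self-energy is not attached to an external line of `G`: the line that leaves it at the other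
leg would be the only connection of the self-energy and the external line with the rest. -/
theorem IsContraction.labelFlag_swap_ne (hk : IsContraction hD hG hΓ' J k)
    (hJ : IsPieces hD hG J) {i} (hi : t i ≠ .vertex) (b : Bool) (j) :
    (J i ((hD i).leg (Residue.boolEquiv hi b))).flag.swap hG.isLoopless ≠ hG.labelFlag j := by
  intro hj
  set w := (J i ((hD i).leg (Residue.boolEquiv hi b))).flag
  set w' := (J i ((hD i).leg (Residue.boolEquiv hi !b))).flag with hw'
  let χ : G.Pt → Prop := fun x => (∃ u, x = .inl (J i u).vert) ∨ x = .inr j ∨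
    ∃ j', x = .inr j' ∧ x = (w'.swap hG.isLoopless).pt
  -- some flag of `Γ'` at a vertex does not belong to the self-energy and its external line
  obtain ⟨v⟩ := hΓ'.nonempty_V
  obtain ⟨y, -⟩ := hΓ'.exists_vflag v
  have hy : ¬ χ (k y.flag).pt := by
    have hlab : ∀ j', (k y.flag).pt ≠ .inr j' := by
      intro j' hh
      have h1 := hG.eq_labelFlag hh
      rw [← hk.label] at h1
      exact hΓ'.flag_ne_labelFlag _ _ (hk.inj h1)
    rintro (⟨u, hu⟩ | hh | ⟨j', hh, -⟩)
    · obtain ⟨x, hx, hx'⟩ := Flag.exists_vflag _ hu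
      obtain ⟨u', rfl⟩ := (hJ.isEmb i).surj x ⟨u, hx'.symm⟩
      have h1 := hk.survives y.flag
      rw [← hx] at h1
      exact hi (hJ.leg_of_survives h1).1
    · exact hlab _ hh
    · exact hlab _ hh
  have key : ∀ z : G.Flag, (z ≠ w' ∨ ∃ j', (w'.swap hG.isLoopless).pt = .inr j') → χ z.pt →
      χ (z.swap hG.isLoopless).pt := by
    rintro z hz (⟨u, hu⟩ | hh | ⟨j', hh, hh'⟩)
    · obtain ⟨x, rfl, hx'⟩ := Flag.exists_vflag _ hu
      obtain ⟨u', rfl⟩ := (hJ.isEmb i).surj x ⟨u, hx'.symm⟩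
      rcases (hD i).eq_leg_or u' with ⟨u₂, hu₂⟩ | ⟨j', rfl⟩
      · rw [(hJ.isEmb i).swap _ _ hu₂]
        exact .inl ⟨u₂, rfl⟩
      · obtain ⟨b', rfl⟩ := (Residue.boolEquiv hi).surjective j'
        by_cases hb : b' = b
        · rw [hb]
          exact .inr (.inl (by rw [hj, hG.labelFlag_pt]))
        · have hb' : b' = !b := by cases b <;> cases b' <;> simp_all
          rw [hb'] at hz ⊢
          rcases hz with hz | ⟨j', hj'⟩
          · exact absurd rfl hz
          · exact .inr (.inr ⟨j', hj', rfl⟩)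
    · rw [hG.eq_labelFlag hh, ← hj, Flag.swap_swap]
      exact .inl ⟨_, rfl⟩
    · have h1 : z = w'.swap hG.isLoopless :=
        (hG.eq_labelFlag hh).trans (hG.eq_labelFlag (hh'.symm.trans hh)).symm
      rw [h1, Flag.swap_swap]
      exact .inl ⟨_, rfl⟩
  have hcut : ∀ x y, χ x ↔ χ y := by
    cases hp : (w'.swap hG.isLoopless).pt with
    | inr j' =>
      refine hG.cut χ fun z => ⟨key z (.inr ⟨j', hp⟩), fun h => ?_⟩
      have := key _ (.inr ⟨j', hp⟩) h
      rwa [Flag.swap_swap] at this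
    | inl v =>
      refine hG.cut_of_ne w' ⟨_, rfl⟩ ⟨v, hp⟩ χ fun z hz hz' => ⟨key z (.inl hz), fun h => ?_⟩
      have := key (z.swap hG.isLoopless) (.inl fun hh => hz' (by rw [← hh, Flag.swap_swap])) h
      rwa [Flag.swap_swap] at this
  exact hy ((hcut (.inr j) _).mp (.inr (.inl rfl)))

/-- Contraction does not change the external lines. -/
theorem IsContraction.swap_labelFlag (hk : IsContraction hD hG hΓ' J k)
    (hJ : IsPieces hD hG J) (j) : k (hΓ'.leg j).flag = (hG.leg j).flag := by
  have hs : Survives hD J (hG.leg j).flag := by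
    by_cases h : ∀ i u, (hG.leg j).flag ≠ (J i u).flag
    · exact .inl h
    · push Not at h
      obtain ⟨i, u, h⟩ := h
      rcases (hD i).eq_leg_or u with ⟨u', hu'⟩ | ⟨j', rfl⟩
      · have h1 := (hJ.isEmb i).swap _ _ hu'
        rw [← h, hG.swap_leg] at h1
        exact absurd h1.symm (hG.flag_ne_labelFlag _ _)
      · by_cases hi : t i = .vertex
        · exact .inr ⟨i, hi, j', h⟩
        · obtain ⟨b, rfl⟩ := (Residue.boolEquiv hi).surjective j'
          refine absurd ?_ (hk.labelFlag_swap_ne hJ hi b j)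
          rw [← h, hG.swap_leg]
  obtain ⟨y, hy⟩ := (hk.range _).mpr hs
  have h1 : y.line = (hΓ'.labelFlag j).line := by
    rw [hk.line, hy, hk.label, ← hG.swap_leg]
    exact .rel _ _ (.inl rfl)
  rcases (Flag.line_eq_iff hΓ'.isLoopless).mp h1 with h2 | h2
  · rw [h2, hk.label] at hy
    exact absurd hy.symm (hG.flag_ne_labelFlag _ _)
  · rw [← hy, h2, hΓ'.leg_flag]

/-- The flags of `G` that correspond to the flags of the graph after insertion. -/
noncomputable def realize (hD : ∀ i, (D i).IsOnePI) (J : ∀ i, (D i).VFlag → G.VFlag)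
    (k : Γ'.Flag → G.Flag) : Rooting.InsFlag Γ' hD → G.Flag :=
  Sum.elim (fun u => (J u.1 u.2.1).flag) (Sum.elim k
    fun q => (J q.1.1 ((hD q.1.1).leg (Residue.boolEquiv q.1.2 q.2))).flag)

theorem realize_pieceFlag (p : Rooting D Γ')
    (hp : ∀ i j, k (p.leg i j).flag = (J i.1 ((hD i.1).leg j)).flag) (i) (u : (D i).VFlag) :
    realize hD J k (p.pieceFlag hD i u) = (J i u).flag := by
  rcases Rooting.vflag_cases (hD i) u with ⟨u, rfl⟩ | ⟨j, rfl⟩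
  · rw [Rooting.pieceFlag_inner]; rfl
  · rw [Rooting.pieceFlag_leg]
    by_cases hi : t i = .vertex
    · rw [p.legGlue_vertex ⟨i, hi⟩]
      exact hp ⟨i, hi⟩ j
    · rw [p.legGlue_self ⟨i, hi⟩]
      simp [realize]

/-- A vertex graph is inserted at the vertex of `Γ'` to which it is contracted, and its legs are
the lines at this vertex. -/
theorem IsContraction.exists_rooting (hk : IsContraction hD hG hΓ' J k) (hJ : IsPieces hD hG J) :
    ∃ p : Rooting D Γ', ∀ i j, k (p.leg i j).flag = (J i.1 ((hD i.1).leg j)).flag := by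
  have h1 : ∀ (i : {i // t i = .vertex}) (j : Fin (t i).numExt),
      ∃ y : Γ'.VFlag, k y.flag = (J i.1 ((hD i.1).leg j)).flag := by
    intro i j
    obtain ⟨z, hz⟩ := (hk.range _).mpr (.inr ⟨i.1, i.2, j, rfl⟩)
    rcases hΓ'.eq_labelFlag_or z with ⟨y, rfl⟩ | ⟨j', rfl⟩
    · exact ⟨y, hz⟩
    · rw [hk.label] at hz
      exact absurd hz.symm (hG.flag_ne_labelFlag _ _)
  choose leg hleg using h1
  have hN : ∀ i, 0 < (t i).numExt := fun i => lt_of_lt_of_le (by simp) (two_le_numExt (r := t i))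
  refine ⟨⟨fun i => (leg i ⟨0, hN i⟩).vert, leg, ?_, ?_, ?_, ?_⟩, hleg⟩
  · intro i i' h
    have h2 := (hk.pt (leg i ⟨0, hN i⟩).flag (leg i' ⟨0, hN i'⟩).flag).mp
      (congrArg Sum.inl h)
    rw [hleg, hleg] at h2
    apply Subtype.ext
    rcases h2 with h2 | ⟨i'', -, u, u', h3, h4⟩
    · exact hJ.disj _ _ _ _ (Sum.inl_injective h2)
    · exact (hJ.flag_eq h3).trans (hJ.flag_eq h4).symm
  · intro i j
    have h2 := (hk.pt (leg i j).flag (leg i ⟨0, hN i⟩).flag).mpr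
      (.inr ⟨i.1, i.2, _, _, hleg i j, hleg i _⟩)
    exact Sum.inl_injective h2
  · intro i j
    rw [← VFlag.flag_line, ← hk.ty, hleg, VFlag.flag_line, (hJ.isEmb _).ty, IsOnePI.leg_type]
  · intro i j j' h
    have h2 := hleg i j
    rw [h, hleg, VFlag.flag_inj, ((hJ.isEmb _).inj).eq_iff] at h2
    exact ((hD i.1).leg_injective h2).symm

section realize

variable (hk : IsContraction hD hG hΓ' J k) (hJ : IsPieces hD hG J) {p : Rooting D Γ'}
  (hp : ∀ i j, k (p.leg i j).flag = (J i.1 ((hD i.1).leg j)).flag)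

theorem IsContraction.exists_leg_of_eq (hk : IsContraction hD hG hΓ' J k) (hJ : IsPieces hD hG J)
    (hp : ∀ i j, k (p.leg i j).flag = (J i.1 ((hD i.1).leg j)).flag) {z i u}
    (h : k z = (J i u).flag) : ∃ i' j, z = (p.leg i' j).flag := by
  have h1 := hk.survives z
  rw [h] at h1
  obtain ⟨hi, j, rfl⟩ := hJ.leg_of_survives h1
  exact ⟨⟨i, hi⟩, j, hk.inj (h.trans (hp ⟨i, hi⟩ j).symm)⟩

theorem IsContraction.realize_injective (hk : IsContraction hD hG hΓ' J k)
    (hJ : IsPieces hD hG J) (hp : ∀ i j, k (p.leg i j).flag = (J i.1 ((hD i.1).leg j)).flag) :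
    Function.Injective (realize hD J k) := by
  intro z z' h
  rcases p.insFlag_cases hD z with ⟨i, u, rfl⟩ | ⟨w, hw, rfl⟩ <;>
    rcases p.insFlag_cases hD z' with ⟨i', u', rfl⟩ | ⟨w', hw', rfl⟩
  · rw [realize_pieceFlag p hp, realize_pieceFlag p hp] at h
    obtain rfl := hJ.flag_eq h
    rw [VFlag.flag_inj, ((hJ.isEmb _).inj).eq_iff] at h
    rw [h]
  · rw [realize_pieceFlag p hp] at h
    obtain ⟨i', j, h'⟩ := hk.exists_leg_of_eq hJ hp h.symm
    exact absurd h' (hw' _ _)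
  · rw [realize_pieceFlag p hp] at h
    obtain ⟨i', j, h'⟩ := hk.exists_leg_of_eq hJ hp h
    exact absurd h' (hw _ _)
  · rw [hk.inj h]

theorem IsContraction.realize_surjective (hk : IsContraction hD hG hΓ' J k)
    (hp : ∀ i j, k (p.leg i j).flag = (J i.1 ((hD i.1).leg j)).flag) :
    Function.Surjective (realize hD J k) := by
  intro z
  by_cases h : ∃ i u, z = (J i u).flag
  · obtain ⟨i, u, rfl⟩ := h
    exact ⟨_, realize_pieceFlag p hp i u⟩
  · push Not at h
    obtain ⟨y, rfl⟩ := (hk.range z).mpr (.inl h)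
    exact ⟨.inr (.inl y), rfl⟩

/-- The self-energies are inserted in the lines of `Γ'` to which they are contracted: the matching
of their legs with each other and with the flags of `Γ'` is the one by the lines of `G`. -/
theorem IsContraction.exists_gluing (hk : IsContraction hD hG hΓ' J k) (hJ : IsPieces hD hG J)
    (hp : ∀ i j, k (p.leg i j).flag = (J i.1 ((hD i.1).leg j)).flag) :
    ∃ σ : Gluing t hΓ', ∀ z,
      realize hD J k (.inr (σ.1 z)) = (realize hD J k (.inr z)).swap hG.isLoopless := by
  have hinj := hk.realize_injective hJ hp
  have hinner : ∀ u : Σ i, InnerFlag (hD i), (realize hD J k (.inl u)).swap hG.isLoopless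
      = realize hD J k (.inl ⟨u.1, u.2.swap⟩) := by
    rintro ⟨i, u⟩
    exact (hJ.isEmb i).swap _ _ u.swap_flag.symm
  have h1 : ∀ z, ∃ z', realize hD J k (.inr z') = (realize hD J k (.inr z)).swap hG.isLoopless := by
    intro z
    obtain ⟨u | z', hz⟩ := hk.realize_surjective hp ((realize hD J k (.inr z)).swap hG.isLoopless)
    · have h2 := hinner u
      rw [hz, Flag.swap_swap] at h2
      cases hinj h2
    · exact ⟨z', hz⟩
  choose σ hσ using h1
  have hinj' : Function.Injective fun z => realize hD J k (.inr z) :=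
    fun a b h => Sum.inr_injective (hinj h)
  have hlink := Rooting.linked_iff_chained (p := p) (hG := hG) (J := J) hinj' hσ fun i j => by
    rw [← p.pieceFlag_leg hD]
    exact realize_pieceFlag p hp i _
  have hσσ : ∀ z, σ (σ z) = z := fun z => hinj' (by simp only [hσ, Flag.swap_swap])
  -- no self-energy is inserted in an external line
  have hlab : ∀ j, σ (.inl (hΓ'.labelFlag j)) = .inl (hΓ'.leg j).flag := by
    intro j
    apply hinj'
    simp only [hσ]
    change (k (hΓ'.labelFlag j)).swap _ = k (hΓ'.leg j).flag
    rw [hk.label, hk.swap_labelFlag hJ, hG.leg_flag]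
  refine ⟨⟨σ, hσσ, ?_, ?_, ?_, ?_, ?_⟩, hσ⟩
  · intro z hz
    apply Flag.swap_ne hG.isLoopless (realize hD J k (.inr z))
    rw [← hσ, hz]
  · have hty : ∀ z, glueType t Γ' z = G.lineType (realize hD J k (.inr z)).line := by
      rintro (z | ⟨i, b⟩)
      · exact (hk.ty z).symm
      · change _ = G.lineType (J i ((hD i).leg (Residue.boolEquiv i.2 b))).line
        rw [(hJ.isEmb _).ty, IsOnePI.leg_type]
        rfl
    intro z
    rw [hty, hty, hσ, Flag.swap_line]
  · intro x y
    rw [← hlink]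
    refine (hk.line x y).symm.trans ?_
    rw [eq_comm, Flag.line_eq_iff hΓ'.isLoopless]
  · intro i c
    obtain ⟨z, hz⟩ := hk.legs i.1 i.2 (Residue.boolEquiv i.2 c)
    exact ⟨z, (hlink _ _).mp hz⟩
  · intro x hx
    rcases hΓ'.eq_labelFlag_or x with ⟨u, rfl⟩ | ⟨j, rfl⟩
    · rcases hΓ'.eq_labelFlag_or (u.flag.swap hΓ'.isLoopless) with ⟨u', hu'⟩ | ⟨j, hj⟩
      · exact absurd ⟨⟨_, rfl⟩, u'.vert, by rw [hu']; rfl⟩ hx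
      · have h2 : u.flag = (hΓ'.leg j).flag := by rw [hΓ'.leg_flag, ← hj, Flag.swap_swap]
        rw [h2, hΓ'.swap_leg, ← hlab, hσσ]
    · rw [hlab, hΓ'.leg_flag]

/-- Insertion at the reconstructed places gives `G` back. -/
theorem IsContraction.realize_isRealization [Fintype ι] (hk : IsContraction hD hG hΓ' J k)
    (hJ : IsPieces hD hG J) (hp : ∀ i j, k (p.leg i j).flag = (J i.1 ((hD i.1).leg j)).flag)
    {σ : Gluing t hΓ'} (hσ : ∀ z,
      realize hD J k (.inr (σ.1 z)) = (realize hD J k (.inr z)).swap hG.isLoopless) :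
    p.IsRealization hD hΓ' σ hG (realize hD J k) := by
  have hne : ∀ {w : Γ'.Flag} {i} {u : (D i).VFlag}, (∀ i j, w ≠ (p.leg i j).flag) →
      (k w).pt ≠ .inl (J i u).vert := by
    intro w i u hw hh
    obtain ⟨x, hx, hx'⟩ := Flag.exists_vflag _ hh
    obtain ⟨u', rfl⟩ := (hJ.isEmb i).surj x ⟨u, hx'.symm⟩
    obtain ⟨i', j, h⟩ := hk.exists_leg_of_eq hJ hp hx.symm
    exact hw _ _ h
  have hne' : ∀ {w : Γ'.Flag} {i v}, (∀ i j, w ≠ (p.leg i j).flag) →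
      p.insPt hD hΓ' (.inr (.inl w)) ≠ .inl (.inr ⟨i, v⟩) := by
    intro w i v hw hh
    obtain ⟨u, -, hu⟩ := p.eq_pieceFlag_of_insPt hD hΓ' hh
    obtain ⟨_, _, -, h⟩ := Rooting.exists_leg_of_eq_pieceFlag hu
    exact hw _ _ h
  refine ⟨⟨hk.realize_injective hJ hp, hk.realize_surjective hp⟩, ?_, ?_, ?_, hk.label⟩
  · intro z z'
    rcases p.insFlag_cases hD z with ⟨i, u, rfl⟩ | ⟨w, hw, rfl⟩ <;>
      rcases p.insFlag_cases hD z' with ⟨i', u', rfl⟩ | ⟨w', hw', rfl⟩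
    · rw [realize_pieceFlag p hp, realize_pieceFlag p hp, Rooting.insPt_pieceFlag,
        Rooting.insPt_pieceFlag, VFlag.flag_pt, VFlag.flag_pt, Sum.inl.injEq, Sum.inl.injEq,
        Sum.inr.injEq]
      constructor
      · intro h
        obtain rfl := hJ.disj _ _ _ _ h
        obtain ⟨f, hf, hfv⟩ := (hJ.isEmb i).onV
        rw [hfv, hfv, hf.eq_iff] at h
        rw [h]
      · intro h
        obtain ⟨rfl, h⟩ := Sigma.mk.inj_iff.mp h
        obtain ⟨f, hf, hfv⟩ := (hJ.isEmb i).onV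
        rw [hfv, hfv, eq_of_heq h]
    · rw [realize_pieceFlag p hp, Rooting.insPt_pieceFlag, VFlag.flag_pt]
      exact iff_of_false (fun h => hne hw' h.symm) (fun h => hne' hw' h.symm)
    · rw [realize_pieceFlag p hp, Rooting.insPt_pieceFlag, VFlag.flag_pt]
      exact iff_of_false (hne hw) (hne' hw)
    · have h1 : (k w).pt = (k w').pt ↔ w.pt = w'.pt := by
        rw [hk.pt]
        constructor
        · exact .inl
        · rintro (h | ⟨i, -, u, u', h, -⟩)
          · exact h
          · obtain ⟨_, _, h⟩ := hk.exists_leg_of_eq hJ hp h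
            exact absurd h (hw _ _)
      refine Iff.trans h1 ?_
      rcases p.basePt_of_not_leg hD hΓ' hw with ⟨v, hv, e1, e2⟩ | ⟨j, e1, e2⟩ <;>
        rcases p.basePt_of_not_leg hD hΓ' hw' with ⟨v', hv', e1', e2'⟩ | ⟨j', e1', e2'⟩ <;>
        · rw [e1, e1']
          change _ ↔ p.basePt hD hΓ' w = p.basePt hD hΓ' w'
          rw [e2, e2']
          simp
  · rintro (⟨i, u⟩ | z | ⟨i, b⟩)
    · exact (hJ.isEmb i).ty u.1
    · exact hk.ty z
    · change G.lineType (J i ((hD i).leg (Residue.boolEquiv i.2 b))).line = _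
      rw [(hJ.isEmb _).ty, IsOnePI.leg_type]
      rfl
  · rintro (⟨i, u⟩ | z)
    · exact ((hJ.isEmb i).swap _ _ u.swap_flag.symm).symm
    · exact hσ z

end realize

end backward

/-! ### The count of the decompositions of a graph -/

section count

variable [Fintype ι] (hD : ∀ i, (D i).IsOnePI) (hΓ' : Γ'.IsOnePI) (hG : G.IsOnePI)

/-- The decompositions of `G` in the subgraphs `D i` and the contracted graph `Γ'`, in terms of
flags. -/
abbrev Decomposition : Type :=
  {x : (∀ i, (D i).VFlag → G.VFlag) × (Γ'.Flag → G.Flag) //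
    IsPieces hD hG x.1 ∧ IsContraction hD hG hΓ' x.1 x.2}

variable (G) in
/-- The realizations of `G` as the graph after an insertion. -/
abbrev Realization : Type :=
  Σ q : Rooting D Γ' × Gluing t hΓ', Iso (q.1.insertion hD hΓ' q.2).diagram G

/-- The central bijection: to write `G` as the result of an insertion in `Γ'` is the same as to
find disjoint subgraphs of `G` whose contraction is `Γ'`. -/
theorem card_realization_eq :
    Nat.card (Realization G hD hΓ') = Nat.card (Decomposition hD hΓ' hG) := by
  have hreal : ∀ x : Realization G hD hΓ', x.1.1.IsRealization hD hΓ' x.1.2 hG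
      (x.2.onFlag (x.1.1.insertion hD hΓ' x.1.2).isPresentation) :=
    fun x => Rooting.isRealization_onFlag x.2
  choose J hJ using fun x : Realization G hD hΓ' => (hreal x).exists_piece
  refine Nat.card_congr (Equiv.ofBijective (fun x => ⟨(J x, fun z =>
    x.2.onFlag (x.1.1.insertion hD hΓ' x.1.2).isPresentation (.inr (.inl z))),
    (hreal x).isPieces (hJ x), (hreal x).isContraction (hJ x)⟩) ⟨?_, ?_⟩)
  · intro x x' hxx
    simp only [Subtype.mk.injEq, Prod.mk.injEq] at hxx
    obtain ⟨h1, h2⟩ := hxx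
    have hx := hreal x
    have hx' := hreal x'
    have hJx := hJ x
    have hJx' := hJ x'
    rw [← h1] at hJx'
    obtain ⟨⟨p, σ⟩, φ⟩ := x
    obtain ⟨⟨p', σ'⟩, φ'⟩ := x'
    dsimp only at hx hx' hJx hJx' h2
    have hk := hx.isContraction hJx
    -- the roots and legs are determined by the legs of the vertex graphs in `G`
    have hpp : p = p' := by
      have hleg : ∀ i j, p.leg i j = p'.leg i j := by
        intro i j
        rw [← VFlag.flag_inj]
        apply hk.inj
        have e1 := hJx i.1 ((hD i.1).leg j)
        have e2 := hJx' i.1 ((hD i.1).leg j)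
        rw [Rooting.pieceFlag_leg, Rooting.legGlue_vertex] at e1 e2
        exact e1.symm.trans (e2.trans (congrFun h2 (p'.leg i j).flag).symm)
      have hroot : ∀ i, p.root i = p'.root i := by
        intro i
        have hN : 0 < (t i.1).numExt := lt_of_lt_of_le (by simp) (two_le_numExt (r := t i.1))
        rw [← p.leg_vert i ⟨0, hN⟩, ← p'.leg_vert i ⟨0, hN⟩, hleg]
      obtain ⟨root, leg, _, _, _, _⟩ := p
      obtain ⟨root', leg', _, _, _, _⟩ := p'
      obtain rfl : root = root' := funext hroot
      obtain rfl : leg = leg' := funext fun i => funext (hleg i)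
      rfl
    subst hpp
    have hH : ∀ z : Rooting.InsFlag Γ' hD, φ.onFlag (p.insertion hD hΓ' σ).isPresentation z
        = φ'.onFlag (p.insertion hD hΓ' σ').isPresentation z := by
      intro z
      rcases p.insFlag_cases hD z with ⟨i, u, rfl⟩ | ⟨w, -, rfl⟩
      · exact (hJx i u).symm.trans (hJx' i u)
      · exact congrFun h2 w
    have hσ : σ = σ' := by
      apply Subtype.ext
      funext z
      have e1 := hx.swap (.inr z)
      have e2 := hx'.swap (.inr z)
      have e3 := (hH (.inr (σ.1 z))).symm.trans
        (e1.trans ((congrArg (Flag.swap hG.isLoopless) (hH (.inr z))).trans e2.symm))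
      exact Sum.inr_injective (hx'.bij.1 e3)
    subst hσ
    rw [Rooting.onFlag_injective_of_insertion (funext hH)]
  · rintro ⟨⟨J', k⟩, hJ', hk⟩
    dsimp only at hJ' hk
    obtain ⟨p, hp⟩ := hk.exists_rooting hJ'
    obtain ⟨σ, hσ⟩ := hk.exists_gluing hJ' hp
    obtain ⟨φ, hφ⟩ := (hk.realize_isRealization hJ' hp hσ).exists_iso
    refine ⟨⟨(p, σ), φ⟩, Subtype.ext (Prod.ext ?_ ?_)⟩
    · funext i u
      rw [← VFlag.flag_inj, hJ]
      exact (congrFun hφ _).trans (realize_pieceFlag p hp i u)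
    · funext z
      exact congrFun hφ (.inr (.inl z))

/-- The decompositions of `G` in subgraphs that are isomorphic to the `D i`, for some labelling, and
a contracted graph that is isomorphic to `Γ'`. -/
abbrev SubgraphDecomposition (D : ∀ i, Diagram (t i)) (Γ' : Diagram r) (G : Diagram r) : Type :=
  Σ S : {S : ι → Finset G.V // Pairwise fun i i' => Disjoint (S i) (S i')},
    (∀ i, EmbIso (D i) G (S.1 i)) × Iso (G.contract (pieceSet S.1)) Γ'

/-- The subgraphs and the isomorphisms of a decomposition are determined by their effect on flags.
-/
theorem card_subgraphDecomposition_eq :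
    Nat.card (SubgraphDecomposition D Γ' G) = Nat.card (Decomposition hD hΓ' hG) := by
  have hJ : ∀ x : SubgraphDecomposition D Γ' G, IsPieces hD hG fun i => (x.2.1 i).onVFlag hG := by
    rintro ⟨⟨S, hS⟩, x, φ⟩
    refine ⟨fun i => (x i).isEmb (hD i) hG, fun i i' u u' h => ?_⟩
    by_contra hne
    refine Finset.disjoint_left.mp (hS hne) (((x i).mem_iff hG (hD i) _).mpr ⟨u, rfl⟩)
      (((x i').mem_iff hG (hD i') _).mpr ⟨u', h.symm⟩)
  have hS : ∀ x : SubgraphDecomposition D Γ' G, ∀ i v,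
      v ∈ x.1.1 i ↔ ∃ u, ((x.2.1 i).onVFlag hG u).vert = v :=
    fun x i v => (x.2.1 i).mem_iff hG (hD i) v
  refine Nat.card_congr (Equiv.ofBijective (fun x => ⟨(fun i => (x.2.1 i).onVFlag hG,
    x.2.2.lift hG hΓ'), hJ x, (hJ x).lift_isContraction hΓ' (hS x) x.2.2⟩) ⟨?_, ?_⟩)
  · intro x x' hxx
    simp only [Subtype.mk.injEq, Prod.mk.injEq] at hxx
    obtain ⟨h1, h2⟩ := hxx
    have hx := hJ x
    have hSx := hS x
    have hSx' := hS x'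
    obtain ⟨⟨S, hd⟩, x, φ⟩ := x
    obtain ⟨⟨S', hd'⟩, x', φ'⟩ := x'
    dsimp only at h1 h2 hSx hSx' hx
    have hSS : S = S' := by
      funext i
      ext v
      rw [hSx, hSx', congrFun h1 i]
    subst hSS
    have hxx : x = x' := funext fun i => EmbIso.onVFlag_injective hG (hD i) (congrFun h1 i)
    subst hxx
    rw [hx.lift_injective hΓ' hSx h2]
  · rintro ⟨⟨J, k⟩, hJ, hk⟩
    classical
    dsimp only at hJ hk
    let S : ι → Finset G.V := fun i => Finset.univ.filter fun v => ∃ u, (J i u).vert = v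
    have hS : ∀ i v, v ∈ S i ↔ ∃ u, (J i u).vert = v := by
      intro i v
      simp [S]
    choose x hx using fun i => (hJ.isEmb i).exists_embIso (hD i) hG (hS i)
    obtain ⟨φ, hφ⟩ := hk.exists_iso hΓ' hJ hS
    refine ⟨⟨⟨S, fun i i' hne => Finset.disjoint_left.mpr fun v hv hv' =>
      hne (hJ.eq_of_mem hS hv hv')⟩, x, φ⟩, Subtype.ext (Prod.ext (funext hx) hφ)⟩

end count

end Diagram

end QED

namespace QED

/-! ### The number of insertion places for self-energies -/

section gluingCount

variable {B κ : Type}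

/-- The flags before the self-energy `none` is inserted. -/
def emb : B ⊕ κ × Bool → B ⊕ Option κ × Bool := Sum.map id (Prod.map some id)

theorem emb_injective : Function.Injective (emb (B := B) (κ := κ)) := by
  rintro (x | ⟨i, c⟩) (x' | ⟨i', c'⟩) h <;> simp_all [emb]

theorem emb_ne_none (a : B ⊕ κ × Bool) (b) : emb a ≠ .inr (none, b) := by
  rcases a with x | ⟨i, c⟩ <;> simp [emb]

theorem emb_cases (z : B ⊕ Option κ × Bool) : (∃ a, z = emb a) ∨ ∃ b, z = .inr (none, b) := by
  rcases z with x | ⟨_ | i, c⟩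
  · exact .inl ⟨.inl x, rfl⟩
  · exact .inr ⟨c, rfl⟩
  · exact .inl ⟨.inr (i, c), rfl⟩

open scoped Classical in
/-- The self-energy `none` is inserted in the line of the flag `y`, with the leg `true` at this
flag. -/
noncomputable def insertAt (σ : B ⊕ κ × Bool → B ⊕ κ × Bool) (y : B ⊕ κ × Bool) :
    B ⊕ Option κ × Bool → B ⊕ Option κ × Bool :=
  let step : B ⊕ κ × Bool → B ⊕ Option κ × Bool := fun a =>
    if a = y then .inr (none, true) else if a = σ y then .inr (none, false) else emb (σ a)
  Sum.elim (fun x => step (.inl x)) fun q => match q with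
    | (some i, b) => step (.inr (i, b))
    | (none, true) => emb y
    | (none, false) => emb (σ y)

section

variable (σ : B ⊕ κ × Bool → B ⊕ κ × Bool) (y : B ⊕ κ × Bool)

open scoped Classical in
theorem insertAt_emb (a) : insertAt σ y (emb a) =
    if a = y then .inr (none, true) else if a = σ y then .inr (none, false) else emb (σ a) := by
  rcases a with x | ⟨i, c⟩ <;> rfl

theorem insertAt_self : insertAt σ y (emb y) = .inr (none, true) := by
  rw [insertAt_emb, if_pos rfl]

variable {σ y} in
theorem insertAt_match (hne : σ y ≠ y) : insertAt σ y (emb (σ y)) = .inr (none, false) := by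
  rw [insertAt_emb, if_neg hne, if_pos rfl]

variable {σ y} in
theorem insertAt_of_ne {a} (h1 : a ≠ y) (h2 : a ≠ σ y) : insertAt σ y (emb a) = emb (σ a) := by
  rw [insertAt_emb, if_neg h1, if_neg h2]

theorem insertAt_true : insertAt σ y (.inr (none, true)) = emb y := rfl

theorem insertAt_false : insertAt σ y (.inr (none, false)) = emb (σ y) := rfl

variable {σ y}

theorem insertAt_involutive (hσ : ∀ z, σ (σ z) = z) (hne : ∀ z, σ z ≠ z) (z) :
    insertAt σ y (insertAt σ y z) = z := by
  rcases emb_cases z with ⟨a, rfl⟩ | ⟨_ | _, rfl⟩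
  · by_cases h1 : a = y
    · rw [h1, insertAt_self, insertAt_true]
    by_cases h2 : a = σ y
    · rw [h2, insertAt_match (hne y), insertAt_false]
    rw [insertAt_of_ne h1 h2, insertAt_of_ne, hσ]
    · intro h; exact h2 (by rw [← h, hσ])
    · intro h; exact h1 (by rw [← hσ a, h, hσ])
  · rw [insertAt_false, insertAt_match (hne y)]
  · rw [insertAt_true, insertAt_self]

theorem insertAt_ne (hne : ∀ z, σ z ≠ z) (z) : insertAt σ y z ≠ z := by
  rcases emb_cases z with ⟨a, rfl⟩ | ⟨_ | _, rfl⟩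
  · by_cases h1 : a = y
    · rw [h1, insertAt_self]; exact (emb_ne_none _ _).symm
    by_cases h2 : a = σ y
    · rw [h2, insertAt_match (hne y)]; exact (emb_ne_none _ _).symm
    rw [insertAt_of_ne h1 h2, emb_injective.ne_iff]
    exact hne a
  · rw [insertAt_false]; exact emb_ne_none _ _
  · rw [insertAt_true]; exact emb_ne_none _ _

/-- The inserted self-energy becomes a part of the chain of the line in which it is inserted. -/
theorem chained_insertAt_iff (hσ : ∀ z, σ (σ z) = z) (hne : ∀ z, σ z ≠ z) (a b) :
    Relation.EqvGen (Chained (insertAt σ y)) (emb a) (emb b) ↔ Relation.EqvGen (Chained σ) a b := by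
  have hy : Relation.EqvGen (Chained (insertAt σ y)) (emb y) (emb (σ y)) :=
    .trans _ _ _ (.rel _ _ (.inl (insertAt_self σ y).symm))
      (.trans _ _ _ (.rel _ _ (.inr ⟨none, true, false, rfl, rfl⟩))
        (.rel _ _ (.inl (insertAt_false σ y).symm)))
  constructor
  · -- the retraction that sends each leg to the flag at which it is inserted
    let ρ : B ⊕ Option κ × Bool → B ⊕ κ × Bool := Sum.elim .inl fun q => match q with
      | (some i, b) => .inr (i, b)
      | (none, true) => y
      | (none, false) => σ y
    have hρ : ∀ a, ρ (emb a) = a := by rintro (x | ⟨i, c⟩) <;> rfl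
    suffices ∀ z z', Relation.EqvGen (Chained (insertAt σ y)) z z' →
        Relation.EqvGen (Chained σ) (ρ z) (ρ z') by
      intro h
      have := this _ _ h
      rwa [hρ, hρ] at this
    have hyy : Relation.EqvGen (Chained σ) y (σ y) := .rel _ _ (.inl rfl)
    intro z z' h
    induction h with
    | rel z z' h =>
      rcases h with rfl | ⟨i, c, c', rfl, rfl⟩
      · rcases emb_cases z with ⟨a, rfl⟩ | ⟨_ | _, rfl⟩
        · rw [hρ]
          by_cases h1 : a = y
          · rw [h1, insertAt_self]; exact .refl _
          by_cases h2 : a = σ y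
          · rw [h2, insertAt_match (hne y)]; exact .refl _
          rw [insertAt_of_ne h1 h2, hρ]
          exact .rel _ _ (.inl rfl)
        · rw [insertAt_false, hρ]; exact .refl _
        · rw [insertAt_true, hρ]; exact .refl _
      · rcases i with _ | i
        · rcases c with _ | _ <;> rcases c' with _ | _
          · exact .refl _
          · exact hyy.symm
          · exact hyy
          · exact .refl _
        · exact .rel _ _ (.inr ⟨i, c, c', rfl, rfl⟩)
    | refl => exact .refl _
    | symm _ _ _ ih => exact ih.symm
    | trans _ _ _ _ _ ih1 ih2 => exact ih1.trans _ _ _ ih2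
  · intro h
    induction h with
    | rel a b h =>
      rcases h with rfl | ⟨i, c, c', rfl, rfl⟩
      · by_cases h1 : a = y
        · rw [h1]; exact hy
        by_cases h2 : a = σ y
        · rw [h2, hσ]; exact hy.symm
        exact .rel _ _ (.inl (insertAt_of_ne h1 h2).symm)
      · exact .rel _ _ (.inr ⟨some i, c, c', rfl, rfl⟩)
    | refl => exact .refl _
    | symm _ _ _ ih => exact ih.symm
    | trans _ _ _ _ _ ih1 ih2 => exact ih1.trans _ _ _ ih2

/-- The place of an insertion is the flag that is matched with the leg `true`, and the matching
before insertion is recovered by the removal of both legs. -/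
theorem insertAt_inj {σ' : B ⊕ κ × Bool → B ⊕ κ × Bool} {y'} (hσ : ∀ z, σ (σ z) = z)
    (hσ' : ∀ z, σ' (σ' z) = z) (h : insertAt σ y = insertAt σ' y') : σ = σ' ∧ y = y' := by
  have hy : y = y' := emb_injective (congrFun h (.inr (none, true)))
  subst hy
  have h1 : σ y = σ' y := emb_injective (congrFun h (.inr (none, false)))
  refine ⟨funext fun a => ?_, rfl⟩
  by_cases ha : a = y
  · rw [ha, h1]
  by_cases ha' : a = σ y
  · rw [ha', hσ, h1, hσ']
  have h2 := congrFun h (emb a)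
  rw [insertAt_of_ne ha ha', insertAt_of_ne ha (h1 ▸ ha')] at h2
  exact emb_injective h2

end

/-- The flags at which a self-energy of type `τ` can be inserted. -/
def Allowed (O : B → Prop) (ty : B ⊕ κ × Bool → LineType) (τ : LineType) (y : B ⊕ κ × Bool) :
    Prop :=
  (∀ x, y = .inl x → O x) ∧ ty y = τ

variable {s : B → B} {O : B → Prop} {ty : B ⊕ Option κ × Bool → LineType}

theorem IsInsertion.insertAt {σ : B ⊕ κ × Bool → B ⊕ κ × Bool}
    (h : IsInsertion s O (ty ∘ emb) σ) (hs : ∀ x, s (s x) = x) (hO : ∀ x, O x → O (s x))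
    (hty : ty (.inr (none, true)) = ty (.inr (none, false))) {y}
    (hy : Allowed O (ty ∘ emb) (ty (.inr (none, true))) y) :
    IsInsertion s O ty (insertAt σ y) := by
  have hyt : ty (emb y) = ty (.inr (none, true)) := hy.2
  have hyf : ty (emb (σ y)) = ty (.inr (none, true)) := (h.ty y).trans hyt
  have hO' : ∀ x, σ y = .inl x → O x := by
    intro x hx
    by_contra hn
    have h1 := h.ext x hn
    rw [← hx, h.invol] at h1
    have h2 := hO _ (hy.1 _ h1)
    rw [hs] at h2
    exact hn h2
  refine ⟨insertAt_involutive h.invol h.ne, insertAt_ne h.ne, ?_, ?_, ?_, ?_⟩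
  · intro z
    rcases emb_cases z with ⟨a, rfl⟩ | ⟨_ | _, rfl⟩
    · by_cases h1 : a = y
      · rw [h1, insertAt_self, hyt]
      by_cases h2 : a = σ y
      · rw [h2, insertAt_match (h.ne y), hyf, hty]
      rw [insertAt_of_ne h1 h2]
      exact h.ty a
    · rw [insertAt_false, hyf, hty]
    · rw [insertAt_true, hyt]
  · intro x x'
    rw [← h.base]
    exact chained_insertAt_iff h.invol h.ne (.inl x) (.inl x')
  · have h1 : ∀ a, ∃ x, Relation.EqvGen (Chained (QED.insertAt σ y)) (emb a) (.inl x) := by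
      intro a
      obtain ⟨x, hx⟩ := h.exists_base a
      exact ⟨x, (chained_insertAt_iff h.invol h.ne a (.inl x)).mpr hx⟩
    rintro (_ | i) c
    · rcases c with _ | _
      · obtain ⟨x, hx⟩ := h1 (σ y)
        exact ⟨x, .trans _ _ _ (.rel _ _ (.inl (insertAt_false σ y).symm)) hx⟩
      · obtain ⟨x, hx⟩ := h1 y
        exact ⟨x, .trans _ _ _ (.rel _ _ (.inl (insertAt_true σ y).symm)) hx⟩
    · exact h1 (.inr (i, c))
  · intro x hx
    have h1 : (.inl x : B ⊕ κ × Bool) ≠ y := fun hh => hx (hy.1 x hh.symm)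
    have h2 : (.inl x : B ⊕ κ × Bool) ≠ σ y := fun hh => hx (hO' x hh.symm)
    have h3 := insertAt_of_ne h1 h2
    rw [h.ext x hx] at h3
    exact h3

/-- Every matching of the flags after insertion results from the insertion of the self-energy
`none` in one of the lines. -/
theorem IsInsertion.exists_insertAt {σ : B ⊕ Option κ × Bool → B ⊕ Option κ × Bool}
    (h : IsInsertion s O ty σ) (hty : ty (.inr (none, true)) = ty (.inr (none, false))) :
    ∃ σ₁ y, IsInsertion s O (ty ∘ emb) σ₁ ∧
      Allowed O (ty ∘ emb) (ty (.inr (none, true))) y ∧ QED.insertAt σ₁ y = σ := by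
  -- the two legs are not matched with each other, as they are in the chain of a flag of `B`
  have htf : σ (.inr (none, true)) ≠ .inr (none, false) := by
    intro hh
    have hh' : σ (.inr (none, false)) = .inr (none, true) := by rw [← hh, h.invol]
    obtain ⟨x, hx⟩ := h.reach none true
    have := (EqvGen.iff_of_invariant (p := fun z => ∃ c, z = .inr (none, c)) ?_ hx).mp ⟨true, rfl⟩
    · obtain ⟨c, hc⟩ := this
      cases hc
    · have hall : ∀ c, ∃ c', σ (.inr (none, c)) = .inr (none, c') := by
        rintro (_ | _)
        · exact ⟨_, hh'⟩
        · exact ⟨_, hh⟩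
      rintro y z (rfl | ⟨i', c, c', rfl, rfl⟩)
      · constructor
        · rintro ⟨c, rfl⟩
          exact hall c
        · rintro ⟨c, hc⟩
          obtain ⟨c', hc'⟩ := hall c
          exact ⟨c', by rw [← hc', ← hc, h.invol]⟩
      · simp
  obtain ⟨y, hy⟩ : ∃ y, σ (.inr (none, true)) = emb y := by
    rcases emb_cases (σ (.inr (none, true))) with h1 | ⟨_ | _, h1⟩
    · exact h1
    · exact absurd h1 htf
    · exact absurd h1 (h.ne _)
  obtain ⟨y', hy'⟩ : ∃ y', σ (.inr (none, false)) = emb y' := by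
    rcases emb_cases (σ (.inr (none, false))) with h1 | ⟨_ | _, h1⟩
    · exact h1
    · exact absurd h1 (h.ne _)
    · exact absurd (by rw [← h1, h.invol]) htf
  have hσy : σ (emb y) = .inr (none, true) := by rw [← hy, h.invol]
  have hσy' : σ (emb y') = .inr (none, false) := by rw [← hy', h.invol]
  have hyy' : y ≠ y' := by
    rintro rfl
    rw [hσy] at hσy'
    cases hσy'
  have hstep : ∀ a, ∃ a', (a = y ∧ a' = y') ∨ (a = y' ∧ a' = y) ∨
      (a ≠ y ∧ a ≠ y' ∧ σ (emb a) = emb a') := by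
    intro a
    by_cases h1 : a = y
    · exact ⟨y', .inl ⟨h1, rfl⟩⟩
    by_cases h2 : a = y'
    · exact ⟨y, .inr (.inl ⟨h2, rfl⟩)⟩
    rcases emb_cases (σ (emb a)) with ⟨a', h3⟩ | ⟨_ | _, h3⟩
    · exact ⟨a', .inr (.inr ⟨h1, h2, h3⟩)⟩
    · exact absurd (emb_injective (by rw [← hy', ← h3, h.invol])) h2
    · exact absurd (emb_injective (by rw [← hy, ← h3, h.invol])) h1
  choose σ₁ hσ₁ using hstep
  have h1y : σ₁ y = y' := by rcases hσ₁ y with h1 | h1 | h1 <;> tauto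
  have h1y' : σ₁ y' = y := by rcases hσ₁ y' with h1 | h1 | h1 <;> tauto
  have h1o : ∀ a, a ≠ y → a ≠ y' → σ (emb a) = emb (σ₁ a) := by
    intro a h2 h3
    rcases hσ₁ a with h1 | h1 | h1 <;> tauto
  have hinv : ∀ a, σ₁ (σ₁ a) = a := by
    intro a
    by_cases h2 : a = y
    · rw [h2, h1y, h1y']
    by_cases h3 : a = y'
    · rw [h3, h1y', h1y]
    apply emb_injective
    rw [← h1o, ← h1o a h2 h3, h.invol]
    · intro h4
      have h5 := h1o a h2 h3
      rw [h4, ← hy, (Function.LeftInverse.injective h.invol).eq_iff] at h5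
      exact emb_ne_none _ _ h5
    · intro h4
      have h5 := h1o a h2 h3
      rw [h4, ← hy', (Function.LeftInverse.injective h.invol).eq_iff] at h5
      exact emb_ne_none _ _ h5
  have hne : ∀ a, σ₁ a ≠ a := by
    intro a
    by_cases h2 : a = y
    · rw [h2, h1y]; exact hyy'.symm
    by_cases h3 : a = y'
    · rw [h3, h1y']; exact hyy'
    intro h4
    have h5 := h1o a h2 h3
    rw [h4] at h5
    exact h.ne _ h5
  have heq : QED.insertAt σ₁ y = σ := by
    funext z
    rcases emb_cases z with ⟨a, rfl⟩ | ⟨_ | _, rfl⟩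
    · by_cases h2 : a = y
      · rw [h2, insertAt_self, hσy]
      by_cases h3 : a = y'
      · rw [h3, ← h1y, insertAt_match (hne y), h1y, hσy']
      rw [insertAt_of_ne h2 (h1y ▸ h3), h1o a h2 h3]
    · rw [insertAt_false, h1y, hy']
    · rw [insertAt_true, hy]
  refine ⟨σ₁, y, ⟨hinv, hne, ?_, ?_, ?_, ?_⟩, ⟨?_, ?_⟩, heq⟩
  · intro a
    have e1 : ty (emb y) = ty (.inr (none, true)) := by rw [← hy, h.ty]
    have e2 : ty (emb y') = ty (.inr (none, false)) := by rw [← hy', h.ty]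
    by_cases h2 : a = y
    · rw [h2, h1y, Function.comp_apply, Function.comp_apply, e1, e2, hty]
    by_cases h3 : a = y'
    · rw [h3, h1y', Function.comp_apply, Function.comp_apply, e1, e2, hty]
    rw [Function.comp_apply, ← h1o a h2 h3, h.ty]
    rfl
  · intro x x'
    rw [← h.base, ← heq]
    exact (chained_insertAt_iff hinv hne (.inl x) (.inl x')).symm
  · intro i c
    obtain ⟨x, hx⟩ := h.reach (some i) c
    rw [← heq] at hx
    exact ⟨x, (chained_insertAt_iff hinv hne (.inr (i, c)) (.inl x)).mp hx⟩
  · intro x hx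
    have h1 := h.ext x hx
    have h2 : (.inl x : B ⊕ κ × Bool) ≠ y := by
      rintro rfl
      change σ (.inl x) = _ at hσy
      rw [hσy] at h1
      cases h1
    have h3 : (.inl x : B ⊕ κ × Bool) ≠ y' := by
      rintro rfl
      change σ (.inl x) = _ at hσy'
      rw [hσy'] at h1
      cases h1
    apply emb_injective
    rw [← h1o _ h2 h3]
    exact h1
  · rintro x rfl
    by_contra hx
    have h1 := h.ext x hx
    change σ (.inl x) = _ at hσy
    rw [hσy] at h1
    cases h1
  · rw [Function.comp_apply, ← hy, h.ty]

/-- A matching after insertion of one more self-energy is a matching before insertion together with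
a flag at which the new self-energy is inserted. -/
theorem card_insertion_option (hs : ∀ x, s (s x) = x)
    (hO : ∀ x, O x → O (s x))
    (hty : ty (.inr (none, true)) = ty (.inr (none, false))) :
    Nat.card {σ // IsInsertion s O ty σ} =
      Nat.card {σ : B ⊕ κ × Bool → B ⊕ κ × Bool // IsInsertion s O (ty ∘ emb) σ} *
        Nat.card {y : B ⊕ κ × Bool // Allowed O (ty ∘ emb) (ty (.inr (none, true))) y} := by
  rw [← Nat.card_prod]
  refine (Nat.card_congr (Equiv.ofBijective
    (fun q => ⟨insertAt q.1.1 q.2.1, q.1.2.insertAt hs hO hty q.2.2⟩) ⟨?_, ?_⟩)).symm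
  · rintro ⟨⟨σ, hσ⟩, ⟨y, hy⟩⟩ ⟨⟨σ', hσ'⟩, ⟨y', hy'⟩⟩ h
    obtain ⟨rfl, rfl⟩ := insertAt_inj hσ.invol hσ'.invol (congrArg Subtype.val h)
    rfl
  · rintro ⟨σ, hσ⟩
    obtain ⟨σ₁, y, h1, h2, h3⟩ := hσ.exists_insertAt hty
    exact ⟨(⟨σ₁, h1⟩, ⟨y, h2⟩), Subtype.ext h3⟩

end gluingCount

section gluingCount

variable {B κ κ' : Type} {s : B → B} {O : B → Prop}

/-- The flags after a renaming of the self-energies. -/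
def flagCongr (e : κ ≃ κ') : B ⊕ κ × Bool ≃ B ⊕ κ' × Bool :=
  Equiv.sumCongr (Equiv.refl B) (Equiv.prodCongr e (Equiv.refl Bool))

theorem IsInsertion.congr (e : κ ≃ κ') {ty : B ⊕ κ' × Bool → LineType}
    {σ : B ⊕ κ × Bool → B ⊕ κ × Bool} (h : IsInsertion s O (ty ∘ flagCongr e) σ) :
    IsInsertion s O ty (flagCongr e ∘ σ ∘ (flagCongr e).symm) := by
  have hch : ∀ a b, Relation.EqvGen (Chained (flagCongr e ∘ σ ∘ (flagCongr e).symm))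
      (flagCongr e a) (flagCongr e b) ↔ Relation.EqvGen (Chained σ) a b := by
    refine EqvGen.iff_of_embedding (flagCongr e).injective ?_ ?_ ?_
    · rintro a b (rfl | ⟨i, c, c', rfl, rfl⟩)
      · exact .inl (by simp)
      · exact .inr ⟨e i, c, c', rfl, rfl⟩
    · rintro a y (rfl | ⟨i, c, c', ha, rfl⟩)
      · exact ⟨σ a, by simp, .inl rfl⟩
      · refine ⟨.inr (e.symm i, c'), by simp [flagCongr], .inr ⟨e.symm i, c, c', ?_, rfl⟩⟩
        apply (flagCongr e).injective
        rw [ha]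
        simp [flagCongr]
    · rintro y b (hb | ⟨i, c, c', rfl, hb⟩)
      · obtain ⟨a, rfl⟩ := (flagCongr e).surjective y
        refine ⟨a, rfl, .inl ((flagCongr e).injective ?_)⟩
        rw [hb]
        simp
      · refine ⟨.inr (e.symm i, c), by simp [flagCongr], .inr ⟨e.symm i, c, c', rfl, ?_⟩⟩
        apply (flagCongr e).injective
        rw [hb]
        simp [flagCongr]
  refine ⟨?_, ?_, ?_, ?_, ?_, ?_⟩
  · intro z
    simp [h.invol]
  · intro z
    obtain ⟨a, rfl⟩ := (flagCongr e).surjective z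
    simpa using h.ne a
  · intro z
    obtain ⟨a, rfl⟩ := (flagCongr e).surjective z
    simpa using h.ty a
  · intro x y
    rw [← h.base, ← hch]
    rfl
  · intro i c
    obtain ⟨x, hx⟩ := h.reach (e.symm i) c
    refine ⟨x, ?_⟩
    rw [← hch] at hx
    simpa [flagCongr] using hx
  · intro x hx
    change flagCongr e (σ (.inl x)) = _
    rw [h.ext x hx]
    rfl

theorem card_insertion_congr (e : κ ≃ κ')
    (ty : B ⊕ κ' × Bool → LineType) :
    Nat.card {σ // IsInsertion s O (ty ∘ flagCongr e) σ} =
      Nat.card {σ // IsInsertion s O ty σ} := by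
  refine Nat.card_congr (Equiv.ofBijective (fun σ => ⟨_, σ.2.congr e⟩) ⟨?_, ?_⟩)
  · rintro ⟨σ, _⟩ ⟨σ', _⟩ h
    apply Subtype.ext
    funext a
    have := congrFun (congrArg Subtype.val h) (flagCongr e a)
    simpa using this
  · rintro ⟨σ, hσ⟩
    have h1 : IsInsertion s O ((ty ∘ flagCongr e) ∘ flagCongr e.symm) σ := by
      convert hσ
      funext z
      rcases z with x | ⟨i, c⟩ <;> simp [flagCongr]
    refine ⟨⟨_, h1.congr e.symm⟩, Subtype.ext (funext fun z => ?_)⟩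
    have h2 : ∀ z, flagCongr (B := B) e (flagCongr e.symm z) = z := by
      rintro (x | ⟨i, c⟩) <;> simp [flagCongr]
    have h3 : ∀ z, (flagCongr (B := B) e.symm).symm ((flagCongr e).symm z) = z := by
      rintro (x | ⟨i, c⟩) <;> simp [flagCongr]
    simp [h2, h3]

theorem card_subtype_option {κ : Type} [Finite κ] (f : Option κ → LineType) (t : LineType) :
    Nat.card {i // f i = t} = Nat.card {i : κ // f (some i) = t} + if f none = t then 1 else 0 := by
  classical
  have := Fintype.ofFinite κ
  rw [Nat.card_eq_fintype_card, Nat.card_eq_fintype_card, Fintype.card_subtype,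
    Fintype.card_subtype, Finset.card_filter, Finset.card_filter, Fintype.sum_option, add_comm]

/-- Self-energies are inserted one after the other, and each insertion in a line adds a line of the
same type. -/
theorem card_insertion [Finite B] [Finite κ] (hs : ∀ x, s (s x) = x) (hO : ∀ x, O x → O (s x))
    (ty : B ⊕ κ × Bool → LineType) (hty : ∀ i c c', ty (.inr (i, c)) = ty (.inr (i, c')))
    (hsn : ∀ x, s x ≠ x) (htys : ∀ x, ty (.inl (s x)) = ty (.inl x)) :
    Nat.card {σ // IsInsertion s O ty σ} = ∏ t : LineType,
      ∏ j ∈ Finset.range (Nat.card {i : κ // ty (.inr (i, true)) = t}),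
        (Nat.card {x : B // O x ∧ ty (.inl x) = t} + 2 * j) := by
  classical
  revert ty
  induction κ using Finite.induction_empty_option with
  | of_equiv e ih =>
    rename_i α β
    intro ty hty htys
    rw [← card_insertion_congr e ty, ih (ty ∘ flagCongr e) (fun i c c' => hty (e i) c c') htys]
    refine Finset.prod_congr rfl fun t _ => ?_
    congr 2
    exact Nat.card_congr (e.subtypeEquiv fun i => Iff.rfl)
  | h_empty =>
    intro ty hty htys
    simp only [Nat.card_of_isEmpty, Finset.range_zero, Finset.prod_empty, Finset.prod_const_one]
    have hex : ∀ z : B ⊕ PEmpty × Bool, ∃ x, z = .inl x := by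
      rintro (x | ⟨i, _⟩)
      · exact ⟨x, rfl⟩
      · exact i.elim
    rw [Nat.card_eq_one_iff_unique]
    constructor
    · constructor
      rintro ⟨σ, hσ⟩ ⟨σ', hσ'⟩
      have key : ∀ (σ : B ⊕ PEmpty × Bool → B ⊕ PEmpty × Bool), IsInsertion s O ty σ →
          ∀ x, σ (.inl x) = .inl (s x) := by
        intro σ hσ x
        obtain ⟨y, hy⟩ := hex (σ (.inl x))
        have h1 := (hσ.base x y).mp (by rw [← hy]; exact .rel _ _ (.inl rfl))
        rcases h1 with rfl | rfl
        · exact absurd hy (hσ.ne _)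
        · exact hy
      apply Subtype.ext
      funext z
      obtain ⟨x, rfl⟩ := hex z
      dsimp only
      rw [key σ hσ, key σ' hσ']
    · refine ⟨⟨Sum.map s id, ?_, ?_, ?_, ?_, ?_, ?_⟩⟩
      · rintro (x | ⟨i, _⟩)
        · simp [hs]
        · exact i.elim
      · rintro (x | ⟨i, _⟩)
        · simpa using hsn x
        · exact i.elim
      · rintro (x | ⟨i, _⟩)
        · exact htys x
        · exact i.elim
      · intro x y
        constructor
        · intro h
          have := (EqvGen.iff_of_invariant
            (p := fun z : B ⊕ PEmpty × Bool => z = .inl x ∨ z = .inl (s x)) ?_ h).mp (.inl rfl)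
          · simpa using this
          · rintro a b (rfl | ⟨i, _⟩)
            · obtain ⟨z, rfl⟩ := hex a
              simp only [Sum.map_inl, Sum.inl.injEq]
              constructor
              · rintro (rfl | rfl)
                · exact .inr rfl
                · exact .inl (hs x)
              · rintro (h | h)
                · right; rw [← h, hs]
                · left; rw [← hs z, h, hs]
            · exact i.elim
        · rintro (rfl | rfl)
          · exact .refl _
          · exact .rel _ _ (.inl rfl)
      · intro i
        exact i.elim
      · intro x _
        rfl
  | h_option ih =>
    rename_i α hα
    intro ty hty htys
    rw [card_insertion_option hs hO (hty none true false),
      ih (ty ∘ emb) (fun i c c' => hty (some i) c c') htys]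
    have hallowed : Nat.card {y : B ⊕ α × Bool //
        Allowed O (ty ∘ emb) (ty (.inr (none, true))) y} =
        Nat.card {x : B // O x ∧ ty (.inl x) = ty (.inr (none, true))} +
          2 * Nat.card {i : α // ty (.inr (some i, true)) = ty (.inr (none, true))} := by
      have e : {y : B ⊕ α × Bool // Allowed O (ty ∘ emb) (ty (.inr (none, true))) y} ≃
          {x : B // O x ∧ ty (.inl x) = ty (.inr (none, true))} ⊕
            {i : α // ty (.inr (some i, true)) = ty (.inr (none, true))} × Bool :=
        { toFun := fun y => match y with
            | ⟨.inl x, h⟩ => .inl ⟨x, h.1 x rfl, h.2⟩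
            | ⟨.inr (i, c), h⟩ => .inr (⟨i, (hty (some i) true c).trans h.2⟩, c)
          invFun := fun y => match y with
            | .inl x => ⟨.inl x.1, ⟨fun x' h => Sum.inl_injective h ▸ x.2.1, x.2.2⟩⟩
            | .inr (i, c) => ⟨.inr (i.1, c), ⟨fun x' h => (Sum.inr_ne_inl h).elim,
                (hty (some i.1) c true).trans i.2⟩⟩
          left_inv := by rintro ⟨x | ⟨i, c⟩, h⟩ <;> rfl
          right_inv := by rintro (x | ⟨i, c⟩) <;> rfl }
      rw [Nat.card_congr e, Nat.card_sum, Nat.card_prod, Nat.card_eq_fintype_card (α := Bool),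
        Fintype.card_bool, mul_comm]
    rw [hallowed]
    have hsplit := card_subtype_option (fun i : Option α => ty (.inr (i, true)))
    rw [← Finset.mul_prod_erase _ _ (Finset.mem_univ (ty (.inr (none, true)))),
      ← Finset.mul_prod_erase _ _ (Finset.mem_univ (ty (.inr (none, true)))), hsplit, if_pos rfl,
      Finset.prod_range_succ]
    have herase : ∀ t ∈ Finset.univ.erase (ty (.inr (none, true))),
        (∏ j ∈ Finset.range (Nat.card {i : Option α // ty (.inr (i, true)) = t}),
          (Nat.card {x : B // O x ∧ ty (.inl x) = t} + 2 * j))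
        = ∏ j ∈ Finset.range (Nat.card {i : α // ty (.inr (some i, true)) = t}),
          (Nat.card {x : B // O x ∧ ty (.inl x) = t} + 2 * j) := by
      intro t ht
      rw [hsplit, if_neg (Finset.ne_of_mem_erase ht).symm, add_zero]
    rw [Finset.prod_congr rfl herase]
    change (∏ j ∈ _, _) * (∏ t ∈ _, _) * _ = _
    simp only [Function.comp_apply, emb, Sum.map_inl, Sum.map_inr, Prod.map_apply, id]
    ring

end gluingCount

end QED

namespace QED

/-- The number of vertices and of internal lines of each type in a vertex graph with `L` loops. -/
def vertexCounts (L : ℕ) : Residue → ℕ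
  | .vertex => 2 * L + 1
  | .electron => 2 * L
  | .photon => L

/-- The numbers of vertices and of internal lines of a vertex graph or an electron self-energy. -/
def graphCounts : Residue → ℕ → Residue → ℕ
  | .vertex => vertexCounts
  | _ => electronCounts

/-! ### The number of insertion places -/

namespace Diagram

variable {r : Residue} {Γ' : Diagram r}

theorem vec_injective {α : Type*} {a b c : α} (h1 : c ≠ a) (h2 : c ≠ b) (h3 : a ≠ b) :
    Function.Injective ![c, a, b] := by
  intro j j' h
  fin_cases j <;> fin_cases j' <;> simp_all [eq_comm]

/-- A vertex has two electron flags and one photon flag, just as a vertex graph has external lines.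
-/
theorem IsOnePI.exists_typed_legs (hΓ' : Γ'.IsOnePI) {r' : Residue} (hr : r' = .vertex) (w : Γ'.V) :
    ∃ leg : Fin r'.numExt → Γ'.VFlag, (∀ j, (leg j).vert = w) ∧
      (∀ j, Γ'.lineType (leg j).line = r'.extType j) ∧ Function.Injective leg := by
  subst hr
  obtain ⟨a, b, hab, -⟩ := Nat.card_eq_two_iff.mp (hΓ'.card_vflag w .electron)
  obtain ⟨⟨c⟩⟩ := (Nat.card_pos_iff.mp (by
    rw [hΓ'.card_vflag w .photon]; simp [LineType.mult])).1
  have hca : c ≠ a.1 := fun h => by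
    have h1 := a.2.2
    rw [← h] at h1
    have h2 := h1.symm.trans (by assumption : _ ∧ _).2
    cases h2
  have hcb : c ≠ b.1 := fun h => by
    have h1 := b.2.2
    rw [← h] at h1
    have h2 := h1.symm.trans (by assumption : _ ∧ _).2
    cases h2
  have hab' : a.1 ≠ b.1 := fun h => hab (Subtype.ext h)
  refine ⟨![c, a.1, b.1], ?_, ?_, ?_⟩
  · intro j
    fin_cases j
    · exact (by assumption : _ ∧ _).1
    · exact a.2.1
    · exact b.2.1
  · intro j
    fin_cases j
    · exact (by assumption : _ ∧ _).2
    · exact a.2.2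
    · exact b.2.2
  · exact vec_injective hca hcb hab'

/-- The identifications of the external lines of a vertex graph with the lines at a vertex. -/
abbrev RootedLegs (r' : Residue) (Γ' : Diagram r) (w : Γ'.V) : Type :=
  {leg : Fin r'.numExt → Γ'.VFlag // (∀ j, (leg j).vert = w) ∧
      (∀ j, Γ'.lineType (leg j).line = r'.extType j) ∧ Function.Injective leg}

/-- The identifications differ by the exchange of the two electron lines. -/
theorem IsOnePI.card_rootedLegs (hΓ' : Γ'.IsOnePI) {r' : Residue} (hr : r' = .vertex) (w : Γ'.V) :
    Nat.card (RootedLegs r' Γ' w) = 2 := by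
  obtain ⟨leg, hv, ht, hinj⟩ := hΓ'.exists_typed_legs hr w
  rw [← card_typed_perm r']
  refine (Nat.card_congr (Equiv.ofBijective (fun π => ⟨leg ∘ π.1, fun j => hv _, fun j => by
    rw [Function.comp_apply, ht, π.2], hinj.comp π.1.injective⟩) ⟨?_, ?_⟩)).symm
  · intro π π' h
    apply Subtype.ext
    ext1 j
    exact hinj (congrFun (congrArg Subtype.val h) j)
  · rintro ⟨leg', hv', ht', hinj'⟩
    choose π hπ using fun j => hΓ'.exists_eq_of_injective hr hv hinj (hv' j)
    have hπi : Function.Injective π := fun j j' h => hinj' (by rw [← hπ, ← hπ, h])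
    refine ⟨⟨Equiv.ofBijective π (Finite.injective_iff_bijective.mp hπi), fun j => ?_⟩,
      Subtype.ext (funext hπ)⟩
    rw [← ht, ← ht', ← hπ]
    rfl

variable {ι : Type} [Fintype ι] {t : ι → Residue} {D : ∀ i, Diagram (t i)}

/-- Different vertices are chosen for the vertex graphs, and for each of them one of two
identifications of the external lines. -/
theorem card_rooting (hΓ' : Γ'.IsOnePI) : Nat.card (Rooting D Γ') =
    (Fintype.card Γ'.V).descFactorial (Nat.card {i // t i = .vertex}) *
      2 ^ Nat.card {i // t i = .vertex} := by
  classical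
  let e : Rooting D Γ' ≃ Σ root : {i // t i = .vertex} ↪ Γ'.V,
      ∀ i : {i // t i = .vertex}, RootedLegs (t i) Γ' (root i) :=
    { toFun := fun p => ⟨⟨p.root, p.root_inj⟩, fun i =>
        ⟨p.leg i, p.leg_vert i, p.leg_ty i, p.leg_inj i⟩⟩
      invFun := fun x => ⟨x.1, fun i => (x.2 i).1, x.1.injective, fun i => (x.2 i).2.1,
        fun i => (x.2 i).2.2.1, fun i => (x.2 i).2.2.2⟩
      left_inv := fun p => rfl
      right_inv := fun x => rfl }
  rw [Nat.card_congr e, Nat.card_sigma]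
  have h1 : ∀ root : {i // t i = .vertex} ↪ Γ'.V,
      Nat.card (∀ i : {i // t i = .vertex}, RootedLegs (t i) Γ' (root i))
        = 2 ^ Nat.card {i // t i = .vertex} := by
    intro root
    rw [Nat.card_pi, Finset.prod_congr rfl fun i _ => hΓ'.card_rootedLegs i.2 (root i),
      Finset.prod_const, Finset.card_univ, Nat.card_eq_fintype_card]
  rw [Finset.sum_congr rfl fun root _ => h1 root, Finset.sum_const, Finset.card_univ,
    Fintype.card_embedding_eq, smul_eq_mul, Nat.card_eq_fintype_card]

/-- Flags at vertices belong to internal or external lines. -/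
theorem IsOnePI.card_internal (h : Γ'.IsOnePI) (s : LineType) :
    Nat.card {x : Γ'.Flag // x.IsInternal h.isLoopless ∧ Γ'.lineType x.line = s} +
      Nat.card {j // r.extType j = s} = Fintype.card Γ'.V * s.mult := by
  have e1 : Nat.card {z : Γ'.Flag // (∃ v, z.pt = .inl v) ∧ Γ'.lineType z.line = s}
      = Fintype.card Γ'.V * s.mult := by
    have e : (Σ v, {u : Γ'.VFlag // u.vert = v ∧ Γ'.lineType u.line = s}) ≃
        {z : Γ'.Flag // (∃ v, z.pt = .inl v) ∧ Γ'.lineType z.line = s} :=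
      Equiv.ofBijective (fun x => ⟨x.2.1.flag, ⟨_, rfl⟩, x.2.2.2⟩) <| by
        constructor
        · rintro ⟨v, u, rfl, hu⟩ ⟨v', u', rfl, hu'⟩ hh
          have : u = u' := by simpa using hh
          subst this
          rfl
        · rintro ⟨z, ⟨v, hv⟩, hz⟩
          obtain ⟨u, rfl, rfl⟩ := z.exists_vflag hv
          exact ⟨⟨_, u, rfl, hz⟩, rfl⟩
    rw [← Nat.card_congr e, Nat.card_sigma, Finset.sum_congr rfl fun v _ => h.card_vflag v s,
      Finset.sum_const, Finset.card_univ, smul_eq_mul]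
  rw [← e1, ← Nat.card_sum]
  refine Nat.card_congr (Equiv.ofBijective (Sum.elim (fun x => ⟨x.1, x.2.1.1, x.2.2⟩)
    fun j => ⟨(h.leg j.1).flag, ⟨_, rfl⟩, (h.leg_type j.1).trans j.2⟩) ⟨?_, ?_⟩)
  · have hne : ∀ (x : Γ'.Flag) j, x.IsInternal h.isLoopless → x ≠ (h.leg j).flag := by
      rintro x j hx rfl
      obtain ⟨v, hv⟩ := hx.2
      rw [h.swap_leg, h.labelFlag_pt] at hv
      cases hv
    rintro (x | j) (x' | j') hh
    · have : x.1 = x'.1 := by simpa using hh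
      rw [Subtype.ext this]
    · exact absurd (by simpa using hh) (hne x.1 j'.1 x.2.1)
    · exact absurd (by simpa using hh.symm) (hne x'.1 j.1 x'.2.1)
    · have h1 : (h.leg j.1).flag = (h.leg j'.1).flag := by simpa using hh
      rw [VFlag.flag_inj] at h1
      rw [Subtype.ext (h.leg_injective h1)]
  · rintro ⟨z, ⟨v, hv⟩, hz⟩
    obtain ⟨u, rfl, rfl⟩ := z.exists_vflag hv
    rcases h.eq_leg_or u with ⟨u', hu'⟩ | ⟨j, rfl⟩
    · exact ⟨.inl ⟨u.flag, ⟨⟨_, rfl⟩, _, congrArg Flag.pt hu'⟩, hz⟩, rfl⟩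
    · exact ⟨.inr ⟨j, (h.leg_type j).symm.trans hz⟩, rfl⟩

theorem extType_eq_electron_iff {r : Residue} (h : r ≠ .vertex) (j : Fin r.numExt) :
    r.extType j = .electron ↔ r = .electron := by
  revert j
  cases r <;> first | exact absurd rfl h | decide

theorem extType_eq_photon_iff {r : Residue} (h : r ≠ .vertex) (j : Fin r.numExt) :
    r.extType j = .photon ↔ r = .photon := by
  revert j
  cases r <;> first | exact absurd rfl h | decide

theorem prod_range_two_mul_add (m n : ℕ) :
    ∏ j ∈ Finset.range n, (2 * m + 2 * j) = 2 ^ n * m.ascFactorial n := by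
  rw [Nat.ascFactorial_eq_prod_range, ← Finset.card_range n, ← Finset.prod_const,
    Finset.card_range, ← Finset.prod_mul_distrib]
  exact Finset.prod_congr rfl fun j _ => by ring

/-- The number of ways to insert the `D i` in `Γ'`: each component contributes a factor `2`, for the
two labellings of its external lines. -/
theorem card_rooting_mul_card_gluing (hΓ' : Γ'.IsOnePI) (m : Residue → ℕ)
    (hv : Fintype.card Γ'.V = m .vertex)
    (he : 2 * m .electron + Nat.card {j // r.extType j = .electron} = 2 * Fintype.card Γ'.V)
    (hp : 2 * m .photon + Nat.card {j // r.extType j = .photon} = Fintype.card Γ'.V)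
    (γ : GraphUnion) (hγ : ∀ s, γ.num s = Nat.card {i // t i = s}) :
    Nat.card (Rooting D Γ' × Gluing t hΓ') = 2 ^ Fintype.card ι * insertionPlaces m γ := by
  classical
  have hO : ∀ x : Γ'.Flag, x.IsInternal hΓ'.isLoopless →
      (x.swap hΓ'.isLoopless).IsInternal hΓ'.isLoopless := by
    rintro x ⟨h1, h2⟩
    exact ⟨h2, by rwa [Flag.swap_swap]⟩
  have hg := card_insertion (B := Γ'.Flag) (κ := {i // t i ≠ .vertex})
    (s := Flag.swap hΓ'.isLoopless) (O := Flag.IsInternal hΓ'.isLoopless)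
    (fun x => Flag.swap_swap _) hO (glueType t Γ')
    (fun i c c' => extType_eq_of_ne_vertex i.2 _ _) (fun x => x.swap_ne _)
    (fun x => by simp [glueType])
  have hie := hΓ'.card_internal .electron
  have hip := hΓ'.card_internal .photon
  simp only [LineType.mult] at hie hip
  have hie' : Nat.card {x : Γ'.Flag // x.IsInternal hΓ'.isLoopless ∧
      glueType t Γ' (.inl x) = .electron} = 2 * m .electron := by
    change Nat.card {x : Γ'.Flag // x.IsInternal hΓ'.isLoopless ∧
      Γ'.lineType x.line = .electron} = _
    lia
  have hip' : Nat.card {x : Γ'.Flag // x.IsInternal hΓ'.isLoopless ∧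
      glueType t Γ' (.inl x) = .photon} = 2 * m .photon := by
    change Nat.card {x : Γ'.Flag // x.IsInternal hΓ'.isLoopless ∧
      Γ'.lineType x.line = .photon} = _
    lia
  have hne : Nat.card {i : {i // t i ≠ .vertex} // glueType t Γ' (.inr (i, true)) = .electron}
      = γ.num .electron := by
    rw [hγ]
    refine Nat.card_congr ((Equiv.subtypeSubtypeEquivSubtypeExists _ _).trans
      (Equiv.subtypeEquivRight fun i => ?_))
    constructor
    · rintro ⟨h1, h2⟩
      exact (extType_eq_electron_iff h1 _).mp h2
    · intro h
      have h1 : t i ≠ .vertex := by rw [h]; simp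
      exact ⟨h1, (extType_eq_electron_iff h1 _).mpr h⟩
  have hnp : Nat.card {i : {i // t i ≠ .vertex} // glueType t Γ' (.inr (i, true)) = .photon}
      = γ.num .photon := by
    rw [hγ]
    refine Nat.card_congr ((Equiv.subtypeSubtypeEquivSubtypeExists _ _).trans
      (Equiv.subtypeEquivRight fun i => ?_))
    constructor
    · rintro ⟨h1, h2⟩
      exact (extType_eq_photon_iff h1 _).mp h2
    · intro h
      have h1 : t i ≠ .vertex := by rw [h]; simp
      exact ⟨h1, (extType_eq_photon_iff h1 _).mpr h⟩
  have huniv : (Finset.univ : Finset LineType) = {.electron, .photon} := rfl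
  rw [huniv, Finset.prod_pair (by simp), hie', hip', hne, hnp, prod_range_two_mul_add,
    prod_range_two_mul_add] at hg
  have hcard : Fintype.card ι = γ.num .vertex + γ.num .electron + γ.num .photon := by
    simp only [hγ, Nat.card_eq_fintype_card, Fintype.card_subtype]
    rw [← Finset.card_univ, Finset.card_eq_sum_card_fiberwise (f := t) (t := Finset.univ)
      (fun _ _ => Finset.mem_coe.mpr (Finset.mem_univ _))]
    have : (Finset.univ : Finset Residue) = {.vertex, .electron, .photon} := rfl
    rw [this, Finset.sum_insert (by simp), Finset.sum_pair (by simp)]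
    ring
  rw [Nat.card_prod, card_rooting hΓ', hg, ← hγ, hv, hcard, insertionPlaces,
    Nat.descFactorial_eq_factorial_mul_choose, Nat.ascFactorial_eq_factorial_mul_choose',
    Nat.ascFactorial_eq_factorial_mul_choose']
  ring

theorem card_vertex_electron : Nat.card {j // Residue.vertex.extType j = .electron} = 2 := by
  rw [Nat.card_eq_fintype_card, Fintype.card_subtype]
  rfl

theorem card_vertex_photon : Nat.card {j // Residue.vertex.extType j = .photon} = 1 := by
  rw [Nat.card_eq_fintype_card, Fintype.card_subtype]
  rfl

theorem card_electron_electron : Nat.card {j // Residue.electron.extType j = .electron} = 2 := by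
  rw [Nat.card_eq_fintype_card, Fintype.card_subtype]
  rfl

theorem card_electron_photon : Nat.card {j // Residue.electron.extType j = .photon} = 0 := by
  rw [Nat.card_eq_fintype_card, Fintype.card_subtype]
  rfl

/-- The number of insertions depends on `Γ'` only through its residue and its loop number, which
determine the numbers of its vertices and lines. -/
theorem card_insertions (hr : r ≠ .photon) (hΓ' : Γ'.IsOnePI) (γ : GraphUnion)
    (hγ : ∀ s, γ.num s = Nat.card {i // t i = s}) :
    Nat.card (Rooting D Γ' × Gluing t hΓ') =
      2 ^ Fintype.card ι * insertionPlaces (graphCounts r Γ'.loops) γ := by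
  have hV := hΓ'.card_V
  have hL := hΓ'.not_tree
  have h1 := card_vertex_electron
  have h2 := card_vertex_photon
  have h3 := card_electron_electron
  have h4 := card_electron_photon
  refine card_rooting_mul_card_gluing hΓ' _ ?_ ?_ ?_ γ hγ
  all_goals
    cases r
    · simp only [graphCounts, vertexCounts]
      simp only [Residue.numExt] at hV
      lia
    · simp only [graphCounts, electronCounts]
      simp only [Residue.numExt] at hV
      lia
    · exact absurd rfl hr

end Diagram

end QED

namespace QED

/-! ### Disjoint unions of families of graphs -/

namespace GraphUnion

/-- The disjoint union of a family of 1PI graphs. -/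
noncomputable def ofFamily {ι : Type} [Fintype ι] (c : ι → OnePI) : GraphUnion :=
  ∑ i, Finsupp.single (c i) 1

theorem exists_ofFamily (γ : GraphUnion) : ∃ (n : ℕ) (c : Fin n → OnePI), ofFamily c = γ := by
  induction γ using Finsupp.induction_linear with
  | zero => exact ⟨0, Fin.elim0, by simp [ofFamily]⟩
  | add γ γ' h h' =>
    obtain ⟨n, c, rfl⟩ := h
    obtain ⟨n', c', rfl⟩ := h'
    exact ⟨n + n', Fin.append c c', by simp [ofFamily, Fin.sum_univ_add]⟩
  | single g n => exact ⟨n, fun _ => g, by simp [ofFamily]⟩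

variable {ι : Type} [Fintype ι] (c : ι → OnePI)

theorem ofFamily_apply (g : OnePI) : ofFamily c g = Nat.card {i // c i = g} := by
  classical
  rw [Nat.card_eq_fintype_card, Fintype.card_subtype, ofFamily, Finsupp.finsetSum_apply,
    Finset.card_filter]
  exact Finset.sum_congr rfl fun i _ => Finsupp.single_apply

theorem num_ofFamily (s : Residue) : (ofFamily c).num s = Nat.card {i // (c i).res = s} := by
  classical
  rw [Nat.card_eq_fintype_card, Fintype.card_subtype, num, ofFamily,
    ← Finsupp.sum_finsetSum_index (by simp) (by intros; split_ifs <;> rfl), Finset.card_filter]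
  exact Finset.sum_congr rfl fun i _ => by simp

theorem loops_ofFamily : (ofFamily c).loops = ∑ i, (c i).loops := by
  rw [loops, ofFamily, ← Finsupp.sum_finsetSum_index (by simp) (by intros; ring)]
  exact Finset.sum_congr rfl fun i _ => by simp

theorem sym_ofFamily : (ofFamily c).sym =
    ((ofFamily c).prod fun _ n => n.factorial) * ∏ i, (c i).sym := by
  rw [sym, Finsupp.prod_mul]
  congr 1
  rw [ofFamily, ← Finsupp.prod_finsetSum_index (by simp) (by intros; ring)]
  exact Finset.prod_congr rfl fun i _ => by simp

/-- The orderings of the members of a family of graphs that agree with a given one are a torsor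
under the permutations of equal members. -/
theorem card_orderings {α : Type} [Fintype α] (f : α → OnePI)
    [Decidable (ofFamily f = ofFamily c)] :
    Nat.card {e : ι ≃ α // ∀ i, f (e i) = c i} =
      if ofFamily f = ofFamily c then (ofFamily c).prod fun _ n => n.factorial else 0 := by
  classical
  split_ifs with h
  · have h1 : ∀ g, Nonempty ({i // c i = g} ≃ {a // f a = g}) := by
      intro g
      have := DFunLike.congr_fun h g
      rw [ofFamily_apply, ofFamily_apply] at this
      exact (Finite.card_eq.mp this.symm)
    let e₀ : ι ≃ α := Equiv.ofFiberEquiv fun g => (h1 g).some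
    have h2 : ∀ i, f (e₀ i) = c i := Equiv.ofFiberEquiv_map _
    have h3 : {e : ι ≃ α // ∀ i, f (e i) = c i} ≃ {π : Equiv.Perm ι // c ∘ π = c} :=
      Equiv.subtypeEquiv ⟨fun e => e.trans e₀.symm, fun e => e.trans e₀,
          fun e => by ext; simp, fun e => by ext; simp⟩ fun e => by
        rw [funext_iff]
        refine forall_congr' fun i => ?_
        simp [← h2]
    rw [Nat.card_congr h3, Nat.card_eq_fintype_card, DomMulAct.stabilizer_card', Finsupp.prod]
    have h4 : (ofFamily c).support = Finset.univ.image c := by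
      ext g
      simp [ofFamily_apply, Fintype.card_eq_zero_iff]
    rw [h4]
    exact Finset.prod_congr rfl fun g _ => by rw [ofFamily_apply, Nat.card_eq_fintype_card]
  · have : IsEmpty {e : ι ≃ α // ∀ i, f (e i) = c i} := by
      refine ⟨fun ⟨e, he⟩ => h ?_⟩
      rw [ofFamily, ofFamily, ← e.sum_comp]
      simp [he]
    exact Nat.card_of_isEmpty

end GraphUnion

namespace Diagram

variable {r : Residue}

open scoped Classical in
/-- The isomorphisms with a representative of an isomorphism class are a torsor under its
automorphisms, if there are any. -/
theorem card_iso_out (D : Diagram r) (q : Quotient (onePISetoid r)) :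
    Nat.card (Iso q.out.1 D) =
      if ∃ h : D.IsOnePI, (⟦⟨D, h⟩⟧ : Quotient (onePISetoid r)) = q then q.out.1.sym else 0 := by
  split_ifs with h
  · obtain ⟨h, rfl⟩ := h
    obtain ⟨φ⟩ := Quotient.mk_out (s := onePISetoid r) ⟨D, h⟩
    exact (Iso.card_eq_right φ _).symm
  · refine @Nat.card_of_isEmpty _ ⟨fun φ => h ?_⟩
    have hD := φ.isOnePI q.out.2
    refine ⟨hD, ?_⟩
    conv_rhs => rw [← Quotient.out_eq q]
    exact Quotient.sound ⟨φ.symm⟩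

open scoped Classical in
theorem card_iso_out' (D : Diagram r) (q : Quotient (onePISetoid r)) :
    Nat.card (Iso D q.out.1) =
      if ∃ h : D.IsOnePI, (⟦⟨D, h⟩⟧ : Quotient (onePISetoid r)) = q then q.out.1.sym else 0 := by
  rw [← card_iso_out]
  exact Nat.card_congr ⟨Iso.symm, Iso.symm, fun _ => rfl, fun _ => rfl⟩

/-- The embeddings of a graph with image `S` are counted by the labellings of `S` that give this
graph, each with a torsor of isomorphisms under the automorphisms. -/
theorem card_embIso (G : Diagram r) (S : Finset G.V) (g : OnePI) :
    Nat.card (EmbIso g.graph G S) = g.sym * Nat.card {l : G.Labelling S // l.cls = g} := by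
  classical
  obtain ⟨r', q⟩ := g
  have e : {l : G.Labelling S // l.cls = ⟨r', q⟩} ≃
      {lam : {e // G.IsBoundary S e} ≃ Fin r'.numExt //
        ∃ h : (G.sub S r' lam).IsOnePI, (⟦⟨_, h⟩⟧ : Quotient (onePISetoid r')) = q} := by
    symm
    refine Equiv.ofBijective (fun x => ⟨⟨r', x.1, x.2.fst⟩, congrArg (Sigma.mk r') x.2.snd⟩)
      ⟨?_, ?_⟩
    · rintro ⟨x, hx⟩ ⟨x', hx'⟩ h
      have h2 := congrArg Subtype.val (eq_of_heq (Sigma.mk.inj (congrArg Subtype.val h)).2)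
      exact Subtype.ext h2
    · rintro ⟨⟨r'', lam, h⟩, hl⟩
      obtain rfl : r'' = r' := congrArg Sigma.fst hl
      exact ⟨⟨lam, h, eq_of_heq (Sigma.mk.inj hl).2⟩, rfl⟩
  rw [Nat.card_congr e, Nat.card_sigma]
  change ∑ lam, Nat.card (Iso q.out.1 (G.sub S r' lam)) = _
  simp only [card_iso_out, Nat.card_eq_fintype_card, Fintype.card_subtype, Finset.card_filter,
    Finset.mul_sum]
  refine Finset.sum_congr rfl fun _ _ => ?_
  split_ifs
  · exact (mul_one _).symm
  · exact (mul_zero _).symm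

end Diagram

end QED

namespace QED

namespace Diagram

variable {r : Residue}

/-! ### The element of the Hopf algebra given by a subgraph -/

section coeff

variable (k : Type*) [Field k] [CharZero k] {G : Diagram r}

/-- A component of a subgraph has two labellings, so that the average of the non-isomorphic
labelled graphs is also the average over the labellings. -/
theorem componentToH_eq (hG : G.IsOnePI) {S : Finset G.V} (hS : Nonempty (G.Labelling S)) :
    G.componentToH k S = (2 : k)⁻¹ • ∑ l : G.Labelling S, MvPolynomial.X l.cls := by
  classical
  obtain ⟨l⟩ := hS
  have h := card_labelling hG l
  rw [Nat.card_eq_fintype_card, ← Finset.card_univ] at h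
  obtain ⟨a, b, hab, h⟩ := Finset.card_eq_two.mp h
  have h2 : G.labelled S = {a.cls, b.cls} := by
    unfold labelled
    rw [h, Finset.image_insert, Finset.image_singleton]
  rw [componentToH, h2, h, Finset.sum_pair hab]
  by_cases hc : a.cls = b.cls
  · rw [hc, Finset.pair_eq_singleton, Finset.card_singleton, Finset.sum_singleton, Nat.cast_one,
      inv_one, one_smul, ← two_smul k, smul_smul, inv_mul_cancel₀ two_ne_zero, one_smul]
  · rw [Finset.card_pair hc, Finset.sum_pair hc, Nat.cast_two]

open scoped Classical in
/-- Expansion of the product over the components: the coefficient of `γ` counts the labellings of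
the components that give `γ`, with weight `2⁻¹` for each component. -/
theorem coeff_subgraphToH_eq (hG : G.IsOnePI) {A : Finset (Finset G.V)}
    (hA : ∀ S ∈ A, Nonempty (G.Labelling S)) (γ : GraphUnion) :
    MvPolynomial.coeff γ (G.subgraphToH k A) = (2 : k)⁻¹ ^ A.card *
      Nat.card {p : ∀ S : A, G.Labelling S // GraphUnion.ofFamily (fun S => (p S).cls) = γ} := by
  have h1 : G.subgraphToH k A = (2 : k)⁻¹ ^ A.card •
      ∑ p : ∀ S : A, G.Labelling S, MvPolynomial.monomial
        (GraphUnion.ofFamily fun S => (p S).cls) 1 := by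
    rw [subgraphToH, Finset.prod_congr rfl fun S hS => componentToH_eq k hG (hA S hS),
      ← Finset.prod_coe_sort]
    simp only [MvPolynomial.smul_eq_C_mul]
    rw [Finset.prod_mul_distrib, Finset.prod_const, Finset.prod_univ_sum, Fintype.piFinset_univ,
      Finset.card_univ, Fintype.card_coe, map_pow]
    congr 1
    refine Finset.sum_congr rfl fun p _ => ?_
    exact (MvPolynomial.monomial_sum_one _ _).symm
  rw [h1, MvPolynomial.coeff_smul, MvPolynomial.coeff_sum, smul_eq_mul, Nat.card_eq_fintype_card,
    Fintype.card_subtype, Finset.card_filter, Nat.cast_sum]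
  congr 1
  refine Finset.sum_congr rfl fun p _ => ?_
  rw [MvPolynomial.coeff_monomial]
  split_ifs <;> simp

open scoped Classical in
/-- The coefficient of a disjoint union of 1PI graphs in a subgraph is given by the number of ways
to embed these graphs as the components of the subgraph. -/
theorem coeff_subgraphToH_mul (hG : G.IsOnePI) {A : Finset (Finset G.V)}
    (hA : ∀ S ∈ A, Nonempty (G.Labelling S)) {ι : Type} [Fintype ι] (c : ι → OnePI) :
    MvPolynomial.coeff (GraphUnion.ofFamily c) (G.subgraphToH k A) *
        (2 ^ Fintype.card ι * (GraphUnion.ofFamily c).sym) =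
      ((∑ e : ι ≃ A, ∏ i, Nat.card (EmbIso (c i).graph G (e i)) : ℕ) : k) := by
  -- the labellings of the components, together with an assignment of the members of the family to
  -- them, are counted in two orders
  have key : ((GraphUnion.ofFamily c).prod fun _ n => n.factorial) *
      Nat.card {p : ∀ S : A, G.Labelling S // GraphUnion.ofFamily (fun S => (p S).cls) =
        GraphUnion.ofFamily c} =
      ∑ e : ι ≃ A, ∏ i, Nat.card {l : G.Labelling (e i) // l.cls = c i} := by
    have h1 : Nat.card (Σ p : ∀ S : A, G.Labelling S, {e : ι ≃ A // ∀ i, (p (e i)).cls = c i}) =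
        Nat.card (Σ e : ι ≃ A, {p : ∀ S : A, G.Labelling S // ∀ i, (p (e i)).cls = c i}) :=
      Nat.card_congr ⟨fun x => ⟨x.2.1, x.1, x.2.2⟩, fun x => ⟨x.2.1, x.1, x.2.2⟩, fun _ => rfl,
        fun _ => rfl⟩
    rw [Nat.card_sigma, Nat.card_sigma] at h1
    have h2 : ∀ p : ∀ S : A, G.Labelling S, Nat.card {e : ι ≃ A // ∀ i, (p (e i)).cls = c i} = _ :=
      fun p => GraphUnion.card_orderings c fun S => (p S).cls
    have h3 : ∀ e : ι ≃ A, Nat.card {p : ∀ S : A, G.Labelling S // ∀ i, (p (e i)).cls = c i} =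
        ∏ i, Nat.card {l : G.Labelling (e i) // l.cls = c i} := by
      intro e
      rw [← Nat.card_pi]
      refine Nat.card_congr (Equiv.trans ?_ (Equiv.subtypePiEquivPi
        (p := fun i (l : G.Labelling (e i)) => l.cls = c i)))
      exact Equiv.subtypeEquiv (Equiv.piCongrLeft' _ e.symm) fun p => Iff.rfl
    rw [Finset.sum_congr rfl fun p _ => h2 p, Finset.sum_congr rfl fun e _ => h3 e] at h1
    rw [← h1, Nat.card_eq_fintype_card, Fintype.card_subtype, Finset.card_filter, Finset.mul_sum]
    exact Finset.sum_congr rfl fun p _ => by split_ifs <;> simp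
  have h4 : ∀ e : ι ≃ A, ∏ i, Nat.card (EmbIso (c i).graph G (e i)) =
      (∏ i, (c i).sym) * ∏ i, Nat.card {l : G.Labelling (e i) // l.cls = c i} := by
    intro e
    rw [← Finset.prod_mul_distrib]
    exact Finset.prod_congr rfl fun i _ => card_embIso G _ _
  rw [Finset.sum_congr rfl fun e _ => h4 e, ← Finset.mul_sum, ← key, coeff_subgraphToH_eq k hG hA,
    GraphUnion.sym_ofFamily]
  by_cases hcard : Fintype.card ι = A.card
  · rw [hcard]
    generalize Nat.card {p : ∀ S : A, G.Labelling S // _} = N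
    generalize ((GraphUnion.ofFamily c).prod fun _ n => n.factorial) = F
    generalize ∏ i, (c i).sym = P
    push_cast
    have h5 : (2 : k)⁻¹ ^ A.card * 2 ^ A.card = 1 := by
      rw [← mul_pow, inv_mul_cancel₀ two_ne_zero, one_pow]
    linear_combination (P * F * N : k) * h5
  · have : IsEmpty (ι ≃ A) := ⟨fun e => hcard (by simpa using Fintype.card_congr e)⟩
    rw [Finset.univ_eq_empty, Finset.sum_empty] at key
    have h6 := (mul_eq_zero.mp key).resolve_left
      (Finset.prod_ne_zero_iff.mpr fun g _ => Nat.factorial_ne_zero _)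
    rw [h6]
    simp

end coeff

open scoped Classical in
/-- The decompositions of `G` in the family `D` and `Γ'` are distributed over the proper subgraphs
in the coproduct of `G`. All of `G` does not occur as a component, since it contracts to a graph
with at most one vertex. -/
theorem card_subgraphDecomposition_eq_sum {G Γ' : Diagram r} (hΓ' : Γ'.IsOnePI)
    {ι : Type} [Fintype ι] [Nonempty ι] {t : ι → Residue} {D : ∀ i, Diagram (t i)}
    (hD : ∀ i, (D i).IsOnePI) :
    Nat.card (SubgraphDecomposition D Γ' G) = ∑ A ∈ G.properSubgraphs,
      (∑ e : ι ≃ A, ∏ i, Nat.card (EmbIso (D i) G (e i))) * Nat.card (Iso (G.contract A) Γ') := by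
  rw [Nat.card_sigma]
  simp only [Nat.card_prod, Nat.card_pi, Finset.sum_mul]
  rw [Finset.sum_sigma', ← Finset.sum_subtype (Finset.univ.filter fun S : ι → Finset G.V =>
    Pairwise fun i i' => Disjoint (S i) (S i')) (by simp) fun S =>
    (∏ i, Nat.card (EmbIso (D i) G (S i))) * Nat.card (Iso (G.contract (pieceSet S)) Γ')]
  symm
  have hpieces : ∀ (A : Finset (Finset G.V)) (e : ι ≃ A), pieceSet (fun i => (e i).1) = A := by
    intro A e
    ext S
    rw [mem_pieceSet]
    exact ⟨fun ⟨i, hi⟩ => hi ▸ (e i).2, fun h => ⟨e.symm ⟨S, h⟩, by simp⟩⟩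
  refine Finset.sum_of_injOn (fun x i => (x.2 i).1) ?_ ?_ ?_ ?_
  · rintro ⟨A, e⟩ - ⟨A', e'⟩ - h
    have h2 : A = A' := (hpieces A e).symm.trans ((congrArg pieceSet h).trans (hpieces A' e'))
    subst h2
    congr 1
    ext1 i
    exact Subtype.ext (congrFun h i)
  · rintro ⟨A, e⟩ hA
    simp only [Finset.coe_sigma, Set.mem_sigma_iff, Finset.mem_coe, properSubgraphs,
      Finset.mem_filter, Finset.mem_univ, true_and] at hA
    refine Finset.mem_coe.mpr (Finset.mem_filter.mpr ⟨Finset.mem_univ _, fun i i' hne => ?_⟩)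
    exact hA.1.1.2 (e i).2 (e i').2 fun h => hne (e.injective (Subtype.ext h))
  · intro S hS hx
    rw [Finset.mem_filter] at hS
    by_contra hne
    refine hx ?_
    rw [← ne_eq, mul_ne_zero_iff, Finset.prod_ne_zero_iff] at hne
    have hemb : ∀ i, Nonempty (EmbIso (D i) G (S i)) := fun i =>
      (Nat.card_ne_zero.mp (hne.1 i (Finset.mem_univ i))).1
    have hS0 : ∀ i, S i ≠ ∅ := by
      intro i h
      obtain ⟨x⟩ := hemb i
      obtain ⟨v⟩ := (hD i).nonempty_V
      exact Finset.ne_empty_of_mem (x.2.onV v).2 h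
    have hSi : Function.Injective S := by
      intro i i' h
      by_contra hii
      have : Disjoint (S i) (S i') := hS.2 hii
      rw [← h, disjoint_self] at this
      exact hS0 i this
    have hmem : ∀ i, S i ∈ pieceSet S := fun i => mem_pieceSet.mpr ⟨i, rfl⟩
    let e : ι ≃ pieceSet S := Equiv.ofBijective (fun i => ⟨S i, hmem i⟩)
      ⟨fun i i' h => hSi (congrArg Subtype.val h), fun B => by
        obtain ⟨i, hi⟩ := mem_pieceSet.mp B.2
        exact ⟨i, Subtype.ext hi⟩⟩
    refine ⟨⟨pieceSet S, e⟩, ?_, rfl⟩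
    simp only [Finset.coe_sigma, Set.mem_sigma_iff, Finset.mem_coe, properSubgraphs,
      Finset.mem_filter, Finset.mem_univ, true_and, and_true]
    refine ⟨⟨fun B hB => ?_, fun B hB B' hB' hBB => ?_⟩, ?_, fun hu => ?_⟩
    · obtain ⟨i, rfl⟩ := mem_pieceSet.mp hB
      obtain ⟨x⟩ := hemb i
      exact ⟨⟨t i, x.1, x.2.isOnePI (hD i)⟩⟩
    · obtain ⟨i, rfl⟩ := mem_pieceSet.mp hB
      obtain ⟨i', rfl⟩ := mem_pieceSet.mp hB'
      exact hS.2 fun h => hBB (congrArg S h)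
    · exact Finset.ne_empty_of_mem (hmem (Classical.arbitrary ι))
    · -- if `G` itself is a component, then `G/γ` has at most one vertex
      obtain ⟨i, hi⟩ := mem_pieceSet.mp hu
      obtain ⟨φ⟩ := (Nat.card_ne_zero.mp hne.2).1
      have hsub : Subsingleton (G.ContractV (pieceSet S)) := by
        have h1 : ∀ B ∈ pieceSet S, B = Finset.univ := by
          intro B hB
          obtain ⟨j, rfl⟩ := mem_pieceSet.mp hB
          by_contra hj
          have : Disjoint (S j) (S i) := hS.2 fun h => hj ((congrArg S h).trans hi)
          rw [hi] at this
          exact hS0 j (disjoint_top.mp this)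
        constructor
        rintro (⟨v, hv⟩ | ⟨B, hB, hB'⟩) (⟨w, hw⟩ | ⟨B', hB₂, hB₂'⟩)
        · exact absurd (Finset.mem_univ v) (hv _ hu)
        · exact absurd (Finset.mem_univ v) (hv _ hu)
        · exact absurd (Finset.mem_univ w) (hw _ hu)
        · congr 2
          exact (h1 B hB).trans (h1 B' hB₂).symm
      have hV : Fintype.card Γ'.V ≤ 1 := by
        have := @Function.Injective.subsingleton _ _ φ.onV.symm φ.onV.symm.injective hsub
        exact Fintype.card_le_one_iff_subsingleton.mpr this
      have h1 := hΓ'.card_V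
      have h2 := hΓ'.not_tree
      have h3 := two_le_numExt (r := r)
      lia
  · rintro ⟨A, e⟩ -
    simp only [hpieces]

end Diagram

end QED

namespace QED

/-! ### The coproduct of the Green's functions -/

/-- An isomorphism class of 1PI graphs with residue `r` as an element of `OnePI`. -/
def OnePI.ofClass {r : Residue} (q : Quotient (onePISetoid r)) : OnePI := ⟨r, q⟩

theorem OnePI.ofClass_injective {r : Residue} :
    Function.Injective (OnePI.ofClass (r := r)) :=
  fun _ _ h => eq_of_heq (Sigma.mk.inj h).2

/-- The isomorphism classes of 1PI graphs with residue `r` and loop number `L`. -/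
noncomputable def onePIClasses (r : Residue) (L : ℕ) : Finset (Quotient (onePISetoid r)) :=
  (onePIGraphs r L).preimage OnePI.ofClass OnePI.ofClass_injective.injOn

theorem mem_onePIClasses {r : Residue} {L : ℕ} {q : Quotient (onePISetoid r)} :
    q ∈ onePIClasses r L ↔ q.out.1.loops = L := by
  rw [onePIClasses, Finset.mem_preimage, onePIGraphs, Set.Finite.mem_toFinset]
  exact and_iff_right rfl

theorem sum_onePIGraphs {M : Type*} [AddCommMonoid M] (r : Residue) (L : ℕ) (f : OnePI → M) :
    ∑ g ∈ onePIGraphs r L, f g = ∑ q ∈ onePIClasses r L, f (.ofClass q) := by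
  refine (Finset.sum_preimage _ _ _ f fun g hg hr => ?_).symm
  rw [onePIGraphs, Set.Finite.mem_toFinset] at hg
  obtain ⟨r', q⟩ := g
  obtain rfl : r' = r := hg.1
  exact absurd ⟨q, rfl⟩ hr

open Diagram

instance {ι : Type} [Fintype ι] {t : ι → Residue} {D : ∀ i, Diagram (t i)} {r : Residue}
    {Γ' : Diagram r} : Finite (Rooting D Γ') := by
  refine Finite.of_injective (fun p => (p.root, p.leg)) fun p p' h => ?_
  obtain ⟨root, leg⟩ := p
  obtain ⟨root', leg'⟩ := p'
  obtain ⟨rfl, rfl⟩ := Prod.mk.inj h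
  rfl

section coproduct

variable (k : Type*) [Field k] [CharZero k] {r : Residue}

/-- Every 1PI graph lies in exactly one isomorphism class. -/
theorem sum_card_iso_out {D : Diagram r} (hD : D.IsOnePI) (L : ℕ) :
    ∑ q ∈ onePIClasses r L, (q.out.1.sym : k)⁻¹ * Nat.card (Diagram.Iso D q.out.1) =
      if D.loops = L then 1 else 0 := by
  classical
  have h : ∀ q : Quotient (onePISetoid r), (q.out.1.sym : k)⁻¹ *
      Nat.card (Diagram.Iso D q.out.1) =
        if (⟦⟨D, hD⟩⟧ : Quotient (onePISetoid r)) = q then 1 else 0 := by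
    intro q
    have h0 : (q.out.1.sym : k) ≠ 0 := Nat.cast_ne_zero.mpr (sym_pos _).ne'
    rw [card_iso_out']
    simp only [hD, exists_true_left]
    split_ifs
    · exact inv_mul_cancel₀ h0
    · simp
  rw [Finset.sum_congr rfl fun q _ => h q, Finset.sum_ite_eq]
  obtain ⟨φ⟩ := Quotient.mk_out (s := onePISetoid r) ⟨D, hD⟩
  simp only [mem_onePIClasses, φ.loops_eq]

/-- Inserting the graphs of a family in `Γ'` in all possible ways, and counting graphs up to
isomorphism, gives the coefficient of `γ ⊗ Γ'` in the coproduct. -/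
theorem sum_coeff_subgraphToH (hr : r ≠ .photon) {Γ' : Diagram r} (hΓ' : Γ'.IsOnePI)
    {γ : GraphUnion} (hγ : γ ≠ 0) (L : ℕ) :
    ∑ q ∈ onePIClasses r L, (q.out.1.sym : k)⁻¹ * ∑ A ∈ q.out.1.properSubgraphs,
        MvPolynomial.coeff γ (q.out.1.subgraphToH k A) *
          Nat.card (Diagram.Iso (q.out.1.contract A) Γ') =
      if Γ'.loops + γ.loops = L then
        (insertionPlaces (graphCounts r Γ'.loops) γ : k) / (γ.sym : k) else 0 := by
  classical
  obtain ⟨n, c, rfl⟩ := γ.exists_ofFamily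
  have hn : Nonempty (Fin n) := by
    by_contra h
    rw [not_nonempty_iff] at h
    exact hγ (Finset.sum_of_isEmpty _)
  have hD : ∀ i, (c i).graph.IsOnePI := fun i => (c i).graph_isOnePI
  have h0 : (2 ^ Fintype.card (Fin n) * (GraphUnion.ofFamily c).sym : k) ≠ 0 := by
    refine mul_ne_zero (pow_ne_zero _ two_ne_zero) (Nat.cast_ne_zero.mpr ?_)
    rw [GraphUnion.sym_ofFamily]
    exact mul_ne_zero (Finset.prod_ne_zero_iff.mpr fun _ _ => Nat.factorial_ne_zero _)
      (Finset.prod_ne_zero_iff.mpr fun i _ => (sym_pos _).ne')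
  have := Fintype.ofFinite (Rooting (fun i => (c i).graph) Γ' × Gluing (fun i => (c i).res) hΓ')
  -- the terms of one isomorphism class count the insertions that give a graph of this class
  have h1 : ∀ q : Quotient (onePISetoid r), (∑ A ∈ q.out.1.properSubgraphs,
      MvPolynomial.coeff (GraphUnion.ofFamily c) (q.out.1.subgraphToH k A) *
        (Nat.card (Diagram.Iso (q.out.1.contract A) Γ') : k)) *
          (2 ^ Fintype.card (Fin n) * (GraphUnion.ofFamily c).sym) =
      ∑ p : Rooting (fun i => (c i).graph) Γ' × Gluing (fun i => (c i).res) hΓ',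
        (Nat.card (Diagram.Iso (p.1.insertion hD hΓ' p.2).diagram q.out.1) : k) := by
    intro q
    have hG := q.out.2
    rw [← Nat.cast_sum, ← Nat.card_sigma]
    change _ = ((Nat.card (Realization q.out.1 hD hΓ') : ℕ) : k)
    rw [card_realization_eq hD hΓ' hG, ← card_subgraphDecomposition_eq hD hΓ' hG,
      card_subgraphDecomposition_eq_sum hΓ' hD, Nat.cast_sum, Finset.sum_mul]
    refine Finset.sum_congr rfl fun A hA => ?_
    rw [properSubgraphs, Finset.mem_filter] at hA
    rw [Nat.cast_mul, ← coeff_subgraphToH_mul k hG hA.2.1.1 c]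
    ring
  refine mul_right_cancel₀ h0 ?_
  rw [Finset.sum_mul, Finset.sum_congr rfl fun q _ => (mul_assoc _ _ _).trans
    (congrArg _ (h1 q))]
  simp only [Finset.mul_sum]
  rw [Finset.sum_comm]
  -- each insertion gives a graph of exactly one class
  have h2 : ∀ p : Rooting (fun i => (c i).graph) Γ' × Gluing (fun i => (c i).res) hΓ', _ :=
    fun p => sum_card_iso_out k (p.1.insertion_isOnePI hD hΓ' p.2).1 L
  rw [Finset.sum_congr rfl fun p _ => h2 p]
  have h3 : ∀ p : Rooting (fun i => (c i).graph) Γ' × Gluing (fun i => (c i).res) hΓ',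
      (p.1.insertion hD hΓ' p.2).diagram.loops = Γ'.loops + (GraphUnion.ofFamily c).loops :=
    fun p => (p.1.insertion_isOnePI hD hΓ' p.2).2.trans
      (by rw [GraphUnion.loops_ofFamily]; rfl)
  simp only [h3]
  split_ifs with hL
  · have h4 := card_insertions (D := fun i => (c i).graph) hr hΓ' _
      (GraphUnion.num_ofFamily c)
    rw [Finset.sum_const, Finset.card_univ, ← Nat.card_eq_fintype_card, h4, nsmul_eq_mul, mul_one]
    have h5 := (mul_ne_zero_iff.mp h0).2
    push_cast
    field_simp
  · simp

end coproduct

end QED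

namespace QED

open Diagram

section coproduct

variable (k : Type*) [Field k] {r : Residue}

/-- The coefficient of `γ ⊗ δ` in an element of `H ⊗ H`. -/
noncomputable def tensorCoeff (γ δ : GraphUnion) : H k ⊗[k] H k →ₗ[k] k :=
  LinearMap.mul' k k ∘ₗ TensorProduct.map (MvPolynomial.lcoeff k γ) (MvPolynomial.lcoeff k δ)

theorem tensorCoeff_tmul (γ δ : GraphUnion) (x y : H k) :
    tensorCoeff k γ δ (x ⊗ₜ y) = MvPolynomial.coeff γ x * MvPolynomial.coeff δ y := rfl

/-- The products of monomials are a basis of `H ⊗ H`. -/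
theorem tensor_ext {x y : H k ⊗[k] H k} (h : ∀ γ δ, tensorCoeff k γ δ x = tensorCoeff k γ δ y) :
    x = y := by
  let b := MvPolynomial.basisMonomials OnePI k
  have hb : ∀ γ δ x, (b.tensorProduct b).repr x (γ, δ) = tensorCoeff k γ δ x := by
    intro γ δ x
    induction x with
    | zero => simp
    | add x y hx hy => simp [hx, hy]
    | tmul x y =>
      rw [Module.Basis.tensorProduct_repr_tmul_apply, tensorCoeff_tmul, smul_eq_mul, mul_comm]
      rfl
  refine (b.tensorProduct b).ext_elem fun ⟨γ, δ⟩ => ?_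
  rw [hb, hb, h]

theorem mem_unions {K : ℕ} {γ : GraphUnion} : γ ∈ unions K ↔ γ.loops = K := by
  rw [unions, Set.Finite.mem_toFinset]
  exact Iff.rfl

theorem coeff_toH (γ δ : GraphUnion) [Decidable (γ = δ)] :
    MvPolynomial.coeff δ (γ.toH k) = if γ = δ then 1 else 0 := by
  classical
  rw [GraphUnion.toH, MvPolynomial.coeff_monomial]
  congr

/-- The sum of the 1PI graphs with residue `r` and loop number `L`, divided by their symmetry
factors. -/
noncomputable def graphSum (r : Residue) (L : ℕ) : H k :=
  ∑ q ∈ onePIClasses r L, (q.out.1.sym : k)⁻¹ • MvPolynomial.X (OnePI.ofClass q)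

theorem coeff_graphSum_single (L : ℕ) (q : Quotient (onePISetoid r)) :
    MvPolynomial.coeff (Finsupp.single (OnePI.ofClass q) 1) (graphSum k r L) =
      if q.out.1.loops = L then (q.out.1.sym : k)⁻¹ else 0 := by
  classical
  simp only [graphSum, MvPolynomial.coeff_sum, MvPolynomial.coeff_smul, MvPolynomial.coeff_X,
    Finsupp.single_left_inj one_ne_zero, OnePI.ofClass_injective.eq_iff, smul_eq_mul, mul_ite,
    mul_one, mul_zero, Finset.sum_ite_eq', mem_onePIClasses]

theorem coeff_graphSum_eq_zero (L : ℕ) {δ : GraphUnion}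
    (hδ : ∀ q : Quotient (onePISetoid r), δ ≠ Finsupp.single (OnePI.ofClass q) 1) :
    MvPolynomial.coeff δ (graphSum k r L) = 0 := by
  classical
  rw [graphSum, MvPolynomial.coeff_sum]
  refine Finset.sum_eq_zero fun q _ => ?_
  rw [MvPolynomial.coeff_smul, MvPolynomial.coeff_X, if_neg (hδ q).symm, smul_zero]

theorem toH_eq (D : Diagram r) (h : D.IsOnePI) :
    D.toH k = MvPolynomial.X (OnePI.ofClass ⟦⟨D, h⟩⟧) := by
  rw [toH, dif_pos h]
  rfl

theorem coeff_toH_eq_zero (D : Diagram r) {δ : GraphUnion}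
    (hδ : ∀ q : Quotient (onePISetoid r), δ ≠ Finsupp.single (OnePI.ofClass q) 1) :
    MvPolynomial.coeff δ (D.toH k) = 0 := by
  classical
  by_cases h : D.IsOnePI
  · rw [toH_eq k D h, MvPolynomial.coeff_X, if_neg (hδ _).symm]
  · rw [toH, dif_neg h, MvPolynomial.coeff_zero]

variable [CharZero k]

theorem coeff_toH_single (D : Diagram r) (q : Quotient (onePISetoid r)) :
    MvPolynomial.coeff (Finsupp.single (OnePI.ofClass q) 1) (D.toH k) =
      Nat.card (Diagram.Iso D q.out.1) * (q.out.1.sym : k)⁻¹ := by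
  classical
  have h0 : (q.out.1.sym : k) ≠ 0 := Nat.cast_ne_zero.mpr (sym_pos _).ne'
  rw [card_iso_out']
  by_cases h : D.IsOnePI
  · rw [toH_eq k D h, MvPolynomial.coeff_X]
    simp only [Finsupp.single_left_inj one_ne_zero, OnePI.ofClass_injective.eq_iff, h,
      exists_true_left]
    split_ifs
    · exact (mul_inv_cancel₀ h0).symm
    · simp
  · rw [toH, dif_neg h, MvPolynomial.coeff_zero]
    simp [h]

theorem coeff_zero_subgraphToH {G : Diagram r} (hG : G.IsOnePI) {A : Finset (Finset G.V)}
    (hA : A ∈ G.properSubgraphs) : MvPolynomial.coeff 0 (G.subgraphToH k A) = 0 := by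
  classical
  rw [properSubgraphs, Finset.mem_filter] at hA
  have h := coeff_subgraphToH_mul k hG hA.2.1.1 (Fin.elim0 : Fin 0 → OnePI)
  have hA0 := Finset.nonempty_iff_ne_empty.mpr hA.2.2.1
  have : IsEmpty (Fin 0 ≃ A) := ⟨fun e => (e.symm ⟨_, hA0.choose_spec⟩).elim0⟩
  simpa [GraphUnion.ofFamily, GraphUnion.sym] using h

/-- The coproduct of the sum of the 1PI graphs with a given residue and loop number, weighted by
their symmetry factors. -/
theorem coproduct_graphSum (hr : r ≠ .photon) {L : ℕ} (hL : 0 < L) :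
    coproduct k (graphSum k r L) = graphSum k r L ⊗ₜ 1 +
      ∑ K ∈ Finset.range L, ∑ γ ∈ unions K,
        ((insertionPlaces (graphCounts r (L - K)) γ : k) / (γ.sym : k)) •
          (γ.toH k ⊗ₜ[k] graphSum k r (L - K)) := by
  classical
  have h1 : coproduct k (graphSum k r L) = graphSum k r L ⊗ₜ 1 + (1 ⊗ₜ graphSum k r L +
      ∑ q ∈ onePIClasses r L, (q.out.1.sym : k)⁻¹ • ∑ A ∈ q.out.1.properSubgraphs,
        q.out.1.subgraphToH k A ⊗ₜ[k] (q.out.1.contract A).toH k) := by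
    rw [graphSum, map_sum, TensorProduct.sum_tmul, TensorProduct.tmul_sum,
      ← Finset.sum_add_distrib, ← Finset.sum_add_distrib]
    refine Finset.sum_congr rfl fun q _ => ?_
    rw [map_smul, coproduct, MvPolynomial.aeval_X, smul_add, smul_add, add_assoc,
      TensorProduct.smul_tmul', TensorProduct.tmul_smul]
    rfl
  rw [h1]
  congr 1
  -- comparison of the coefficients of `γ ⊗ δ`, where only single graphs `δ` occur
  refine tensor_ext k fun γ δ => ?_
  simp only [map_add, map_sum, map_smul, tensorCoeff_tmul, smul_eq_mul, coeff_toH]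
  by_cases hδ : ∃ q : Quotient (onePISetoid r), δ = Finsupp.single (OnePI.ofClass q) 1
  swap
  · push Not at hδ
    simp only [coeff_graphSum_eq_zero k _ hδ, coeff_toH_eq_zero k _ hδ, mul_zero,
      Finset.sum_const_zero, add_zero]
  obtain ⟨q, rfl⟩ := hδ
  have hq : 0 < q.out.1.loops := q.out.2.not_tree
  simp only [coeff_graphSum_single, coeff_toH_single]
  have h2 : ∀ K, ∑ γ' ∈ unions K, (insertionPlaces (graphCounts r (L - K)) γ' : k) / (γ'.sym : k) *
      ((if γ' = γ then 1 else 0) * if q.out.1.loops = L - K then (q.out.1.sym : k)⁻¹ else 0) =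
      if γ.loops = K then (insertionPlaces (graphCounts r (L - K)) γ : k) / (γ.sym : k) *
        (if q.out.1.loops = L - K then (q.out.1.sym : k)⁻¹ else 0) else 0 := by
    intro K
    generalize (if q.out.1.loops = L - K then (q.out.1.sym : k)⁻¹ else 0) = B
    simp only [ite_mul, one_mul, zero_mul, mul_ite, mul_zero, Finset.sum_ite_eq', mem_unions]
  simp only [h2, Finset.sum_ite_eq, Finset.mem_range]
  by_cases hγ : γ = 0
  · subst hγ
    rw [Finset.sum_eq_zero, add_zero]
    · simp [GraphUnion.loops, GraphUnion.sym, insertionPlaces, GraphUnion.num, hL]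
    · intro q' _
      rw [Finset.sum_eq_zero, mul_zero]
      intro A hA
      rw [coeff_zero_subgraphToH k q'.out.2 hA, zero_mul]
  · have h3 := sum_coeff_subgraphToH k hr q.out.2 hγ L
    rw [MvPolynomial.coeff_one, if_neg (Ne.symm hγ), zero_mul, zero_add]
    have h4 : ∀ q' : Quotient (onePISetoid r), (q'.out.1.sym : k)⁻¹ *
        ∑ A ∈ q'.out.1.properSubgraphs, MvPolynomial.coeff γ (q'.out.1.subgraphToH k A) *
          (Nat.card (Diagram.Iso (q'.out.1.contract A) q.out.1) * (q.out.1.sym : k)⁻¹) =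
        ((q'.out.1.sym : k)⁻¹ *
          ∑ A ∈ q'.out.1.properSubgraphs, MvPolynomial.coeff γ (q'.out.1.subgraphToH k A) *
            Nat.card (Diagram.Iso (q'.out.1.contract A) q.out.1)) * (q.out.1.sym : k)⁻¹ := by
      intro q'
      simp only [mul_assoc, Finset.sum_mul]
    rw [Finset.sum_congr rfl fun q' _ => h4 q', ← Finset.sum_mul, h3]
    by_cases hc : q.out.1.loops + γ.loops = L
    · have h5 : L - γ.loops = q.out.1.loops := by lia
      rw [if_pos hc, if_pos (by lia), h5, if_pos rfl]
    · rw [if_neg hc, zero_mul]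
      split_ifs
      · lia
      · rw [mul_zero]
      · rfl

end coproduct

end QED

namespace QED

/-! ### Insertions with one distinguished component -/

namespace GraphUnion

theorem num_add_single (γ : GraphUnion) (g : OnePI) (s : Residue) :
    (γ + Finsupp.single g 1).num s = γ.num s + if g.res = s then 1 else 0 := by
  rw [num, Finsupp.sum_add_index' (by simp) (by intros; split_ifs <;> rfl),
    Finsupp.sum_single_index (by simp)]
  rfl

theorem loops_add_single (γ : GraphUnion) (g : OnePI) :
    (γ + Finsupp.single g 1).loops = γ.loops + g.loops := by
  rw [loops, Finsupp.sum_add_index' (by simp) (by intros; ring),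
    Finsupp.sum_single_index (by simp), one_mul]
  rfl

/-- The symmetry factor of a disjoint union after one more component `g` is added: if `g` occurs
`n` times before, it gains the factor `(n + 1) Sym(g)`. -/
theorem sym_add_single (γ : GraphUnion) (g : OnePI) :
    (γ + Finsupp.single g 1).sym = (γ g + 1) * g.sym * γ.sym := by
  have h1 : ∀ i : OnePI, Nat.factorial 0 * i.sym ^ 0 = 1 := by simp
  rw [sym, sym, ← Finsupp.mul_prod_erase' _ g _ fun i => h1 i,
    ← Finsupp.mul_prod_erase' γ g _ fun i => h1 i, Finsupp.erase_add, Finsupp.erase_single,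
    add_zero, Finsupp.add_apply, Finsupp.single_eq_same, Nat.factorial_succ, pow_succ]
  ring

theorem toH_mul_X (k : Type*) [Field k] (γ : GraphUnion) (g : OnePI) :
    MvPolynomial.X g * γ.toH k = (γ + Finsupp.single g 1).toH k := by
  rw [toH, toH, MvPolynomial.X, MvPolynomial.monomial_mul, one_mul, add_comm]

theorem sub_add_single {γ : GraphUnion} {g : OnePI} (hg : g ∈ γ.support) :
    γ - Finsupp.single g 1 + Finsupp.single g 1 = γ :=
  tsub_add_cancel_of_le (Finsupp.single_le_iff.mpr
    (Nat.one_le_iff_ne_zero.mpr (Finsupp.mem_support_iff.mp hg)))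

end GraphUnion

/-- The coefficient of the insertions in terms of the numbers of components. -/
theorem wardCoeff_eq (l : ℕ) (γ : GraphUnion) : wardCoeff l γ =
    (2 * l).descFactorial (γ.num .vertex) * (2 * l).ascFactorial (γ.num .electron) *
      l.ascFactorial (γ.num .photon) := by
  rw [wardCoeff, Nat.descFactorial_eq_factorial_mul_choose,
    Nat.ascFactorial_eq_factorial_mul_choose', Nat.ascFactorial_eq_factorial_mul_choose']

theorem insertionPlaces_eq (m : Residue → ℕ) (γ : GraphUnion) : insertionPlaces m γ =
    (m .vertex).descFactorial (γ.num .vertex) * (m .electron).ascFactorial (γ.num .electron) *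
      (m .photon).ascFactorial (γ.num .photon) := by
  rw [insertionPlaces, Nat.descFactorial_eq_factorial_mul_choose,
    Nat.ascFactorial_eq_factorial_mul_choose', Nat.ascFactorial_eq_factorial_mul_choose']

theorem descFactorial_add_one (a n : ℕ) :
    (a + 1).descFactorial n = a.descFactorial n + n * a.descFactorial (n - 1) := by
  cases n with
  | zero => simp
  | succ n =>
    rw [Nat.succ_descFactorial_succ, Nat.descFactorial_succ, Nat.add_sub_cancel, ← add_mul]
    rcases le_or_gt n a with h | h
    · congr 1
      lia
    · rw [Nat.descFactorial_of_lt h, mul_zero, mul_zero]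

theorem ascFactorial_add_one (a n : ℕ) :
    (a + 1).ascFactorial n = a.ascFactorial n + n * (a + 1).ascFactorial (n - 1) := by
  cases n with
  | zero => simp
  | succ n =>
    rw [Nat.ascFactorial_succ, Nat.ascFactorial_succ, ← Nat.succ_ascFactorial a, Nat.add_sub_cancel,
      ← add_mul]
    congr 1
    lia

theorem sum_support_res (γ : GraphUnion) (s : Residue) :
    ∑ g ∈ γ.support with g.res = s, γ g = γ.num s := by
  rw [Finset.sum_filter]
  rfl

/-- The difference of the numbers of insertion places in a vertex graph and in an electron
self-energy with the same number of loops: these graphs differ by one vertex and one electron line,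
so that one component is inserted there. -/
theorem insertionPlaces_vertexCounts {l : ℕ} (hl : 0 < l) (γ : GraphUnion) :
    insertionPlaces (vertexCounts l) γ = electronInsertionPlaces l γ +
      ∑ g ∈ γ.support with g.res ≠ .photon, γ g * wardCoeff l (γ - Finsupp.single g 1) := by
  classical
  have hnum : ∀ g ∈ γ.support, ∀ s, (γ - Finsupp.single g 1).num s =
      γ.num s - if g.res = s then 1 else 0 := by
    intro g hg s
    conv_rhs => rw [← GraphUnion.sub_add_single hg, GraphUnion.num_add_single]
    lia
  have hsplit : γ.support.filter (fun g => g.res ≠ .photon) =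
      γ.support.filter (fun g => g.res = .vertex) ∪
        γ.support.filter fun g => g.res = .electron := by
    rw [← Finset.filter_or]
    refine Finset.filter_congr fun g _ => ?_
    cases g.res <;> simp
  have hdisj : Disjoint (γ.support.filter fun g => g.res = .vertex)
      (γ.support.filter fun g => g.res = .electron) :=
    Finset.disjoint_filter.mpr fun g _ h h' => by simp [h] at h'
  have hv : ∑ g ∈ γ.support with g.res = .vertex, γ g * wardCoeff l (γ - Finsupp.single g 1) =
      γ.num .vertex * ((2 * l).descFactorial (γ.num .vertex - 1) *
        (2 * l).ascFactorial (γ.num .electron) * l.ascFactorial (γ.num .photon)) := by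
    rw [← sum_support_res, Finset.sum_mul, sum_support_res]
    refine Finset.sum_congr rfl fun g hg => ?_
    rw [Finset.mem_filter] at hg
    simp [wardCoeff_eq, hnum g hg.1, hg.2]
  have he : ∑ g ∈ γ.support with g.res = .electron, γ g * wardCoeff l (γ - Finsupp.single g 1) =
      γ.num .electron * ((2 * l).descFactorial (γ.num .vertex) *
        (2 * l).ascFactorial (γ.num .electron - 1) * l.ascFactorial (γ.num .photon)) := by
    rw [← sum_support_res γ .electron, Finset.sum_mul, sum_support_res]
    refine Finset.sum_congr rfl fun g hg => ?_
    rw [Finset.mem_filter] at hg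
    simp [wardCoeff_eq, hnum g hg.1, hg.2]
  -- a vertex graph has `2l + 1` vertices and `2l` electron lines, and an electron self-energy has
  -- `2l` vertices and `2l - 1` electron lines
  have hl' : 2 * l = 2 * l - 1 + 1 := by lia
  have ha := ascFactorial_add_one (2 * l - 1) (γ.num .electron)
  rw [← hl'] at ha
  rw [hsplit, Finset.sum_union hdisj, hv, he, electronInsertionPlaces, insertionPlaces_eq,
    insertionPlaces_eq]
  simp only [vertexCounts, electronCounts]
  rw [descFactorial_add_one, ha]
  ring

end QED

namespace QED

/-! ### The coproduct of the Ward elements -/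

section Ward

variable (k : Type*) [Field k]

theorem sum_onePIGraphs_eq_graphSum (r : Residue) (L : ℕ) :
    ∑ g ∈ onePIGraphs r L, (g.sym : k)⁻¹ • (MvPolynomial.X g : H k) = graphSum k r L :=
  sum_onePIGraphs _ _ _

theorem green_zero (r : Residue) : green k r 0 = 1 := if_pos rfl

theorem green_eq {L : ℕ} (hL : 0 < L) (r : Residue) :
    green k r L = (r.sign : k) • graphSum k r L := by
  rw [green, if_neg hL.ne', sum_onePIGraphs_eq_graphSum]

theorem ward_zero : ward k 0 = 0 := by
  rw [ward, green_zero, green_zero, sub_self]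

theorem onePIGraphs_zero (r : Residue) : onePIGraphs r 0 = ∅ := by
  rw [Finset.eq_empty_iff_forall_notMem]
  intro g hg
  rw [onePIGraphs, Set.Finite.mem_toFinset] at hg
  exact g.graph_isOnePI.not_tree.ne' hg.2

open scoped Classical in
/-- As `G^el` is defined with a minus sign, the Ward elements are sums over the vertex graphs and the
electron self-energies with the same number of loops. -/
theorem ward_eq (L : ℕ) : ward k L =
    ∑ g ∈ onePIGraphs .vertex L ∪ onePIGraphs .electron L, (g.sym : k)⁻¹ • MvPolynomial.X g := by
  have hdisj : Disjoint (onePIGraphs .vertex L) (onePIGraphs .electron L) := by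
    rw [Finset.disjoint_left]
    intro g hg hg'
    rw [onePIGraphs, Set.Finite.mem_toFinset] at hg hg'
    have := hg.1.symm.trans hg'.1
    cases this
  rw [Finset.sum_union hdisj, sum_onePIGraphs_eq_graphSum, sum_onePIGraphs_eq_graphSum]
  rcases Nat.eq_zero_or_pos L with rfl | hL
  · rw [ward_zero, ← sum_onePIGraphs_eq_graphSum, ← sum_onePIGraphs_eq_graphSum, onePIGraphs_zero,
      onePIGraphs_zero, Finset.sum_empty, add_zero]
  · rw [ward, green_eq k hL, green_eq k hL]
    simp [Residue.sign]

/-- The first factors at loop order `M` in the first part of the coproduct of the Ward elements. -/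
noncomputable def wardInsertion (l M : ℕ) : H k :=
  ∑ K ∈ Finset.range (M + 1), ∑ γ ∈ unions (M - K),
    ((wardCoeff l γ : k) / (γ.sym : k)) • (ward k K * γ.toH k)

/-- For `l = 0` there are no insertion places, so that only the empty union contributes. -/
theorem wardInsertion_zero (L : ℕ) : wardInsertion k 0 L = ward k L := by
  have h1 : ∀ γ : GraphUnion, γ ≠ 0 → wardCoeff 0 γ = 0 := by
    intro γ hγ
    obtain ⟨g, hg⟩ := Finsupp.support_nonempty_iff.mpr hγ
    have h := GraphUnion.num_add_single (γ - Finsupp.single g 1) g g.res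
    rw [GraphUnion.sub_add_single hg, if_pos rfl] at h
    rw [wardCoeff_eq]
    generalize g.res = s at h
    cases s <;> rw [h] <;> simp [Nat.zero_ascFactorial]
  have h0 : (0 : GraphUnion) ∈ unions 0 := by
    rw [mem_unions]
    exact Finsupp.sum_zero_index
  rw [wardInsertion, Finset.sum_eq_single L, Nat.sub_self, Finset.sum_eq_single 0]
  · simp [wardCoeff, GraphUnion.num, GraphUnion.sym, GraphUnion.toH]
  · intro γ _ hγ
    rw [h1 γ hγ, Nat.cast_zero, zero_div, zero_smul]
  · exact fun h => absurd h0 h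
  · intro K hK hKL
    refine Finset.sum_eq_zero fun γ hγ => ?_
    rw [h1 γ, Nat.cast_zero, zero_div, zero_smul]
    rintro rfl
    rw [mem_unions] at hγ h0
    rw [Finset.mem_range] at hK
    lia
  · exact fun h => absurd (Finset.self_mem_range_succ L) h

theorem GraphUnion.sym_ne_zero [CharZero k] (γ : GraphUnion) :
    (γ.sym : k) ≠ 0 := by
  refine Nat.cast_ne_zero.mpr (Finset.prod_ne_zero_iff.mpr fun g _ => ?_)
  exact mul_ne_zero (Nat.factorial_ne_zero _) (pow_ne_zero _ (Diagram.sym_pos _).ne')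

variable [CharZero k]

/-- Multiplication with a Ward element distinguishes a component of a disjoint union that is a
vertex graph or an electron self-energy. -/
theorem wardInsertion_eq (l M : ℕ) : wardInsertion k l M =
    ∑ γ ∈ unions M, (((∑ g ∈ γ.support with g.res ≠ .photon,
      γ g * wardCoeff l (γ - Finsupp.single g 1) : ℕ) : k) / (γ.sym : k)) • γ.toH k := by
  classical
  have hR : ∀ γ : GraphUnion, (((∑ g ∈ γ.support with g.res ≠ .photon,
      γ g * wardCoeff l (γ - Finsupp.single g 1) : ℕ) : k) / (γ.sym : k)) • γ.toH k =
      ∑ g ∈ γ.support with g.res ≠ .photon,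
        ((γ g * wardCoeff l (γ - Finsupp.single g 1) : k) / (γ.sym : k)) • γ.toH k := by
    intro γ
    rw [← Finset.sum_smul, ← Finset.sum_div]
    push_cast
    rfl
  have hL : ∀ K (γ : GraphUnion), ((wardCoeff l γ : k) / (γ.sym : k)) • (ward k K * γ.toH k) =
      ∑ g ∈ onePIGraphs .vertex K ∪ onePIGraphs .electron K,
        (((wardCoeff l γ : k) / (γ.sym : k)) * (g.sym : k)⁻¹) •
          (γ + Finsupp.single g 1).toH k := by
    intro K γ
    rw [ward_eq, Finset.sum_mul, Finset.smul_sum]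
    refine Finset.sum_congr rfl fun g _ => ?_
    rw [smul_mul_assoc, GraphUnion.toH_mul_X, smul_smul]
  simp only [wardInsertion, hR, hL]
  rw [Finset.sum_sigma', Finset.sum_sigma', Finset.sum_sigma']
  have hmem : ∀ (g : OnePI) K, g ∈ onePIGraphs .vertex K ∪ onePIGraphs .electron K ↔
      g.res ≠ .photon ∧ g.loops = K := by
    intro g K
    simp only [Finset.mem_union, onePIGraphs, Set.Finite.mem_toFinset]
    change _ ∧ _ ∨ _ ∧ _ ↔ _
    cases g.res <;> simp
  -- the pair of `γ` and a graph `g` in the Ward element corresponds to `γ + g` with its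
  -- distinguished component `g`
  refine Finset.sum_bij' (fun x _ => ⟨x.1.2 + Finsupp.single x.2 1, x.2⟩)
    (fun y _ => ⟨⟨y.2.loops, y.1 - Finsupp.single y.2 1⟩, y.2⟩) ?_ ?_ ?_ ?_ ?_
  · rintro ⟨⟨K, γ⟩, g⟩ hx
    simp only [Finset.mem_sigma, Finset.mem_range, mem_unions, hmem] at hx
    simp only [Finset.mem_sigma, mem_unions, GraphUnion.loops_add_single, Finset.mem_filter,
      Finsupp.mem_support_iff]
    refine ⟨by lia, ?_, hx.2.1⟩
    simp
  · rintro ⟨γ, g⟩ hx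
    simp only [Finset.mem_sigma, mem_unions, Finset.mem_filter] at hx
    have h1 := GraphUnion.loops_add_single (γ - Finsupp.single g 1) g
    rw [GraphUnion.sub_add_single hx.2.1] at h1
    simp only [Finset.mem_sigma, Finset.mem_range, mem_unions, hmem]
    exact ⟨⟨by lia, by lia⟩, hx.2.2, trivial⟩
  · rintro ⟨⟨K, γ⟩, g⟩ hx
    simp only [Finset.mem_sigma, Finset.mem_range, mem_unions, hmem] at hx
    obtain ⟨-, -, rfl⟩ := hx
    simp
  · rintro ⟨γ, g⟩ hx
    simp only [Finset.mem_sigma, mem_unions, Finset.mem_filter] at hx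
    simp [GraphUnion.sub_add_single hx.2.1]
  · rintro ⟨⟨K, γ⟩, g⟩ hx
    have h1 : (g.sym : k) ≠ 0 := Nat.cast_ne_zero.mpr (Diagram.sym_pos _).ne'
    have h2 := γ.sym_ne_zero k
    have h3 : ((γ g + 1 : ℕ) : k) ≠ 0 := Nat.cast_ne_zero.mpr (Nat.succ_ne_zero _)
    congr 1
    simp only [GraphUnion.sym_add_single, Finsupp.add_apply, Finsupp.single_eq_same,
      add_tsub_cancel_right]
    push_cast at h3 ⊢
    field_simp

end Ward

end QED

namespace QED

section Ward

variable (k : Type*) [Field k] [CharZero k]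

/-- The coproduct of the Green's functions: the insertion places are counted by the residue and the
loop number of the second factor, and the signs on both sides agree. -/
theorem coproduct_green {r : Residue} (hr : r ≠ .photon) {L : ℕ} (hL : 0 < L) :
    coproduct k (green k r L) = green k r L ⊗ₜ 1 +
      ∑ K ∈ Finset.range L, ∑ γ ∈ unions K,
        ((insertionPlaces (graphCounts r (L - K)) γ : k) / (γ.sym : k)) •
          (γ.toH k ⊗ₜ[k] green k r (L - K)) := by
  rw [green_eq k hL, map_smul, coproduct_graphSum k hr hL, smul_add, TensorProduct.smul_tmul',
    Finset.smul_sum]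
  congr 1
  refine Finset.sum_congr rfl fun K hK => ?_
  rw [Finset.smul_sum]
  refine Finset.sum_congr rfl fun γ _ => ?_
  rw [Finset.mem_range] at hK
  rw [green_eq k (by lia), TensorProduct.tmul_smul, smul_comm]

/-- The coproduct of the Ward elements, with the first part ordered by the loop number of the second
factor. -/
theorem coproduct_ward {L : ℕ} (hL : 0 < L) :
    coproduct k (ward k L) = ward k L ⊗ₜ 1 +
      ∑ M ∈ Finset.range L, wardInsertion k (L - M) M ⊗ₜ green k .vertex (L - M) +
      ∑ K ∈ Finset.range L, ∑ γ ∈ unions K,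
        ((electronInsertionPlaces (L - K) γ : k) / (γ.sym : k)) •
          (γ.toH k ⊗ₜ[k] ward k (L - K)) := by
  rw [add_assoc, ← Finset.sum_add_distrib, ward, map_sub, coproduct_green k (by simp) hL,
    coproduct_green k (by simp) hL, TensorProduct.sub_tmul, add_sub_add_comm,
    ← Finset.sum_sub_distrib]
  congr 1
  refine Finset.sum_congr rfl fun K hK => ?_
  rw [Finset.mem_range] at hK
  rw [wardInsertion_eq, TensorProduct.sum_tmul, ← Finset.sum_sub_distrib, ← Finset.sum_add_distrib]
  refine Finset.sum_congr rfl fun γ _ => ?_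
  simp only [graphCounts]
  rw [insertionPlaces_vertexCounts (by lia), Nat.cast_add, add_div, add_smul, ward,
    TensorProduct.tmul_sub, smul_sub, ← TensorProduct.smul_tmul', ← electronInsertionPlaces]
  abel

/-- The coproduct of the Ward elements in closed form. The terms with a second factor of loop
number zero combine to `W_L ⊗ 1`, as `W₀ = 0` and nothing can be inserted in a graph without loops.
-/
theorem coproduct_ward_eq_sum (L : ℕ) :
    coproduct k (ward k L) =
      ∑ K ∈ Finset.range (L + 1), ∑ K' ∈ Finset.range (L - K + 1), ∑ γ ∈ unions K',
          ((wardCoeff (L - K - K') γ : k) / (γ.sym : k)) •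
            ((ward k K * γ.toH k) ⊗ₜ[k] green k .vertex (L - K - K')) +
        ∑ K ∈ Finset.range (L + 1), ∑ γ ∈ unions K,
          ((electronInsertionPlaces (L - K) γ : k) / (γ.sym : k)) •
            (γ.toH k ⊗ₜ[k] ward k (L - K)) := by
  have h1 : ∑ K ∈ Finset.range (L + 1), ∑ K' ∈ Finset.range (L - K + 1), ∑ γ ∈ unions K',
      ((wardCoeff (L - K - K') γ : k) / (γ.sym : k)) •
        ((ward k K * γ.toH k) ⊗ₜ[k] green k .vertex (L - K - K')) =
      ∑ M ∈ Finset.range (L + 1), wardInsertion k (L - M) M ⊗ₜ[k] green k .vertex (L - M) := by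
    have h2 := Finset.sum_range_diag_flip (L + 1) fun K K' => ∑ γ ∈ unions K',
      ((wardCoeff (L - K - K') γ : k) / (γ.sym : k)) •
        ((ward k K * γ.toH k) ⊗ₜ[k] green k .vertex (L - K - K'))
    have h3 : ∀ K ∈ Finset.range (L + 1), L + 1 - K = L - K + 1 := by
      intro K hK
      rw [Finset.mem_range] at hK
      lia
    refine (Finset.sum_congr rfl fun K hK => by rw [h3 K hK]).trans (h2.symm.trans ?_)
    refine Finset.sum_congr rfl fun M hM => ?_
    rw [wardInsertion, TensorProduct.sum_tmul]
    refine Finset.sum_congr rfl fun K hK => ?_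
    rw [Finset.mem_range] at hK
    have h4 : L - K - (M - K) = L - M := by lia
    rw [h4, TensorProduct.sum_tmul]
    rfl
  rw [h1]
  rcases Nat.eq_zero_or_pos L with rfl | hL
  · simp [ward_zero, wardInsertion_zero]
  · rw [Finset.sum_range_succ, Finset.sum_range_succ, Nat.sub_self, wardInsertion_zero, green_zero,
      ward_zero, coproduct_ward k hL]
    simp only [TensorProduct.tmul_zero, smul_zero, Finset.sum_const_zero, add_zero]
    abel

end Ward

/-! ### The Hopf ideal -/

section HopfIdeal

variable (k : Type*) [Field k]

theorem counit_ward (L : ℕ) : counit k (ward k L) = 0 := by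
  rw [ward_eq, map_sum]
  refine Finset.sum_eq_zero fun g _ => ?_
  rw [map_smul, counit, MvPolynomial.aeval_X, smul_zero]

/-- The defining property of the antipode: `m ∘ (S ⊗ id) ∘ Δ = 1 ∘ ε`. -/
theorem lift_antipode_coproduct (x : H k) :
    Algebra.TensorProduct.lift (antipode k) (AlgHom.id k (H k)) (fun _ _ => Commute.all _ _)
      (coproduct k x) = algebraMap k (H k) (counit k x) := by
  have h : (Algebra.TensorProduct.lift (antipode k) (AlgHom.id k (H k))
      fun _ _ => Commute.all _ _).comp (coproduct k) = (Algebra.ofId k (H k)).comp (counit k) := by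
    refine MvPolynomial.algHom_ext fun g => ?_
    simp only [AlgHom.comp_apply, coproduct, counit, MvPolynomial.aeval_X, map_add, map_sum,
      Algebra.TensorProduct.lift_tmul, map_one, map_zero, AlgHom.id_apply, mul_one, one_mul]
    rw [antipode_X]
    ring
  exact DFunLike.congr_fun h x

theorem ward_mem (L : ℕ) : ward k L ∈ wardIdeal k := Ideal.subset_span ⟨L, rfl⟩

theorem tensorIdeal_eq (I : Ideal (H k)) : tensorIdeal k I =
    (I.map (Algebra.TensorProduct.includeLeft : H k →ₐ[k] H k ⊗[k] H k) ⊔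
      I.map (Algebra.TensorProduct.includeRight : H k →ₐ[k] H k ⊗[k] H k)).restrictScalars k := by
  rw [tensorIdeal, Submodule.restrictScalars_sup, Ideal.map_includeLeft_eq,
    Ideal.map_includeRight_eq]

theorem counit_eq_zero {x : H k} (hx : x ∈ wardIdeal k) : counit k x = 0 := by
  suffices wardIdeal k ≤ RingHom.ker (counit k) from this hx
  refine Ideal.span_le.mpr ?_
  rintro _ ⟨L, rfl⟩
  exact counit_ward k L

variable [CharZero k]

/-- Each term in the coproduct of a Ward element has a Ward element in one of the factors. -/
theorem coproduct_mem_tensorIdeal {x : H k} (hx : x ∈ wardIdeal k) :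
    coproduct k x ∈ tensorIdeal k (wardIdeal k) := by
  rw [tensorIdeal_eq, Submodule.restrictScalars_mem]
  set J := (wardIdeal k).map (Algebra.TensorProduct.includeLeft : H k →ₐ[k] H k ⊗[k] H k) ⊔
      (wardIdeal k).map (Algebra.TensorProduct.includeRight : H k →ₐ[k] H k ⊗[k] H k) with hJ
  have hl : ∀ x y : H k, x ∈ wardIdeal k → x ⊗ₜ y ∈ J := by
    intro x y hx
    have : x ⊗ₜ[k] y = (1 ⊗ₜ y) * (x ⊗ₜ 1) := by simp
    rw [this]
    exact J.mul_mem_left _ (Ideal.mem_sup_left (Ideal.mem_map_of_mem _ hx))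
  have hr : ∀ x y : H k, y ∈ wardIdeal k → x ⊗ₜ y ∈ J := by
    intro x y hy
    have : x ⊗ₜ[k] y = (x ⊗ₜ 1) * (1 ⊗ₜ y) := by simp
    rw [this]
    exact J.mul_mem_left _ (Ideal.mem_sup_right (Ideal.mem_map_of_mem _ hy))
  suffices wardIdeal k ≤ J.comap (coproduct k) from this hx
  refine Ideal.span_le.mpr ?_
  rintro _ ⟨L, rfl⟩
  change coproduct k (ward k L) ∈ J
  rw [coproduct_ward_eq_sum]
  refine J.add_mem ?_ ?_
  · refine J.sum_mem fun K _ => J.sum_mem fun K' _ => J.sum_mem fun γ _ => ?_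
    exact Submodule.smul_of_tower_mem J _ (hl _ _ (Ideal.mul_mem_right _ _ (ward_mem k K)))
  · refine J.sum_mem fun K _ => J.sum_mem fun γ _ => ?_
    exact Submodule.smul_of_tower_mem J _ (hr _ _ (ward_mem k _))

/-- The antipode of `W_L` is determined by the relation `m ∘ (S ⊗ id) ∘ Δ = 1 ∘ ε`, in which every
other term has a factor `W_K` with `0 < K ≤ L`, or `S(W_K)` with `K < L`. -/
theorem antipode_ward_mem (L : ℕ) : antipode k (ward k L) ∈ wardIdeal k := by
  induction L using Nat.strong_induction_on with
  | _ L ih =>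
    rcases Nat.eq_zero_or_pos L with rfl | hL
    · rw [ward_zero, map_zero]
      exact zero_mem _
    have h := lift_antipode_coproduct k (ward k L)
    rw [counit_ward, map_zero, coproduct_ward k hL] at h
    simp only [map_add, map_sum, map_smul, Algebra.TensorProduct.lift_tmul, AlgHom.id_apply,
      mul_one, add_assoc] at h
    rw [eq_neg_of_add_eq_zero_left h]
    refine neg_mem (add_mem ?_ ?_)
    · refine sum_mem fun M hM => Ideal.mul_mem_right _ _ ?_
      rw [wardInsertion, map_sum]
      refine sum_mem fun K hK => ?_
      rw [map_sum]
      refine sum_mem fun γ _ => ?_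
      rw [Finset.mem_range] at hM hK
      rw [map_smul, map_mul]
      exact Submodule.smul_of_tower_mem _ _ (Ideal.mul_mem_right _ _ (ih K (by lia)))
    · refine sum_mem fun K _ => sum_mem fun γ _ => ?_
      exact Submodule.smul_of_tower_mem _ _ (Ideal.mul_mem_left _ _ (ward_mem k _))

theorem antipode_mem {x : H k} (hx : x ∈ wardIdeal k) : antipode k x ∈ wardIdeal k := by
  suffices wardIdeal k ≤ (wardIdeal k).comap (antipode k) from this hx
  refine Ideal.span_le.mpr ?_
  rintro _ ⟨L, rfl⟩
  exact antipode_ward_mem k L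

end HopfIdeal

end QED

/-- The coproduct of the Ward elements, and the resulting Hopf ideal. -/
theorem mainTheorem3 (k : Type*) [Field k] [CharZero k] :
    (∀ L : ℕ,
      coproduct k (ward k L) =
        ∑ K ∈ Finset.range (L + 1), ∑ K' ∈ Finset.range (L - K + 1), ∑ γ ∈ unions K',
            ((wardCoeff (L - K - K') γ : k) / (γ.sym : k)) •
              ((ward k K * γ.toH k) ⊗ₜ[k] green k .vertex (L - K - K')) +
          ∑ K ∈ Finset.range (L + 1), ∑ γ ∈ unions K,
            ((electronInsertionPlaces (L - K) γ : k) / (γ.sym : k)) •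
              (γ.toH k ⊗ₜ[k] ward k (L - K))) ∧
      (∀ x ∈ wardIdeal k, coproduct k x ∈ tensorIdeal k (wardIdeal k)) ∧
      (∀ x ∈ wardIdeal k, counit k x = 0) ∧
      (∀ x ∈ wardIdeal k, antipode k x ∈ wardIdeal k) :=
  ⟨coproduct_ward_eq_sum k, fun _ => coproduct_mem_tensorIdeal k, fun _ => counit_eq_zero k,
    fun _ => antipode_mem k⟩
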